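/- Let $M$ be an open subset of the space with coordinates $\mathbf u=(u_1,u_3,u_5,\dots;\hat u_{-1},\hat u_1,\hat u_3,\dots)$ on which $\hat u_{-1}$ does not vanish, let $C^\infty(M)$ be the algebra of complex valued functions that depend smoothly on finitely many of the coordinates, and let $\mathcal A=\prod_{d\ge0}\mathcal A_d$ be the algebra of differential polynomials on $M$, where $\mathcal A_d$ is the degree $d$ part of $C^\infty(M)[\mathbf u^{(s)}\mid s\ge1]$ for $\deg \mathbf u^{(s)}=s$, with the derivation $D=\sum_{s\ge0}\mathbf u^{(s+1)}\cdot\partial/\partial\mathbf u^{(s)}$. Let $\mathcal F=\mathcal A/(D(\mathcal A)\oplus\mathbb C)$ be the space of local functionals, and write $\int f\,dx$ for the class of $f\in\mathcal A$. Let $\mathcal D^-$ be the algebra of pseudo-differential operators $\sum_{i\le N} a_iD^i$, $a_i\in\mathcal A$, and $\mathcal D^+$ the algebra of operators $\sum_{i\in\mathbb Z}a_iD^i$ for which there is an integer $m$ such that $a_i$ has no component of degree $<m-i$ for all $i$; in both, $fD^i\cdot gD^j=\sum_{r\ge0}\binom ir fD^r(g)D^{i+j-r}$. For $A=\sum_i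 a_iD^i$ put $A_+=\sum_{i\ge0}a_iD^i$, $A_-=\sum_{i<0}a_iD^i$, $A^*=\sum_i(-D)^i\cdot a_i$, $\langle A\rangle=\int a_{-1}\,dx\in\mathcal F$, and for $\mathbf X=(X,\hat X)$, $\mathbf Y=(Y,\hat Y)$ in $\mathfrak D=\mathcal D^-\times\mathcal D^+$ put $\langle\mathbf X,\mathbf Y\rangle=\langle XY\rangle+\langle\hat X\hat Y\rangle$. There are unique operators $P=D+\sum_{i\ge1}u_iD^{-i}\in\mathcal D^-$ and $\hat P=D^{-1}\hat u_{-1}+\sum_{i\ge1}\hat u_iD^i\in\mathcal D^+$ whose coefficients with odd subscripts are the coordinates and which satisfy $P^*=-DPD^{-1}$ and $\hat P^*=-D\hat PD^{-1}$. For odd $k\ge1$ the two-component BKP hierarchy $$\frac{\partial P}{\partial t_k}=[(P^k)_+,P],\quad \frac{\partial\hat P}{\partial t_k}=[(P^k)_+,\hat P],\quad \frac{\partial P}{\partial\hat t_k}=[-(\hat P^k)_-,P],\quad \frac{\partial\hat P}{\partial\hat t_k}=[-(\hat P^k)_-,\hat P]$$ defines evolutionary derivations (that is, derivations commuting with $D$)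 $\partial/\partial t_k$ and $\partial/\partial\hat t_k$ of $\mathcal A$. Put $\mathbf A=(A,\hat A)=(P^2D^{-1},D\hat P^2)$. A variational gradient of $F\in\mathcal F$ is an element $\mathbf X=\delta F/\delta\mathbf A=(X,\hat X)\in\mathfrak D$ with $X^*=X$, $\hat X^*=\hat X$ and $\delta F=\langle\mathbf X,\delta\mathbf A\rangle$ for every evolutionary derivation $\delta$ of $\mathcal A$; let $\mathcal F_0$ be the set of the $F\in\mathcal F$ that have a variational gradient. For $F,G\in\mathcal F_0$ put $\{F,G\}_{i}=\big\langle \delta F/\delta\mathbf A,\mathcal P_i(\delta G/\delta\mathbf A)\big\rangle$, $i=1,2$, where $$\begin{aligned}\mathcal P_1(X,\hat X)=\big(&A(XD^{-1})_-+D^{-1}(XA)_--(D^{-1}X)_-A-(AX)_-D^{-1}\\&-A(D\hat X)_--D^{-1}(\hat A\hat X)_-+(\hat XD)_-A+(\hat X\hat A)_-D^{-1},\\&\hat A(\hat XD)_++D(\hat X\hat A)_+-(D\hat X)_+\hat A-(\hat A\hat X)_+D\\&-\hat A(D^{-1}X)_+-D(AX)_++(XD^{-1})_+\hat A+(XA)_+D\big),\\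 \mathcal P_2(X,\hat X)=\big(&A(XA)_--(AX)_-A-A(\hat A\hat X)_-+(\hat X\hat A)_-A,\\&\hat A(\hat X\hat A)_+-(\hat A\hat X)_+\hat A-\hat A(AX)_++(XA)_+\hat A\big).\end{aligned}$$ Then $\{\cdot,\cdot\}_1$ and $\{\cdot,\cdot\}_2$ do not depend on the choice of the variational gradients, and they are compatible Poisson brackets on $\mathcal F_0$: the set $\mathcal F_0$ is a linear subspace of $\mathcal F$, and for all $a,b\in\mathbb C$ the bracket $a\{\cdot,\cdot\}_1+b\{\cdot,\cdot\}_2$ maps $\mathcal F_0\times\mathcal F_0$ to $\mathcal F_0$, is bilinear and antisymmetric, and satisfies the Jacobi identity. For every odd $k\ge1$ the functionals $$H_k=\frac2k\langle P^k\rangle,\qquad \hat H_k=-\frac2k\langle\hat P^k\rangle$$ belong to $\mathcal F_0$, and the hierarchy has the bihamiltonian recursion form $$\frac{\partial F}{\partial t_k}=\{F,H_{k+2}\}_1=\{F,H_k\}_2,\qquad \frac{\partial F}{\partial\hat t_k}=\{F,\hat H_{k+2}\}_1=\{F,\hat H_k\}_2$$ for every $F\in\mathcal F_0$ and every odd $k\ge1$.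 -/

import Mathlib

open scoped ContDiff
open TopologicalSpace

noncomputable section

namespace TwoBKP

/-! ### The algebra of differential polynomials -/

/-- Labels of the coordinates of the infinite-dimensional manifold: `Sum.inl j` is the label of
`u_{2j+1}` and `Sum.inr j` is the label of `û_{2j-1}` (`j ≥ 0`). -/
abbrev Coord : Type := ℕ ⊕ ℕ

/-- The label of `û_{-1}`. -/
abbrev rhoLabel : Coord := Sum.inr 0

/-- `C^∞(M)` for an open set `M` of the coordinate space: complex valued functions on `M` which
depend smoothly on finitely many of the coordinates. -/
def SmoothSub (M : Opens (Coord → ℝ)) : Subalgebra ℂ (M → ℂ) where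
  carrier := {f | ∃ (S : Finset Coord) (g : (S → ℝ) → ℂ), ∀ x : M,
    ContDiffAt ℝ ∞ g (S.restrict x.1) ∧ f x = g (S.restrict x.1)}
  mul_mem' := by
    rintro a b ⟨S, g, hg⟩ ⟨T, h, hh⟩
    refine ⟨S ∪ T, fun y => g (fun i => y ⟨i.1, Finset.mem_union_left _ i.2⟩) *
      h (fun i => y ⟨i.1, Finset.mem_union_right _ i.2⟩), fun x => ⟨?_, ?_⟩⟩
    · refine ContDiffAt.mul ?_ ?_
      · exact ContDiffAt.comp (g := g) ((S ∪ T).restrict x.1) (hg x).1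
          (contDiff_pi.2 fun i => contDiff_apply ℝ ℝ _).contDiffAt
      · exact ContDiffAt.comp (g := h) ((S ∪ T).restrict x.1) (hh x).1
          (contDiff_pi.2 fun i => contDiff_apply ℝ ℝ _).contDiffAt
    · rw [Pi.mul_apply, (hg x).2, (hh x).2]; rfl
  add_mem' := by
    rintro a b ⟨S, g, hg⟩ ⟨T, h, hh⟩
    refine ⟨S ∪ T, fun y => g (fun i => y ⟨i.1, Finset.mem_union_left _ i.2⟩) +
      h (fun i => y ⟨i.1, Finset.mem_union_right _ i.2⟩), fun x => ⟨?_, ?_⟩⟩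
    · refine ContDiffAt.add ?_ ?_
      · exact ContDiffAt.comp (g := g) ((S ∪ T).restrict x.1) (hg x).1
          (contDiff_pi.2 fun i => contDiff_apply ℝ ℝ _).contDiffAt
      · exact ContDiffAt.comp (g := h) ((S ∪ T).restrict x.1) (hh x).1
          (contDiff_pi.2 fun i => contDiff_apply ℝ ℝ _).contDiffAt
    · rw [Pi.add_apply, (hg x).2, (hh x).2]; rfl
  algebraMap_mem' c := ⟨∅, fun _ => c, fun _ => ⟨contDiffAt_const, rfl⟩⟩

/-- The ring `C^∞(M)`. -/
def Smooth (M : Opens (Coord → ℝ)) : Type := SmoothSub M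

instance (M : Opens (Coord → ℝ)) : CommRing (Smooth M) :=
  inferInstanceAs (CommRing (SmoothSub M))

instance (M : Opens (Coord → ℝ)) : Algebra ℂ (Smooth M) :=
  inferInstanceAs (Algebra ℂ (SmoothSub M))

/-- The partial derivative of a function on `M` along the `k`-th coordinate. -/
def partialFun {M : Opens (Coord → ℝ)} (k : Coord) (f : M → ℂ) : M → ℂ := fun x =>
  lineDeriv ℝ (Function.extend Subtype.val f 0) x.1 (Pi.single k 1)

theorem partialFun_mem {M : Opens (Coord → ℝ)} (k : Coord) {f : M → ℂ} (hf : f ∈ SmoothSub M) :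
    partialFun k f ∈ SmoothSub M := by
  obtain ⟨S, g, hg⟩ := hf
  refine ⟨S, fun y => fderiv ℝ g y (S.restrict (Pi.single k 1 : Coord → ℝ)), fun x => ⟨?_, ?_⟩⟩
  · exact ((hg x).1.fderiv_right (m := ∞) (by simp)).clm_apply contDiffAt_const
  · have hd : HasFDerivAt g (fderiv ℝ g (S.restrict x.1)) (S.restrict x.1) :=
      ((hg x).1.differentiableAt (by simp)).hasFDerivAt
    have hline : HasDerivAt (fun t : ℝ => S.restrict (x.1 + t • (Pi.single k 1 : Coord → ℝ)))
        (S.restrict (Pi.single k 1 : Coord → ℝ)) 0 := by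
      refine hasDerivAt_pi.2 fun i => ?_
      have := ((hasDerivAt_id (0 : ℝ)).mul_const ((Pi.single k 1 : Coord → ℝ) i.1)).const_add
        (x.1 i.1)
      simpa [Finset.restrict] using this
    have hcomp : HasDerivAt
        (fun t : ℝ => g (S.restrict (x.1 + t • (Pi.single k 1 : Coord → ℝ))))
        (fderiv ℝ g (S.restrict x.1) (S.restrict (Pi.single k 1 : Coord → ℝ))) 0 := by
      refine HasFDerivAt.comp_hasDerivAt (0 : ℝ) (l := g) ?_ hline
      simpa using hd
    refine HasDerivAt.deriv (hcomp.congr_of_eventuallyEq ?_)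
    have hc : Continuous fun t : ℝ => x.1 + t • (Pi.single k 1 : Coord → ℝ) := by fun_prop
    have hM : ∀ᶠ t : ℝ in nhds 0, x.1 + t • (Pi.single k 1 : Coord → ℝ) ∈ M := by
      refine hc.continuousAt.eventually (M.isOpen.mem_nhds ?_)
      simp
    filter_upwards [hM] with t ht
    have := Subtype.val_injective.extend_apply f 0
      (⟨x.1 + t • (Pi.single k 1 : Coord → ℝ), ht⟩ : M)
    exact this.trans (hg ⟨_, ht⟩).2

/-- `∂/∂u_k` on `C^∞(M)`. -/
def partialSmooth {M : Opens (Coord → ℝ)} (k : Coord) (f : Smooth M) : Smooth M :=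
  ⟨partialFun k f.1, partialFun_mem k f.2⟩

/-- The `k`-th coordinate as an element of `C^∞(M)`. -/
def coordFun (M : Opens (Coord → ℝ)) (k : Coord) : Smooth M :=
  ⟨fun x => (x.1 k : ℂ), {k}, fun y => (y ⟨k, Finset.mem_singleton_self k⟩ : ℂ), fun _ =>
    ⟨(Complex.ofRealCLM.contDiff.comp (contDiff_apply ℝ ℝ _)).contDiffAt, rfl⟩⟩

/-- The polynomial ring `C^∞(M)[u_k^{(s)} | s ≥ 1]`; the variable with index `(k, s)` is
`u_k^{(s+1)}`. -/
abbrev Jet (M : Opens (Coord → ℝ)) : Type := MvPolynomial (Coord × ℕ) (Smooth M)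

/-- The degree of the variables: `deg u_k^{(s)} = s`. -/
def jetWeight (q : Coord × ℕ) : ℕ := q.2 + 1

variable {M : Opens (Coord → ℝ)}

/-- The jet variable `u_k^{(s)}`, `s ≥ 0`, with `u_k^{(0)} = u_k`. -/
def jetVar (k : Coord) : ℕ → Jet M
  | 0 => MvPolynomial.C (coordFun M k)
  | s + 1 => MvPolynomial.X (k, s)

/-- The partial derivative `∂/∂u_k^{(s)}`, `s ≥ 0`. -/
def jetPartial (k : Coord) : ℕ → Jet M → Jet M
  | 0, p => ∑ m ∈ p.support, MvPolynomial.monomial m (partialSmooth k (p.coeff m))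
  | s + 1, p => MvPolynomial.pderiv (k, s) p

/-- The total derivative `D = ∑ u_k^{(s+1)} ∂/∂u_k^{(s)}` (for each argument, only finitely many
terms are nonzero). -/
def jetD (p : Jet M) : Jet M :=
  ∑ᶠ q : Coord × ℕ, jetVar q.1 (q.2 + 1) * jetPartial q.1 q.2 p

/-- The evolutionary vector field `∑ D^s(y_k) ∂/∂u_k^{(s)}`. -/
def jetEv (y : Coord → Jet M) (p : Jet M) : Jet M :=
  ∑ᶠ q : Coord × ℕ, jetD^[q.2] (y q.1) * jetPartial q.1 q.2 p

/-- Homogeneity of degree `d`. -/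
abbrev JetHom (d : ℕ) (p : Jet M) : Prop := MvPolynomial.IsWeightedHomogeneous jetWeight p d

theorem JetHom.finsum {ι : Type*} {d : ℕ} {f : ι → Jet M} (h : ∀ i, JetHom d (f i)) :
    JetHom d (∑ᶠ i, f i) :=
  finsum_induction (JetHom d) (MvPolynomial.isWeightedHomogeneous_zero _ _ _)
    (fun _ _ hx hy => MvPolynomial.IsWeightedHomogeneous.add hx hy) h

theorem JetHom.zsmul {d : ℕ} {p : Jet M} (c : ℤ) (hp : JetHom d p) : JetHom d (c • p) :=
  (MvPolynomial.weightedHomogeneousSubmodule (Smooth M) jetWeight d).toAddSubgroup.zsmul_mem hp c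

theorem jetPartial_hom (k : Coord) (s : ℕ) {d : ℕ} {p : Jet M} (hp : JetHom d p) :
    jetPartial k s p = 0 ∨ ∃ e, e + s = d ∧ JetHom e (jetPartial k s p) := by
  cases s with
  | zero =>
    refine Or.inr ⟨d, rfl, ?_⟩
    refine MvPolynomial.IsWeightedHomogeneous.sum _ _ _ fun m hm => ?_
    exact MvPolynomial.isWeightedHomogeneous_monomial _ _ _
      (hp (MvPolynomial.mem_support_iff.1 hm))
  | succ s =>
    by_cases h : s + 1 ≤ d
    · exact Or.inr ⟨d - (s + 1), by omega,
        MvPolynomial.IsWeightedHomogeneous.pderiv hp (by simp only [jetWeight]; omega)⟩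
    · refine Or.inl (MvPolynomial.pderiv_eq_zero_of_notMem_vars fun hv => ?_)
      obtain ⟨m, hm, hkm⟩ := (MvPolynomial.mem_vars_iff_mem_support _).1 hv
      have h1 := hp (MvPolynomial.mem_support_iff.1 hm)
      have h2 := Finsupp.le_weight_of_ne_zero' jetWeight (Finsupp.mem_support_iff.1 hkm)
      simp only [jetWeight] at h1 h2
      omega

theorem jetD_hom {d : ℕ} {p : Jet M} (hp : JetHom d p) : JetHom (d + 1) (jetD p) := by
  refine JetHom.finsum fun q => ?_
  rcases jetPartial_hom q.1 q.2 hp with h | ⟨e, he, h⟩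
  · rw [h, mul_zero]
    exact MvPolynomial.isWeightedHomogeneous_zero _ _ _
  · have hX : JetHom (q.2 + 1) (jetVar q.1 (q.2 + 1) : Jet M) :=
      MvPolynomial.isWeightedHomogeneous_X _ _ (q.1, q.2)
    have := MvPolynomial.IsWeightedHomogeneous.mul hX h
    rwa [show q.2 + 1 + e = d + 1 by omega] at this

theorem jetD_iterate_hom (s : ℕ) {d : ℕ} {p : Jet M} (hp : JetHom d p) :
    JetHom (d + s) (jetD^[s] p) := by
  induction s with
  | zero => exact hp
  | succ s ih =>
    rw [Function.iterate_succ_apply']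
    exact jetD_hom ih

theorem jetEv_hom {a b : ℕ} {y : Coord → Jet M} {p : Jet M} (hy : ∀ k, JetHom a (y k))
    (hp : JetHom b p) : JetHom (a + b) (jetEv y p) := by
  refine JetHom.finsum fun q => ?_
  rcases jetPartial_hom q.1 q.2 hp with h | ⟨e, he, h⟩
  · rw [h, mul_zero]
    exact MvPolynomial.isWeightedHomogeneous_zero _ _ _
  · have := MvPolynomial.IsWeightedHomogeneous.mul (jetD_iterate_hom q.2 (hy q.1)) h
    rwa [show a + q.2 + e = a + b by omega] at this

/-- The algebra `𝒜 = ∏_{d ≥ 0} 𝒜_d` of differential polynomials: formal series `∑_d f_d` whose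
`d`-th term `f_d` is homogeneous of degree `d`.  The product is the Cauchy product. -/
def DiffAlg (M : Opens (Coord → ℝ)) : Subalgebra ℂ (PowerSeries (Jet M)) where
  carrier := {f | ∀ d, JetHom d (PowerSeries.coeff d f)}
  mul_mem' := by
    intro a b ha hb d
    rw [PowerSeries.coeff_mul]
    refine MvPolynomial.IsWeightedHomogeneous.sum _ _ _ fun p hp => ?_
    have := MvPolynomial.IsWeightedHomogeneous.mul (ha p.1) (hb p.2)
    rwa [Finset.HasAntidiagonal.mem_antidiagonal.1 hp] at this
  add_mem' := by
    intro a b ha hb d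
    rw [map_add]
    exact MvPolynomial.IsWeightedHomogeneous.add (ha d) (hb d)
  algebraMap_mem' c d := by
    rw [PowerSeries.algebraMap_apply, PowerSeries.coeff_C]
    split_ifs with h
    · subst h
      exact MvPolynomial.isWeightedHomogeneous_C _ _
    · exact MvPolynomial.isWeightedHomogeneous_zero _ _ _

/-- The homogeneous component of degree `d`. -/
def comp (d : ℕ) (f : DiffAlg M) : Jet M := PowerSeries.coeff d f.1

theorem comp_hom (d : ℕ) (f : DiffAlg M) : JetHom d (comp d f) := f.2 d

/-- The element of `𝒜` with prescribed homogeneous components. -/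
def ofComp (f : ℕ → Jet M) (hf : ∀ d, JetHom d (f d)) : DiffAlg M :=
  ⟨PowerSeries.mk f, fun d => by rw [PowerSeries.coeff_mk]; exact hf d⟩

/-- The coordinate `u_k` as an element of `𝒜`. -/
def coord (k : Coord) : DiffAlg M :=
  ofComp (fun d => if d = 0 then MvPolynomial.C (coordFun M k) else 0) fun d => by
    split_ifs with h
    · subst h
      exact MvPolynomial.isWeightedHomogeneous_C _ _
    · exact MvPolynomial.isWeightedHomogeneous_zero _ _ _

/-- The derivation `D : 𝒜_d → 𝒜_{d+1}` on `𝒜`. -/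
def der (f : DiffAlg M) : DiffAlg M :=
  ofComp (fun d => match d with
    | 0 => 0
    | d + 1 => jetD (comp d f)) fun d => by
    cases d with
    | zero => exact MvPolynomial.isWeightedHomogeneous_zero _ _ _
    | succ d => exact jetD_hom (comp_hom d f)

/-- The evolutionary derivation of `𝒜`, i.e. the derivation `δ` commuting with `D` and with
prescribed `δ u_k = Y_k ∈ 𝒜`. -/
def ev (Y : Coord → DiffAlg M) (f : DiffAlg M) : DiffAlg M :=
  ofComp (fun d => ∑ p ∈ Finset.HasAntidiagonal.antidiagonal d,
    jetEv (fun k => comp p.1 (Y k)) (comp p.2 f)) fun d => by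
    refine MvPolynomial.IsWeightedHomogeneous.sum _ _ _ fun p hp => ?_
    have := jetEv_hom (fun k => comp_hom p.1 (Y k)) (comp_hom p.2 f)
    rwa [Finset.HasAntidiagonal.mem_antidiagonal.1 hp] at this

/-- The space `𝓕 = 𝒜 / (D(𝒜) ⊕ ℂ)` of local functionals. -/
abbrev LocalFun (M : Opens (Coord → ℝ)) : Type :=
  DiffAlg M ⧸ (Submodule.span ℂ (Set.range (der (M := M))) ⊔ Submodule.span ℂ {1})

/-- The local functional `∫ f dx`. -/
def integral (f : DiffAlg M) : LocalFun M := Submodule.Quotient.mk f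

/-! ### Pseudo-differential operators -/

/-- The space `𝒟` of formal sums `∑_{i ∈ ℤ} a_i D^i` with coefficients in `𝒜`. -/
def PDO (M : Opens (Coord → ℝ)) : Type := ℤ → DiffAlg M

instance : AddCommGroup (PDO M) := inferInstanceAs (AddCommGroup (ℤ → DiffAlg M))

instance : Module ℂ (PDO M) := inferInstanceAs (Module ℂ (ℤ → DiffAlg M))

/-- The product determined by `f D^i · g D^j = ∑_{r ≥ 0} binom(i, r) f D^r(g) D^{i+j-r}`.
In a fixed degree `d` only `r ≤ d` contributes to a coefficient, and if both factors belong to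
`𝒟⁻`, or both belong to `𝒟⁺`, only finitely many `i` do. -/
def PDO.mul (a b : PDO M) : PDO M := fun n =>
  ofComp (fun d => ∑ᶠ i : ℤ, ∑ r ∈ Finset.range (d + 1),
    Ring.choose i r • comp d (a i * der^[r] (b (n - i + r)))) fun d => by
    refine JetHom.finsum fun i => MvPolynomial.IsWeightedHomogeneous.sum _ _ _ fun r _ => ?_
    exact JetHom.zsmul _ (comp_hom d _)

instance : Mul (PDO M) := ⟨PDO.mul⟩

/-- The operator of multiplication by `f ∈ 𝒜`. -/
def PDO.const (f : DiffAlg M) : PDO M := fun i => if i = 0 then f else 0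

/-- The monomial `D^j`. -/
def Dpow (j : ℤ) : PDO M := fun i => if i = j then 1 else 0

instance : One (PDO M) := ⟨Dpow 0⟩

instance : Pow (PDO M) ℕ := ⟨fun a k => npowRec k a⟩

/-- The operator `D`. -/
abbrev DD : PDO M := Dpow 1

/-- The operator `D⁻¹`. -/
abbrev DDinv : PDO M := Dpow (-1)

/-- `a ∈ 𝒟⁻`: the operator is of the first type. -/
def InMinus (a : PDO M) : Prop := ∃ N : ℤ, ∀ i : ℤ, N < i → a i = 0

/-- `a ∈ 𝒟⁺`: the operator is of the second type, i.e. the degree `d` part of its coefficient at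
`D^i` vanishes if `i + d < m`, for some `m`. -/
def InPlus (a : PDO M) : Prop := ∃ m : ℤ, ∀ (i : ℤ) (d : ℕ), i + d < m → comp d (a i) = 0

/-- The positive part `a_+`. -/
def pos (a : PDO M) : PDO M := fun i => if 0 ≤ i then a i else 0

/-- The negative part `a_-`. -/
def neg (a : PDO M) : PDO M := fun i => if i < 0 then a i else 0

/-- The adjoint `∑ (-D)^i · a_i`, whose coefficient at `D^n` is
`∑_{r ≥ 0} (-1)^{n+r} binom(n+r, r) D^r(a_{n+r})`. -/
def adj (a : PDO M) : PDO M := fun n =>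
  ofComp (fun d => ∑ r ∈ Finset.range (d + 1),
    (((n + r).negOnePow : ℤ) * Ring.choose (n + r) r) • comp d (der^[r] (a (n + r)))) fun d => by
    refine MvPolynomial.IsWeightedHomogeneous.sum _ _ _ fun r _ => ?_
    exact JetHom.zsmul _ (comp_hom d _)

/-- The commutator. -/
def comm (a b : PDO M) : PDO M := a * b - b * a

/-- `⟨a⟩ = ∫ res a dx`. -/
def tr (a : PDO M) : LocalFun M := integral (a (-1))

/-- The evolutionary derivation with `δ u_k = Y_k` acting on the coefficients of an operator. -/
def evOp (Y : Coord → DiffAlg M) (a : PDO M) : PDO M := fun i => ev Y (a i)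

/-- The inner product on `𝔇 = 𝒟⁻ × 𝒟⁺`. -/
def pair (X Y : PDO M × PDO M) : LocalFun M := tr (X.1 * Y.1) + tr (X.2 * Y.2)

/-! ### The hierarchy -/

/-- `L = (P, P̂)` is the pair of Lax operators `P = D + ∑_{i ≥ 1} u_i D^{-i} ∈ 𝒟⁻` and
`P̂ = D⁻¹ û_{-1} + ∑_{i ≥ 1} û_i D^i ∈ 𝒟⁺` subject to `P^* = -D P D⁻¹`, `P̂^* = -D P̂ D⁻¹`, whose
coefficients with odd subscripts are the coordinates of `M`. -/
structure IsLaxPair (L : PDO M × PDO M) : Prop where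
  leading : ∀ i : ℤ, 0 ≤ i → L.1 i = if i = 1 then 1 else 0
  odd_coeff : ∀ j : ℕ, L.1 (-(2 * j + 1)) = coord (Sum.inl j)
  adj_eq : adj L.1 = -(DD * L.1 * DDinv)
  hat_mem : InPlus L.2
  hat_leading : ∀ i : ℤ, i ≤ 0 → L.2 i = (DDinv * PDO.const (coord rhoLabel) : PDO M) i
  hat_odd_coeff : ∀ j : ℕ, 1 ≤ j → L.2 (2 * j - 1) = coord (Sum.inr j)
  hat_adj_eq : adj L.2 = -(DD * L.2 * DDinv)

/-- The characteristic `Y_k = ∂u_k/∂t` of the flow `∂P/∂t = [B, P]`, `∂P̂/∂t = [B, P̂]`: the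
coefficients of the right hand sides at the positions of the coordinates. -/
def laxField (L : PDO M × PDO M) (B : PDO M) : Coord → DiffAlg M
  | Sum.inl j => comm B L.1 (-(2 * j + 1))
  | Sum.inr j => comm B L.2 (2 * j - 1)

/-- The flow `∂/∂t_k`, with `B = (P^k)_+`. -/
def flow (L : PDO M × PDO M) (k : ℕ) : Coord → DiffAlg M := laxField L (pos (L.1 ^ k))

/-- The flow `∂/∂t̂_k`, with `B = -(P̂^k)_-`. -/
def flowHat (L : PDO M × PDO M) (k : ℕ) : Coord → DiffAlg M := laxField L (-neg (L.2 ^ k))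

/-- The operators `𝐀 = (P² D⁻¹, D P̂²)`. -/
def bfA (L : PDO M × PDO M) : PDO M × PDO M := (L.1 ^ 2 * DDinv, DD * L.2 ^ 2)

/-- The Hamiltonian `H_k = (2/k) ⟨P^k⟩`. -/
def ham (L : PDO M × PDO M) (k : ℕ) : LocalFun M := (2 / (k : ℂ)) • tr (L.1 ^ k)

/-- The Hamiltonian `Ĥ_k = -(2/k) ⟨P̂^k⟩`. -/
def hamHat (L : PDO M × PDO M) (k : ℕ) : LocalFun M := (-(2 / (k : ℂ))) • tr (L.2 ^ k)

/-! ### The brackets -/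

/-- `X` is a variational gradient `δF/δ𝐀` of the local functional `F`: an element of
`𝔇_0 = {X ∈ 𝒟⁻ × 𝒟⁺ | X^* = X}` such that `δF = ⟨X, δ𝐀⟩` for every variation `δ`. -/
structure IsGradient (L : PDO M × PDO M) (F : LocalFun M) (X : PDO M × PDO M) : Prop where
  mem_minus : InMinus X.1
  mem_plus : InPlus X.2
  adj_fst : adj X.1 = X.1
  adj_snd : adj X.2 = X.2
  variation : ∀ f : DiffAlg M, integral f = F → ∀ Y : Coord → DiffAlg M,
    integral (ev Y f) = pair X (evOp Y (bfA L).1, evOp Y (bfA L).2)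

/-- The set `𝓕_0` of local functionals which have a variational gradient in `𝔇`. -/
def F0 (L : PDO M × PDO M) : Set (LocalFun M) := {F | ∃ X, IsGradient L F X}

/-- The first Poisson tensor at the point `(A, Â)`. -/
def tensor₁ (A X : PDO M × PDO M) : PDO M × PDO M :=
  (A.1 * neg (X.1 * DDinv) + DDinv * neg (X.1 * A.1)
      - neg (DDinv * X.1) * A.1 - neg (A.1 * X.1) * DDinv
      - A.1 * neg (DD * X.2) - DDinv * neg (A.2 * X.2)
      + neg (X.2 * DD) * A.1 + neg (X.2 * A.2) * DDinv,
    A.2 * pos (X.2 * DD) + DD * pos (X.2 * A.2)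
      - pos (DD * X.2) * A.2 - pos (A.2 * X.2) * DD
      - A.2 * pos (DDinv * X.1) - DD * pos (A.1 * X.1)
      + pos (X.1 * DDinv) * A.2 + pos (X.1 * A.1) * DD)

/-- The second Poisson tensor at the point `(A, Â)`. -/
def tensor₂ (A X : PDO M × PDO M) : PDO M × PDO M :=
  (A.1 * neg (X.1 * A.1) - neg (A.1 * X.1) * A.1
      - A.1 * neg (A.2 * X.2) + neg (X.2 * A.2) * A.1,
    A.2 * pos (X.2 * A.2) - pos (A.2 * X.2) * A.2
      - A.2 * pos (A.1 * X.1) + pos (X.1 * A.1) * A.2)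

open Classical in
/-- The bracket `{F, G}(𝐀) = ⟨δF/δ𝐀, 𝒫(δG/δ𝐀)⟩` of `F, G ∈ 𝓕_0` defined by the tensor `𝒫` at the
point `𝐀` (by convention `0` outside `𝓕_0`). -/
def bracket (T : PDO M × PDO M → PDO M × PDO M → PDO M × PDO M) (L : PDO M × PDO M)
    (F G : LocalFun M) : LocalFun M :=
  if h : F ∈ F0 L ∧ G ∈ F0 L then pair h.1.choose (T (bfA L) h.2.choose) else 0

/-- The first bracket `{·,·}_1`. -/
def bracket₁ (L : PDO M × PDO M) : LocalFun M → LocalFun M → LocalFun M := bracket tensor₁ L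

/-- The second bracket `{·,·}_2`. -/
def bracket₂ (L : PDO M × PDO M) : LocalFun M → LocalFun M → LocalFun M := bracket tensor₂ L

/-- `b` is a Poisson bracket on the set `S` of functionals: `S` is a linear subspace closed under
`b`, and `b` is a Lie bracket on `S`. -/
structure IsPoissonBracket {V : Type*} [AddCommGroup V] [Module ℂ V] (S : Set V)
    (b : V → V → V) : Prop where
  zero_mem : (0 : V) ∈ S
  add_mem : ∀ F ∈ S, ∀ G ∈ S, F + G ∈ S
  smul_mem : ∀ c : ℂ, ∀ F ∈ S, c • F ∈ S
  bracket_mem : ∀ F ∈ S, ∀ G ∈ S, b F G ∈ S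
  add_left : ∀ F ∈ S, ∀ G ∈ S, ∀ H ∈ S, b (F + G) H = b F H + b G H
  smul_left : ∀ c : ℂ, ∀ F ∈ S, ∀ G ∈ S, b (c • F) G = c • b F G
  skew : ∀ F ∈ S, ∀ G ∈ S, b F G = -b G F
  jacobi : ∀ F ∈ S, ∀ G ∈ S, ∀ H ∈ S, b (b F G) H + b (b G H) F + b (b H F) G = 0

end TwoBKP

end

/-!
# The bihamiltonian structure of the two-component BKP hierarchy

**Operators.** `PDO.mul` is associative on `𝒟⁻` and on `𝒟⁺` because both are filtered by a weight
(`cone`) in which products are locally finite sums (`HasS`): by additivity and continuity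
associativity follows from the cases where the left factor is a function or the operator `D`. In the
same way the adjoint is an anti-automorphism (`adj_mul`), and the trace is cyclic
(`tr_mul_comm`), so that `𝔇 = 𝒟⁻ × 𝒟⁺` is a ring with involution and trace.

**The quadratic bracket.** On `𝔇` let `π (U, V) = (U_- + (V_-)^*, V_+ + (U_+)^*)`. This is a
projection whose image `{(W, Ŵ) | W = W_-, Ŵ = Ŵ_+}` and kernel `{(Z, -Z^*)}` are isotropic Lie
subalgebras (`splitD`). For antisymmetric `A` and symmetric `X` the second tensor is
`A ↦ A W + W^* A` with `W = π (X A)`. For any `SplitRing` this tensor is skew (`tensor_skew`), the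
gradient of the bracket of two functionals can be written down (`variation_tensor`), and the
commutator of two hamiltonian vector fields is the hamiltonian vector field of that gradient
(`commutator_tensor`). The Jacobi identity follows (`trD_tensor_jacobi`), provided that the values
of the tensor are tangent to the manifold of the operators `(A, Â)`: then they are evolutionary
derivations, which act on functionals.

**Compatibility.** Replacing `A` by `A + ε J` with `J = (D⁻¹, D)` changes the second tensor by `ε`
times the first one, the quadratic term being zero on symmetric operators (`bilD_JD`). So
`{·,·}₂ ± {·,·}₁` are again brackets of the same kind, and three points of the pencil suffice for
its bilinear Jacobi identities (`IsPoissonBracket.pencil`).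

**Tangent vectors.** An operator `T` with `T^* = -DTD⁻¹` is determined by its odd coefficients, and
these can be prescribed (`IsLax.eq_zero`, `exists_isLax`); this gives the Lax pair. By a fixed point
argument on the odd coefficients, which uses that `û_{-1}` is invertible, every antisymmetric pair
`(B, B̂)` with `B` of negative order and `B̂_- = (ρ D⁻¹ σ + σ D⁻¹ ρ)_-`, `ρ = û_{-1}`, is a variation
of `(A, Â)` (`IsLaxPair.exists_evDd_A_eq`). The values of the tensors at `A` and `A ± J` have this
form (`IsLaxPair.isAdmissible`).

**The hierarchy.** For odd `k` the operators `P^k`, `P̂^k`, their positive and their negative parts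
satisfy `T^* = -DTD⁻¹` as well, so that the Lax equations hold for all coefficients once they hold
for the odd ones (`IsLaxPair.evOp_laxField`). The gradients of `H_k` and `Ĥ_k` are `(D P^{k-2}, 0)`
and `(0, -P̂^{k-2} D⁻¹)` if `k ≥ 3`, and `(1, 0)` and `(0, -ρ⁻¹)` if `k = 1`. Applied to them, both
tensors give `A W + W^* A` with `W = (-(Q_-)^*, -Q_+)` and `Q = P^k` or `Q = P̂^k`, which is the flow
`∂/∂t_k` or `∂/∂t̂_k` of `(A, Â)`.
-/

noncomputable section

namespace TwoBKP

variable {M : Opens (Coord → ℝ)}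

/-! ### Smooth functions and their partial derivatives -/

/-- `f` is represented by the function `g` of the coordinates in `S`. -/
def Represents (f : M → ℂ) (S : Finset Coord) (g : (S → ℝ) → ℂ) : Prop :=
  ∀ x : M, ContDiffAt ℝ ∞ g (S.restrict x.1) ∧ f x = g (S.restrict x.1)

theorem Represents.hasDerivAt {f : M → ℂ} {S : Finset Coord} {g : (S → ℝ) → ℂ}
    (hg : Represents f S g) (k : Coord) (x : M) :
    HasDerivAt (fun t : ℝ => Function.extend Subtype.val f 0 (x.1 + t • (Pi.single k 1 : Coord → ℝ)))
      (fderiv ℝ g (S.restrict x.1) (S.restrict (Pi.single k 1 : Coord → ℝ))) 0 := by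
  have hd : HasFDerivAt g (fderiv ℝ g (S.restrict x.1)) (S.restrict x.1) :=
    ((hg x).1.differentiableAt (by simp)).hasFDerivAt
  have hline : HasDerivAt (fun t : ℝ => S.restrict (x.1 + t • (Pi.single k 1 : Coord → ℝ)))
      (S.restrict (Pi.single k 1 : Coord → ℝ)) 0 := by
    refine hasDerivAt_pi.2 fun i => ?_
    have := ((hasDerivAt_id (0 : ℝ)).mul_const ((Pi.single k 1 : Coord → ℝ) i.1)).const_add
      (x.1 i.1)
    simpa [Finset.restrict] using this
  have hcomp : HasDerivAt
      (fun t : ℝ => g (S.restrict (x.1 + t • (Pi.single k 1 : Coord → ℝ))))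
      (fderiv ℝ g (S.restrict x.1) (S.restrict (Pi.single k 1 : Coord → ℝ))) 0 := by
    refine HasFDerivAt.comp_hasDerivAt (0 : ℝ) (l := g) ?_ hline
    simpa using hd
  refine hcomp.congr_of_eventuallyEq ?_
  have hc : Continuous fun t : ℝ => x.1 + t • (Pi.single k 1 : Coord → ℝ) := by fun_prop
  have hM : ∀ᶠ t : ℝ in nhds 0, x.1 + t • (Pi.single k 1 : Coord → ℝ) ∈ M := by
    refine hc.continuousAt.eventually (M.isOpen.mem_nhds ?_)
    simp
  filter_upwards [hM] with t ht
  have := Subtype.val_injective.extend_apply f 0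
    (⟨x.1 + t • (Pi.single k 1 : Coord → ℝ), ht⟩ : M)
  exact this.trans (hg ⟨_, ht⟩).2

theorem Represents.partialFun_eq {f : M → ℂ} {S : Finset Coord} {g : (S → ℝ) → ℂ}
    (hg : Represents f S g) (k : Coord) (x : M) :
    partialFun k f x = fderiv ℝ g (S.restrict x.1) (S.restrict (Pi.single k 1 : Coord → ℝ)) :=
  (hg.hasDerivAt k x).deriv

theorem Represents.partialFun {f : M → ℂ} {S : Finset Coord} {g : (S → ℝ) → ℂ}
    (hg : Represents f S g) (k : Coord) :
    Represents (partialFun k f) S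
      (fun y => fderiv ℝ g y (S.restrict (Pi.single k 1 : Coord → ℝ))) := fun x =>
  ⟨((hg x).1.fderiv_right (m := ∞) (by simp)).clm_apply contDiffAt_const, hg.partialFun_eq k x⟩

theorem partialFun_hasDerivAt {f : M → ℂ} (hf : f ∈ SmoothSub M) (k : Coord) (x : M) :
    HasDerivAt (fun t : ℝ => Function.extend Subtype.val f 0 (x.1 + t • (Pi.single k 1 : Coord → ℝ)))
      (partialFun k f x) 0 := by
  obtain ⟨S, g, hg⟩ := hf
  rw [Represents.partialFun_eq hg]
  exact Represents.hasDerivAt hg k x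

theorem extend_zero_add (f g : M → ℂ) (y : Coord → ℝ) :
    Function.extend Subtype.val (f + g) 0 y =
      Function.extend Subtype.val f 0 y + Function.extend Subtype.val g 0 y := by
  by_cases h : y ∈ M
  · have e := fun f : M → ℂ => Subtype.val_injective.extend_apply f 0 (⟨y, h⟩ : M)
    simp only at e
    rw [e, e, e]; rfl
  · have e := fun f : M → ℂ => Function.extend_apply' (f := (Subtype.val : M → _)) f 0 y
      (fun ⟨a, ha⟩ => h (ha ▸ a.2))
    rw [e, e, e]; simp

theorem extend_zero_mul (f g : M → ℂ) (y : Coord → ℝ) :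
    Function.extend Subtype.val (f * g) 0 y =
      Function.extend Subtype.val f 0 y * Function.extend Subtype.val g 0 y := by
  by_cases h : y ∈ M
  · have e := fun f : M → ℂ => Subtype.val_injective.extend_apply f 0 (⟨y, h⟩ : M)
    simp only at e
    rw [e, e, e]; rfl
  · have e := fun f : M → ℂ => Function.extend_apply' (f := (Subtype.val : M → _)) f 0 y
      (fun ⟨a, ha⟩ => h (ha ▸ a.2))
    rw [e, e, e]; simp

theorem partialSmooth_add (k : Coord) (f g : Smooth M) :
    partialSmooth k (f + g) = partialSmooth k f + partialSmooth k g := by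
  refine Subtype.ext (funext fun x => ?_)
  refine HasDerivAt.deriv (((partialFun_hasDerivAt f.2 k x).add
    (partialFun_hasDerivAt g.2 k x)).congr_of_eventuallyEq (.of_forall fun t => ?_))
  exact extend_zero_add f.1 g.1 _

theorem partialSmooth_mul (k : Coord) (f g : Smooth M) :
    partialSmooth k (f * g) = f * partialSmooth k g + partialSmooth k f * g := by
  refine Subtype.ext (funext fun x => ?_)
  have h := (partialFun_hasDerivAt f.2 k x).mul (partialFun_hasDerivAt g.2 k x)
  have e := fun f : M → ℂ => Subtype.val_injective.extend_apply f 0 x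
  simp only [zero_smul, add_zero, e] at h
  refine (HasDerivAt.deriv (h.congr_of_eventuallyEq (.of_forall fun t => ?_))).trans ?_
  · exact extend_zero_mul f.1 g.1 _
  · exact add_comm _ _

theorem partialSmooth_comm (j k : Coord) (f : Smooth M) :
    partialSmooth j (partialSmooth k f) = partialSmooth k (partialSmooth j f) := by
  obtain ⟨f, S, g, hg⟩ := f
  replace hg : Represents f S g := hg
  refine Subtype.ext (funext fun x => ?_)
  change partialFun j (partialFun k f) x = partialFun k (partialFun j f) x
  rw [(hg.partialFun k).partialFun_eq, (hg.partialFun j).partialFun_eq]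
  have hd : DifferentiableAt ℝ (fderiv ℝ g) (S.restrict x.1) :=
    ((hg x).1.fderiv_right (m := ∞) (by simp)).differentiableAt (by simp)
  have key : ∀ v w : S → ℝ, fderiv ℝ (fun y => fderiv ℝ g y v) (S.restrict x.1) w =
      fderiv ℝ (fderiv ℝ g) (S.restrict x.1) w v := fun v w => by
    rw [fderiv_clm_apply hd (differentiableAt_const v)]
    simp
  rw [key, key]
  exact ((hg x).1.isSymmSndFDerivAt (by simp; exact WithTop.coe_le_coe.2 le_top)).eq _ _

/-- A smooth function depends on finitely many coordinates only. -/
theorem partialSmooth_finite (f : Smooth M) :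
    ∃ S : Finset Coord, ∀ k ∉ S, partialSmooth k f = 0 := by
  obtain ⟨f, S, g, hg⟩ := f
  refine ⟨S, fun k hk => Subtype.ext (funext fun x => ?_)⟩
  refine (Represents.partialFun_eq hg k x).trans ?_
  have : S.restrict (Pi.single k 1 : Coord → ℝ) = 0 := by
    funext i
    have : i.1 ≠ k := fun h => hk (h ▸ i.2)
    simp [Finset.restrict, this]
  rw [this, map_zero]; rfl

theorem partialSmooth_algebraMap (k : Coord) (c : ℂ) :
    partialSmooth k (algebraMap ℂ (Smooth M) c) = 0 := by
  have hg : Represents (M := M) (fun _ => c) ∅ (fun _ => c) := fun x => ⟨contDiffAt_const, rfl⟩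
  refine Subtype.ext (funext fun x => (hg.partialFun_eq k x).trans ?_)
  simp; rfl

theorem partialSmooth_coordFun (j k : Coord) :
    partialSmooth j (coordFun M k) = if j = k then 1 else 0 := by
  have hg : Represents (M := M) (fun x => (x.1 k : ℂ)) {k}
    (fun y => (y ⟨k, Finset.mem_singleton_self k⟩ : ℂ)) := fun x =>
    ⟨(Complex.ofRealCLM.contDiff.comp (contDiff_apply ℝ ℝ _)).contDiffAt, rfl⟩
  refine Subtype.ext (funext fun x => (hg.partialFun_eq j x).trans ?_)
  have h := (Complex.ofRealCLM.hasFDerivAt).comp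
    (Finset.restrict ({k} : Finset Coord) x.1)
    (ContinuousLinearMap.proj (R := ℝ) (φ := fun _ : ({k} : Finset Coord) => ℝ)
      ⟨k, Finset.mem_singleton_self k⟩).hasFDerivAt
  have h' : fderiv ℝ (fun y : ({k} : Finset Coord) → ℝ =>
      (y ⟨k, Finset.mem_singleton_self k⟩ : ℂ)) (Finset.restrict ({k} : Finset Coord) x.1) = _ :=
    h.fderiv
  rw [h']
  split_ifs with hjk
  · subst hjk
    simp [Finset.restrict]; rfl
  · simp [Finset.restrict, Ne.symm hjk]; rfl

/-- The partial derivatives of smooth functions as derivations. -/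
def partialD (k : Coord) : Derivation ℂ (Smooth M) (Smooth M) :=
  Derivation.mk'
    { toFun := partialSmooth k
      map_add' := partialSmooth_add k
      map_smul' := fun c f => by
        rw [Algebra.smul_def, partialSmooth_mul, partialSmooth_algebraMap, zero_mul, add_zero,
          RingHom.id_apply, Algebra.smul_def] }
    (fun f g => by
      change partialSmooth k (f * g) = f • partialSmooth k g + g • partialSmooth k f
      rw [partialSmooth_mul, smul_eq_mul, smul_eq_mul, mul_comm g])

/-! ### Derivations of the ring of jets -/

theorem coeff_jetPartial_zero (k : Coord) (p : Jet M) (m : (Coord × ℕ) →₀ ℕ) :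
    (jetPartial k 0 p).coeff m = partialD k (p.coeff m) := by
  classical
  simp only [jetPartial, MvPolynomial.coeff_sum, MvPolynomial.coeff_monomial]
  rw [Finset.sum_ite_eq' p.support m fun m => partialSmooth k (p.coeff m)]
  split_ifs with h
  · rfl
  · rw [MvPolynomial.notMem_support_iff.1 h, map_zero]

/-- The partial derivatives `∂/∂u_k^{(s)}` of jets as derivations. -/
def jetPartialD (k : Coord) : ℕ → Derivation ℂ (Jet M) (Jet M)
  | 0 => Derivation.mk'
    { toFun := jetPartial k 0
      map_add' := fun p q => by ext1 m; simp [coeff_jetPartial_zero]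
      map_smul' := fun c p => by ext1 m; simp [coeff_jetPartial_zero] }
    (fun p q => by
      classical
      ext1 m
      simp only [LinearMap.coe_mk, AddHom.coe_mk, smul_eq_mul, MvPolynomial.coeff_add,
        MvPolynomial.coeff_mul, coeff_jetPartial_zero, map_sum, Derivation.leibniz,
        Finset.sum_add_distrib]
      congr 1
      rw [← Finsupp.sum_antidiagonal_swap m fun a b => q.coeff b * partialD k (p.coeff a)]
      )
  | s + 1 => (MvPolynomial.pderiv (R := Smooth M) (k, s)).restrictScalars ℂ

theorem jetPartialD_apply (k : Coord) (s : ℕ) (p : Jet M) :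
    jetPartialD k s p = jetPartial k s p := by
  cases s <;> rfl

theorem jetPartialD_C_zero (k : Coord) (f : Smooth M) :
    jetPartialD k 0 (MvPolynomial.C f) = MvPolynomial.C (partialSmooth k f) := by
  classical
  rw [jetPartialD_apply]
  ext1 m
  rw [coeff_jetPartial_zero, MvPolynomial.coeff_C, MvPolynomial.coeff_C]
  split_ifs
  · rfl
  · rw [map_zero]

theorem jetPartialD_C_succ (k : Coord) (s : ℕ) (f : Smooth M) :
    jetPartialD k (s + 1) (MvPolynomial.C f) = 0 :=
  MvPolynomial.pderiv_C

theorem jetPartialD_X_zero (k : Coord) (q : Coord × ℕ) :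
    jetPartialD k 0 (MvPolynomial.X q : Jet M) = 0 := by
  classical
  rw [jetPartialD_apply]
  ext1 m
  rw [coeff_jetPartial_zero, MvPolynomial.coeff_X]
  split_ifs
  · rw [Derivation.map_one_eq_zero]; rfl
  · rw [map_zero]; rfl

theorem jetPartialD_X_succ (k : Coord) (s : ℕ) (q : Coord × ℕ) :
    jetPartialD k (s + 1) (MvPolynomial.X q : Jet M) = if (k, s) = q then 1 else 0 := by
  classical
  change MvPolynomial.pderiv (k, s) (MvPolynomial.X q : Jet M) = _
  rw [MvPolynomial.pderiv_X, Pi.single_apply]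
  simp only [eq_comm]

/-- Two derivations of the ring of jets that agree on functions and on jet variables agree. -/
theorem jet_derivation_ext {d₁ d₂ : Derivation ℂ (Jet M) (Jet M)}
    (hC : ∀ f, d₁ (MvPolynomial.C f) = d₂ (MvPolynomial.C f))
    (hX : ∀ q, d₁ (MvPolynomial.X q) = d₂ (MvPolynomial.X q)) : d₁ = d₂ := by
  refine Derivation.ext fun p => ?_
  induction p using MvPolynomial.induction_on with
  | C f => rw [hC]
  | add p q hp hq => rw [map_add, map_add, hp, hq]
  | mul_X p q hp => rw [Derivation.leibniz, Derivation.leibniz, hp, hX]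

theorem jetPartialD_comm (a b : Coord × ℕ) (p : Jet M) :
    jetPartialD a.1 a.2 (jetPartialD b.1 b.2 p) = jetPartialD b.1 b.2 (jetPartialD a.1 a.2 p) := by
  suffices h : ⁅(jetPartialD a.1 a.2 : Derivation ℂ (Jet M) (Jet M)), jetPartialD b.1 b.2⁆ = 0 by
    have := congrArg (fun d : Derivation ℂ (Jet M) (Jet M) => d p) h
    simpa [Derivation.commutator_apply, sub_eq_zero] using this
  obtain ⟨j, s⟩ := a
  obtain ⟨k, t⟩ := b
  refine jet_derivation_ext (fun f => ?_) fun q => ?_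
  · cases s <;> cases t <;>
      simp [Derivation.commutator_apply, jetPartialD_C_zero, jetPartialD_C_succ,
        partialSmooth_comm j k]
  · cases s <;> cases t <;>
      simp only [Derivation.commutator_apply, jetPartialD_X_zero, jetPartialD_X_succ, map_zero,
        Derivation.coe_zero, Pi.zero_apply, sub_self] <;> split_ifs <;> simp

/-- A jet depends on finitely many of the variables `u_k^{(s)}` only. -/
theorem jetPartialD_finite (p : Jet M) :
    {q : Coord × ℕ | jetPartialD q.1 q.2 p ≠ 0}.Finite := by
  classical
  induction p using MvPolynomial.induction_on with
  | C f =>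
    obtain ⟨S, hS⟩ := partialSmooth_finite f
    refine (S ×ˢ {0}).finite_toSet.subset fun q hq => ?_
    obtain ⟨k, s⟩ := q
    cases s with
    | zero =>
      simp only [Finset.coe_product, Set.mem_prod, Finset.mem_coe, Finset.mem_singleton, and_true]
      by_contra hk
      refine hq ?_
      simp only [jetPartialD_C_zero, hS k hk, map_zero]
    | succ s => exact absurd (jetPartialD_C_succ k s f) hq
  | add p q hp hq =>
    refine (hp.union hq).subset fun a ha => ?_
    by_contra h
    simp only [Set.mem_union, Set.mem_ofPred_eq, not_or, not_not] at h
    exact ha (by rw [map_add, h.1, h.2, add_zero])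
  | mul_X p q hp =>
    refine (hp.union (Set.finite_singleton (q.1, q.2 + 1))).subset fun a ha => ?_
    by_contra h
    simp only [Set.mem_union, Set.mem_ofPred_eq, not_or, not_not, Set.mem_singleton_iff] at h
    refine ha ?_
    rw [Derivation.leibniz, h.1, smul_zero, add_zero]
    obtain ⟨k, s⟩ := a
    cases s with
    | zero => rw [jetPartialD_X_zero, smul_zero]
    | succ s =>
      rw [jetPartialD_X_succ, if_neg, smul_zero]
      rintro rfl
      exact h.2 rfl

theorem jetPartialD_finsupp (c : Coord × ℕ → Jet M) (p : Jet M) :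
    (Function.support fun q : Coord × ℕ => c q * jetPartialD q.1 q.2 p).Finite :=
  (jetPartialD_finite p).subset fun q hq h => hq (by simp only [h, mul_zero])

/-- The derivation `∑_q c_q ∂/∂u_q` of the ring of jets. -/
def vf (c : Coord × ℕ → Jet M) : Derivation ℂ (Jet M) (Jet M) :=
  Derivation.mk'
    { toFun := fun p => ∑ᶠ q : Coord × ℕ, c q * jetPartialD q.1 q.2 p
      map_add' := fun p p' => by
        rw [← finsum_add_distrib (jetPartialD_finsupp c p) (jetPartialD_finsupp c p')]
        simp only [map_add, mul_add]
      map_smul' := fun a p => by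
        rw [RingHom.id_apply, smul_finsum' _ (jetPartialD_finsupp c p)]
        simp only [Derivation.map_smul, mul_smul_comm] }
    (fun p p' => by
      simp only [LinearMap.coe_mk, AddHom.coe_mk, smul_eq_mul]
      rw [mul_finsum' _ _ (jetPartialD_finsupp c p'), mul_finsum' _ _ (jetPartialD_finsupp c p),
        ← finsum_add_distrib]
      · refine finsum_congr fun q => ?_
        rw [Derivation.leibniz, smul_eq_mul, smul_eq_mul]
        ring
      · exact (jetPartialD_finsupp c p').subset fun q hq h => hq (by simp only [h, mul_zero])
      · exact (jetPartialD_finsupp c p).subset fun q hq h => hq (by simp only [h, mul_zero]))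

theorem vf_apply (c : Coord × ℕ → Jet M) (p : Jet M) :
    vf c p = ∑ᶠ q : Coord × ℕ, c q * jetPartialD q.1 q.2 p := rfl

theorem jetD_eq_vf (p : Jet M) : jetD p = vf (fun q => MvPolynomial.X q) p := by
  simp only [jetD, vf_apply, jetPartialD_apply, jetVar]

theorem jetEv_eq_vf (y : Coord → Jet M) (p : Jet M) :
    jetEv y p = vf (fun q => jetD^[q.2] (y q.1)) p := by
  simp only [jetEv, vf_apply, jetPartialD_apply]

theorem vf_X (c : Coord × ℕ → Jet M) (k : Coord) (s : ℕ) :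
    vf c (MvPolynomial.X (k, s)) = c (k, s + 1) := by
  rw [vf_apply, finsum_eq_single _ (k, s + 1)]
  · simp [jetPartialD_X_succ]
  · rintro ⟨j, t⟩ h
    cases t with
    | zero => rw [jetPartialD_X_zero, mul_zero]
    | succ t =>
      rw [jetPartialD_X_succ, if_neg, mul_zero]
      rintro h'
      obtain ⟨rfl, rfl⟩ := Prod.mk.injEq _ _ _ _ ▸ h'
      exact h rfl

theorem vf_coordFun (c : Coord × ℕ → Jet M) (k : Coord) :
    vf c (MvPolynomial.C (coordFun M k)) = c (k, 0) := by
  rw [vf_apply, finsum_eq_single _ (k, 0)]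
  · simp [jetPartialD_C_zero, partialSmooth_coordFun]
  · rintro ⟨j, t⟩ h
    cases t with
    | zero =>
      rw [jetPartialD_C_zero, partialSmooth_coordFun, if_neg, map_zero, mul_zero]
      rintro rfl
      exact h rfl
    | succ t => rw [jetPartialD_C_succ, mul_zero]

theorem vf_add (c c' : Coord × ℕ → Jet M) (p : Jet M) : vf (c + c') p = vf c p + vf c' p := by
  simp only [vf_apply]
  rw [← finsum_add_distrib (jetPartialD_finsupp c p) (jetPartialD_finsupp c' p)]
  simp only [Pi.add_apply, add_mul]

theorem vf_smul (a : ℂ) (c : Coord × ℕ → Jet M) (p : Jet M) : vf (a • c) p = a • vf c p := by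
  simp only [vf_apply]
  rw [smul_finsum' _ (jetPartialD_finsupp c p)]
  simp only [Pi.smul_apply, smul_mul_assoc]

theorem vf_zero (p : Jet M) : vf (0 : Coord × ℕ → Jet M) p = 0 := by
  simp [vf_apply]

/-- The commutator of two vector fields; the mixed partial derivatives cancel. -/
theorem vf_comm (a b : Coord × ℕ → Jet M) (p : Jet M) :
    vf a (vf b p) - vf b (vf a p) = vf (fun q => vf a (b q) - vf b (a q)) p := by
  classical
  have h1 : ∀ a b : Coord × ℕ → Jet M, vf a (vf b p) =
      (∑ᶠ q : Coord × ℕ, vf a (b q) * jetPartialD q.1 q.2 p) +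
      ∑ q ∈ (jetPartialD_finite p).toFinset, ∑ r ∈ (jetPartialD_finite p).toFinset,
        b q * (a r * jetPartialD r.1 r.2 (jetPartialD q.1 q.2 p)) := by
    intro a b
    have hs : ∀ c : Coord × ℕ → Jet M, (Function.support fun q : Coord × ℕ =>
        c q * jetPartialD q.1 q.2 p) ⊆ ↑(jetPartialD_finite p).toFinset := fun c q hq => by
      rw [Set.Finite.coe_toFinset]
      exact fun h => hq (by simp only [h, mul_zero])
    rw [vf_apply b, finsum_eq_sum_of_support_subset _ (hs b),
      finsum_eq_sum_of_support_subset _ (hs fun q => vf a (b q)), map_sum,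
      ← Finset.sum_add_distrib]
    refine Finset.sum_congr rfl fun q _ => ?_
    rw [Derivation.leibniz, smul_eq_mul, smul_eq_mul, mul_comm (jetPartialD q.1 q.2 p),
      add_comm]
    congr 1
    rw [← Finset.mul_sum, vf_apply a, finsum_eq_sum_of_support_subset]
    intro r hr
    rw [Set.Finite.coe_toFinset]
    intro h
    refine hr ?_
    simp only
    rw [jetPartialD_comm r q, h, map_zero, mul_zero]
  rw [h1 a b, h1 b a, Finset.sum_comm (s := (jetPartialD_finite p).toFinset)
    (f := fun q r => a q * (b r * jetPartialD r.1 r.2 (jetPartialD q.1 q.2 p)))]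
  have h2 : ∀ q r : Coord × ℕ, a r * (b q * jetPartialD q.1 q.2 (jetPartialD r.1 r.2 p)) =
      b q * (a r * jetPartialD r.1 r.2 (jetPartialD q.1 q.2 p)) := fun q r => by
    rw [jetPartialD_comm q r]; ring
  simp only [h2, add_sub_add_right_eq_sub]
  rw [vf_apply, ← finsum_sub_distrib (jetPartialD_finsupp (fun q => vf a (b q)) p)
    (jetPartialD_finsupp (fun q => vf b (a q)) p)]
  simp only [sub_mul]

/-- The total derivative of jets as a derivation. -/
def jetDD : Derivation ℂ (Jet M) (Jet M) := vf fun q => MvPolynomial.X q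

theorem jetD_eq : (jetD : Jet M → Jet M) = jetDD := funext jetD_eq_vf

theorem jetEv_jetD (y : Coord → Jet M) (p : Jet M) : jetEv y (jetD p) = jetD (jetEv y p) := by
  rw [jetEv_eq_vf, jetEv_eq_vf, jetD_eq_vf, jetD_eq_vf, ← sub_eq_zero, vf_comm]
  refine (congrArg (fun c => vf c p) (funext fun q => ?_)).trans (vf_zero p)
  rw [vf_X, ← jetD_eq_vf, Function.iterate_succ_apply', sub_self]
  rfl

theorem jetEv_jetD_iterate (y : Coord → Jet M) (n : ℕ) (p : Jet M) :
    jetEv y (jetD^[n] p) = jetD^[n] (jetEv y p) := by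
  induction n with
  | zero => rfl
  | succ n ih => rw [Function.iterate_succ_apply', Function.iterate_succ_apply', jetEv_jetD, ih]

theorem jetD_iterate_sub (n : ℕ) (p q : Jet M) :
    jetD^[n] (p - q) = jetD^[n] p - jetD^[n] q := by
  rw [jetD_eq]; exact iterate_map_sub jetDD n p q

theorem jetD_iterate_add (n : ℕ) (p q : Jet M) :
    jetD^[n] (p + q) = jetD^[n] p + jetD^[n] q := by
  rw [jetD_eq]; exact iterate_map_add jetDD n p q

theorem jetD_iterate_smul (n : ℕ) (a : ℂ) (p : Jet M) :
    jetD^[n] (a • p) = a • jetD^[n] p := by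
  induction n with
  | zero => rfl
  | succ n ih =>
    rw [Function.iterate_succ_apply', Function.iterate_succ_apply', ih, jetD_eq, Derivation.map_smul]

/-- The commutator of two evolutionary vector fields is evolutionary. -/
theorem jetEv_comm (y z : Coord → Jet M) (p : Jet M) :
    jetEv y (jetEv z p) - jetEv z (jetEv y p) =
      jetEv (fun k => jetEv y (z k) - jetEv z (y k)) p := by
  rw [jetEv_eq_vf z p, jetEv_eq_vf y p, jetEv_eq_vf y, jetEv_eq_vf z, jetEv_eq_vf _ p, vf_comm]
  refine congrArg (fun c => vf c p) (funext fun q => ?_)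
  rw [← jetEv_eq_vf, ← jetEv_eq_vf, jetEv_jetD_iterate, jetEv_jetD_iterate, jetD_iterate_sub]

/-- The evolutionary vector field as a bilinear map of its characteristic and its argument. -/
def jetEvL : (Coord → Jet M) →ₗ[ℂ] Jet M →ₗ[ℂ] Jet M :=
  LinearMap.mk₂ ℂ jetEv
    (fun y z p => by
      rw [jetEv_eq_vf, jetEv_eq_vf, jetEv_eq_vf, ← vf_add]
      exact congrArg (fun c => vf c p) (funext fun q => jetD_iterate_add _ _ _))
    (fun a y p => by
      rw [jetEv_eq_vf, jetEv_eq_vf, ← vf_smul]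
      exact congrArg (fun c => vf c p) (funext fun q => jetD_iterate_smul _ _ _))
    (fun y p q => by rw [jetEv_eq_vf, jetEv_eq_vf, jetEv_eq_vf, map_add])
    (fun a y p => by rw [jetEv_eq_vf, jetEv_eq_vf, Derivation.map_smul])

theorem jetEvL_apply (y : Coord → Jet M) (p : Jet M) : jetEvL y p = jetEv y p := rfl

theorem jetEv_mul (y : Coord → Jet M) (p q : Jet M) :
    jetEv y (p * q) = p * jetEv y q + jetEv y p * q := by
  rw [jetEv_eq_vf, jetEv_eq_vf, jetEv_eq_vf, Derivation.leibniz, smul_eq_mul, smul_eq_mul,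
    mul_comm q]

theorem jetD_mul (p q : Jet M) : jetD (p * q) = p * jetD q + jetD p * q := by
  rw [jetD_eq, Derivation.leibniz, smul_eq_mul, smul_eq_mul, mul_comm q]

theorem jetEv_coordFun (y : Coord → Jet M) (k : Coord) :
    jetEv y (MvPolynomial.C (coordFun M k)) = y k := by
  rw [jetEv_eq_vf, vf_coordFun]; rfl

/-! ### Derivations of the algebra of differential polynomials -/

/- The priority keeps instance search from trying the algebra structures of `DiffAlg M` first
whenever an integer acts on it. -/
instance (priority := 10000) : ZSMul (DiffAlg M) := SubNegMonoid.toZSMul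

instance (priority := 10000) : Module ℤ (DiffAlg M) := AddCommGroup.toIntModule _

theorem sum_antidiagonal_assoc {V : Type*} [AddCommMonoid V] (F : ℕ → ℕ → ℕ → V) (d : ℕ) :
    ∑ p ∈ Finset.HasAntidiagonal.antidiagonal d, ∑ q ∈ Finset.HasAntidiagonal.antidiagonal p.2,
        F p.1 q.1 q.2 =
      ∑ p ∈ Finset.HasAntidiagonal.antidiagonal d, ∑ q ∈ Finset.HasAntidiagonal.antidiagonal p.1,
        F q.1 q.2 p.2 := by
  simp only [Finset.sum_sigma']
  refine Finset.sum_nbij' (fun x => ⟨(x.1.1 + x.2.1, x.2.2), (x.1.1, x.2.1)⟩)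
    (fun x => ⟨(x.2.1, x.2.2 + x.1.2), (x.2.2, x.1.2)⟩) ?_ ?_ ?_ ?_ ?_
  all_goals
    rintro ⟨⟨a, b⟩, ⟨c, e⟩⟩ h
    simp only [Finset.mem_sigma, Finset.HasAntidiagonal.mem_antidiagonal] at h ⊢
  · exact ⟨by omega, by trivial⟩
  · exact ⟨by omega, by trivial⟩
  · obtain ⟨h1, rfl⟩ := h; rfl
  · obtain ⟨h1, rfl⟩ := h; rfl

theorem sum_antidiagonal_left_comm {V : Type*} [AddCommMonoid V] (F : ℕ → ℕ → ℕ → V) (d : ℕ) :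
    ∑ p ∈ Finset.HasAntidiagonal.antidiagonal d, ∑ q ∈ Finset.HasAntidiagonal.antidiagonal p.2,
        F p.1 q.1 q.2 =
      ∑ p ∈ Finset.HasAntidiagonal.antidiagonal d, ∑ q ∈ Finset.HasAntidiagonal.antidiagonal p.2,
        F q.1 p.1 q.2 := by
  rw [sum_antidiagonal_assoc, sum_antidiagonal_assoc (fun a b c => F b a c)]
  refine Finset.sum_congr rfl fun p _ => ?_
  exact (Finset.Nat.sum_antidiagonal_swap (f := fun q => F q.1 q.2 p.2)).symm

theorem DiffAlg.ext {f g : DiffAlg M} (h : ∀ d, comp d f = comp d g) : f = g :=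
  Subtype.ext (PowerSeries.ext h)

/-- The homogeneous component as a linear map. -/
def compL (d : ℕ) : DiffAlg M →ₗ[ℂ] Jet M where
  toFun := comp d
  map_add' f g := map_add (PowerSeries.coeff d) f.1 g.1
  map_smul' _ _ := rfl

theorem compL_apply (d : ℕ) (f : DiffAlg M) : compL d f = comp d f := rfl

@[simp] theorem comp_add (d : ℕ) (f g : DiffAlg M) : comp d (f + g) = comp d f + comp d g :=
  map_add (compL d) f g
@[simp] theorem comp_sub (d : ℕ) (f g : DiffAlg M) : comp d (f - g) = comp d f - comp d g :=
  map_sub (compL d) f g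
@[simp] theorem comp_neg (d : ℕ) (f : DiffAlg M) : comp d (-f) = -comp d f := map_neg (compL d) f
@[simp] theorem comp_zero (d : ℕ) : comp d (0 : DiffAlg M) = 0 := map_zero (compL d)
@[simp] theorem comp_smul (d : ℕ) (c : ℂ) (f : DiffAlg M) : comp d (c • f) = c • comp d f :=
  map_smul (compL d) c f
@[simp] theorem comp_zsmul (d : ℕ) (c : ℤ) (f : DiffAlg M) : comp d (c • f) = c • comp d f :=
  map_zsmul (compL d) c f
@[simp] theorem comp_sum {ι : Type*} (s : Finset ι) (f : ι → DiffAlg M) (d : ℕ) :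
    comp d (∑ i ∈ s, f i) = ∑ i ∈ s, comp d (f i) := map_sum (compL d) f s

theorem comp_mul (d : ℕ) (f g : DiffAlg M) : comp d (f * g) =
    ∑ p ∈ Finset.HasAntidiagonal.antidiagonal d, comp p.1 f * comp p.2 g :=
  PowerSeries.coeff_mul d f.1 g.1

theorem comp_one (d : ℕ) : comp d (1 : DiffAlg M) = if d = 0 then 1 else 0 :=
  PowerSeries.coeff_one d

@[simp] theorem comp_ofComp (f : ℕ → Jet M) (hf : ∀ d, JetHom d (f d)) (d : ℕ) :
    comp d (ofComp f hf) = f d := PowerSeries.coeff_mk d f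

@[simp] theorem comp_der_zero (f : DiffAlg M) : comp 0 (der f) = 0 := comp_ofComp _ _ 0

@[simp] theorem comp_der_succ (d : ℕ) (f : DiffAlg M) : comp (d + 1) (der f) = jetD (comp d f) :=
  comp_ofComp _ _ (d + 1)

theorem jetD_sum {ι : Type*} (s : Finset ι) (f : ι → Jet M) :
    jetD (∑ i ∈ s, f i) = ∑ i ∈ s, jetD (f i) := by
  rw [jetD_eq, map_sum]

theorem comp_der_iterate (r d : ℕ) (f : DiffAlg M) :
    comp d (der^[r] f) = if r ≤ d then jetD^[r] (comp (d - r) f) else 0 := by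
  induction r generalizing d with
  | zero => simp
  | succ r ih =>
    rw [Function.iterate_succ_apply']
    cases d with
    | zero => simp
    | succ d =>
      rw [comp_der_succ, ih, Function.iterate_succ_apply']
      simp only [Nat.succ_le_succ_iff, Nat.add_sub_add_right]
      split_ifs
      · rfl
      · rw [jetD_eq, map_zero]

theorem comp_der_iterate_of_lt {r d : ℕ} (h : d < r) (f : DiffAlg M) :
    comp d (der^[r] f) = 0 := by
  rw [comp_der_iterate, if_neg (by omega)]

theorem comp_ev (Y : Coord → DiffAlg M) (d : ℕ) (f : DiffAlg M) : comp d (ev Y f) =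
    ∑ p ∈ Finset.HasAntidiagonal.antidiagonal d,
      jetEvL (fun k => comp p.1 (Y k)) (comp p.2 f) := comp_ofComp _ _ d

/-- The derivation `D` of `𝒜`. -/
def derD : Derivation ℂ (DiffAlg M) (DiffAlg M) :=
  Derivation.mk'
    { toFun := der
      map_add' := fun f g => DiffAlg.ext fun d => by
        cases d with
        | zero => simp
        | succ d => simp [jetD_eq]
      map_smul' := fun c f => DiffAlg.ext fun d => by
        cases d with
        | zero => simp
        | succ d => simp [jetD_eq] }
    (fun f g => DiffAlg.ext fun d => by
      simp only [LinearMap.coe_mk, AddHom.coe_mk, smul_eq_mul, mul_comm g, comp_add]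
      cases d with
      | zero => simp [comp_mul]
      | succ d =>
        rw [comp_der_succ, comp_mul, comp_mul, comp_mul, Finset.Nat.sum_antidiagonal_succ',
          Finset.Nat.sum_antidiagonal_succ]
        simp only [comp_der_zero, comp_der_succ, mul_zero, zero_mul, zero_add, jetD_eq, map_sum]
        rw [← jetD_eq, ← Finset.sum_add_distrib]
        exact Finset.sum_congr rfl fun p _ => jetD_mul _ _)

@[simp] theorem der_sub (f g : DiffAlg M) : der (f - g) = der f - der g := map_sub derD f g
@[simp] theorem der_zero : der (0 : DiffAlg M) = 0 := map_zero derD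
@[simp] theorem der_one : der (1 : DiffAlg M) = 0 := derD.map_one_eq_zero
@[simp] theorem der_zsmul (c : ℤ) (f : DiffAlg M) : der (c • f) = c • der f := map_zsmul derD c f
@[simp] theorem der_smul (c : ℂ) (f : DiffAlg M) : der (c • f) = c • der f :=
  derD.map_smul c f
@[simp] theorem der_sum {ι : Type*} (s : Finset ι) (f : ι → DiffAlg M) :
    der (∑ i ∈ s, f i) = ∑ i ∈ s, der (f i) := map_sum derD f s
theorem der_mul (f g : DiffAlg M) : der (f * g) = f * der g + der f * g := by
  have := derD.leibniz f g
  rwa [smul_eq_mul, smul_eq_mul, mul_comm g] at this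

theorem derIt_add (r : ℕ) (f g : DiffAlg M) : der^[r] (f + g) = der^[r] f + der^[r] g :=
  iterate_map_add derD r f g
theorem derIt_zero (r : ℕ) : der^[r] (0 : DiffAlg M) = 0 := iterate_map_zero derD r
theorem derIt_smul (r : ℕ) (c : ℂ) (f : DiffAlg M) : der^[r] (c • f) = c • der^[r] f := by
  induction r with
  | zero => rfl
  | succ r ih => simp only [Function.iterate_succ_apply', ih, der_smul]

/-- The evolutionary derivation with characteristic `Y`. -/
def evD (Y : Coord → DiffAlg M) : Derivation ℂ (DiffAlg M) (DiffAlg M) :=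
  Derivation.mk'
    { toFun := ev Y
      map_add' := fun f g => DiffAlg.ext fun d => by
        simp only [comp_ev, comp_add, map_add, Finset.sum_add_distrib]
      map_smul' := fun c f => DiffAlg.ext fun d => by
        simp only [comp_ev, comp_smul, map_smul, Finset.smul_sum, RingHom.id_apply] }
    (fun f g => DiffAlg.ext fun d => by
      simp only [LinearMap.coe_mk, AddHom.coe_mk, smul_eq_mul, mul_comm g]
      have e : ∀ (Y : Coord → Jet M) (p q : Jet M),
          jetEvL Y (p * q) = p * jetEvL Y q + jetEvL Y p * q := jetEv_mul
      simp only [comp_add, comp_ev, comp_mul, map_sum, e, Finset.sum_add_distrib, Finset.mul_sum,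
        Finset.sum_mul]
      rw [sum_antidiagonal_left_comm (fun a b c =>
        comp b f * jetEvL (fun k => comp a (Y k)) (comp c g)), sum_antidiagonal_assoc (fun a b c =>
        jetEvL (fun k => comp a (Y k)) (comp b f) * comp c g)])

section
variable (Y Z : Coord → DiffAlg M)

@[simp] theorem ev_add (f g : DiffAlg M) : ev Y (f + g) = ev Y f + ev Y g := map_add (evD Y) f g
@[simp] theorem ev_zero : ev Y 0 = 0 := map_zero (evD Y)
@[simp] theorem ev_one : ev Y 1 = 0 := (evD Y).map_one_eq_zero
@[simp] theorem ev_zsmul (c : ℤ) (f : DiffAlg M) : ev Y (c • f) = c • ev Y f :=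
  map_zsmul (evD Y) c f
theorem ev_mul (f g : DiffAlg M) : ev Y (f * g) = f * ev Y g + ev Y f * g := by
  have := (evD Y).leibniz f g
  rwa [smul_eq_mul, smul_eq_mul, mul_comm g] at this

theorem ev_der (f : DiffAlg M) : ev Y (der f) = der (ev Y f) := by
  refine DiffAlg.ext fun d => ?_
  cases d with
  | zero => simp [comp_ev]
  | succ d =>
    rw [comp_ev, Finset.Nat.sum_antidiagonal_succ', comp_der_succ, comp_ev]
    simp only [comp_der_zero, comp_der_succ]
    rw [map_zero, zero_add, jetD_sum]
    refine Finset.sum_congr rfl fun p _ => ?_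
    rw [jetEvL_apply, jetEvL_apply, jetEv_jetD]

theorem ev_coord (k : Coord) : ev Y (coord k) = Y k := by
  refine DiffAlg.ext fun d => ?_
  rw [comp_ev, Finset.sum_eq_single (d, 0)]
  · simp only [coord, comp_ofComp, if_pos, jetEvL_apply, jetEv_coordFun]
  · rintro ⟨a, b⟩ h hne
    have hb : b ≠ 0 := by
      rintro rfl
      simp only [Finset.HasAntidiagonal.mem_antidiagonal, add_zero] at h
      exact hne (by rw [h])
    simp [coord, hb]
  · intro h
    exact absurd (Finset.HasAntidiagonal.mem_antidiagonal.2 (add_zero d)) h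

theorem ev_commutator (f : DiffAlg M) :
    ev Y (ev Z f) - ev Z (ev Y f) = ev (fun k => ev Y (Z k) - ev Z (Y k)) f := by
  refine DiffAlg.ext fun d => ?_
  simp only [comp_sub, comp_ev, map_sum]
  rw [sum_antidiagonal_left_comm (fun a b c => jetEvL (fun k => comp a (Z k))
    (jetEvL (fun k => comp b (Y k)) (comp c f))), ← Finset.sum_sub_distrib]
  simp only [← Finset.sum_sub_distrib, jetEvL_apply, jetEv_comm]
  simp only [← jetEvL_apply]
  rw [sum_antidiagonal_assoc (fun a b c => jetEvL (fun k => jetEvL (fun k => comp a (Y k))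
    (comp b (Z k)) - jetEvL (fun k => comp b (Z k)) (comp a (Y k))) (comp c f))]
  refine Finset.sum_congr rfl fun p _ => ?_
  rw [← LinearMap.sum_apply, ← map_sum]
  refine congrArg (fun y => jetEvL y (comp p.2 f)) (funext fun k => ?_)
  rw [Finset.sum_apply, Finset.sum_sub_distrib, Finset.sum_sub_distrib]
  congr 1
  exact Finset.Nat.sum_antidiagonal_swap
    (f := fun q : ℕ × ℕ => jetEvL (fun k => comp q.1 (Z k)) (comp q.2 (Y k)))

theorem ev_add_left (f : DiffAlg M) : ev (Y + Z) f = ev Y f + ev Z f := by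
  refine DiffAlg.ext fun d => ?_
  simp only [comp_add, comp_ev, ← Finset.sum_add_distrib, ← LinearMap.add_apply, ← map_add]
  rfl

theorem ev_neg_left (f : DiffAlg M) : ev (-Y) f = -ev Y f := by
  have h0 := ev_add_left 0 0 f
  rw [add_zero, left_eq_add] at h0
  rw [eq_neg_iff_add_eq_zero, ← ev_add_left, neg_add_cancel, h0]

theorem ev_sub_left (f : DiffAlg M) : ev (Y - Z) f = ev Y f - ev Z f := by
  rw [sub_eq_add_neg, ev_add_left, ev_neg_left, sub_eq_add_neg]

/-! ### Local functionals -/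

@[simp] theorem integral_der (f : DiffAlg M) : integral (der f) = 0 :=
  (Submodule.Quotient.mk_eq_zero _).2
    (Submodule.mem_sup_left (Submodule.subset_span ⟨f, rfl⟩))

theorem integral_sub (f g : DiffAlg M) : integral (f - g) = integral f - integral g := rfl
theorem integral_neg (f : DiffAlg M) : integral (-f) = -integral f := rfl
theorem integral_zero : integral (0 : DiffAlg M) = 0 := rfl
theorem integral_smul (c : ℂ) (f : DiffAlg M) : integral (c • f) = c • integral f := rfl

/-- The action of an evolutionary derivation on local functionals. -/
def evLoc : LocalFun M →ₗ[ℂ] LocalFun M :=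
  Submodule.mapQ _ _ (evD Y).toLinearMap <| by
    refine sup_le (Submodule.span_le.2 ?_) (Submodule.span_le.2 ?_)
    · rintro _ ⟨f, rfl⟩
      refine Submodule.mem_sup_left (Submodule.subset_span ⟨ev Y f, ?_⟩)
      exact (ev_der Y f).symm
    · rintro _ rfl
      have : (evD Y).toLinearMap (1 : DiffAlg M) = 0 := (evD Y).map_one_eq_zero
      simp only [Submodule.comap_coe, Set.mem_preimage, SetLike.mem_coe, this]
      exact Submodule.zero_mem _

theorem evLoc_commutator (F : LocalFun M) :
    evLoc Y (evLoc Z F) - evLoc Z (evLoc Y F) = evLoc (fun k => ev Y (Z k) - ev Z (Y k)) F := by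
  obtain ⟨f, rfl⟩ := Submodule.Quotient.mk_surjective _ F
  exact congrArg integral (ev_commutator Y Z f)

end

/-- A differential polynomial all of whose homogeneous components are total derivatives is a total
derivative. -/
theorem mem_range_der {f : DiffAlg M} (h : ∀ d, ∃ g : DiffAlg M, comp d f = comp d (der g)) :
    ∃ g, f = der g := by
  choose g hg using h
  refine ⟨ofComp (fun d => comp d (g (d + 1))) fun d => comp_hom d _, DiffAlg.ext fun d => ?_⟩
  cases d with
  | zero => rw [hg 0, comp_der_zero, comp_der_zero]
  | succ d => rw [hg (d + 1), comp_der_succ, comp_der_succ, comp_ofComp]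

/-! ### Locally finite sums of pseudo-differential operators -/

theorem PDO.ext {a b : PDO M} (h : ∀ n, a n = b n) : a = b := funext h

theorem PDO.ext_comp {a b : PDO M} (h : ∀ n d, comp d (a n) = comp d (b n)) : a = b :=
  funext fun n => DiffAlg.ext (h n)

@[simp] theorem PDO.add_apply (a b : PDO M) (n : ℤ) : (a + b) n = a n + b n := rfl
@[simp] theorem PDO.sub_apply (a b : PDO M) (n : ℤ) : (a - b) n = a n - b n := rfl
@[simp] theorem PDO.neg_apply (a : PDO M) (n : ℤ) : (-a) n = -a n := rfl
@[simp] theorem PDO.zero_apply (n : ℤ) : (0 : PDO M) n = 0 := rfl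
@[simp] theorem PDO.smul_apply (c : ℂ) (a : PDO M) (n : ℤ) : (c • a) n = c • a n := rfl
@[simp] theorem PDO.zsmul_apply (c : ℤ) (a : PDO M) (n : ℤ) : (c • a) n = c • a n := rfl

/-- Evaluation at a coefficient. -/
def coeffHom (n : ℤ) : PDO M →+ DiffAlg M where
  toFun a := a n
  map_zero' := rfl
  map_add' _ _ := rfl

@[simp] theorem PDO.sum_apply {ι : Type*} (s : Finset ι) (x : ι → PDO M) (n : ℤ) :
    (∑ i ∈ s, x i) n = ∑ i ∈ s, x i n := map_sum (coeffHom n) x s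

instance : Module (DiffAlg M) (PDO M) := inferInstanceAs (Module (DiffAlg M) (ℤ → DiffAlg M))

@[simp] theorem PDO.fsmul_apply (f : DiffAlg M) (a : PDO M) (n : ℤ) : (f • a) n = f * a n := rfl

/-- `a = ∑ᵢ xᵢ`, where only finitely many terms contribute to each homogeneous component of each
coefficient. -/
def HasS {ι : Type*} (x : ι → PDO M) (a : PDO M) : Prop :=
  ∀ n d, ∃ s : Finset ι, (∀ i ∉ s, comp d (x i n) = 0) ∧ comp d (a n) = ∑ i ∈ s, comp d (x i n)

section HasS
variable {ι : Type*} {x y : ι → PDO M} {a b : PDO M}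

theorem HasS.eq_finsum (h : HasS x a) (n : ℤ) (d : ℕ) :
    comp d (a n) = ∑ᶠ i, comp d (x i n) := by
  obtain ⟨s, hs, e⟩ := h n d
  rw [e, finsum_eq_sum_of_support_subset]
  intro i hi
  by_contra h'
  exact hi (hs i h')

theorem HasS.unique (h : HasS x a) (h' : HasS x b) : a = b :=
  PDO.ext_comp fun n d => by rw [h.eq_finsum, h'.eq_finsum]

theorem HasS.congr (h : HasS x a) (e : ∀ i, x i = y i) : HasS y a :=
  (funext e : x = y) ▸ h

theorem HasS.add (h : HasS x a) (h' : HasS y b) : HasS (fun i => x i + y i) (a + b) := by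
  classical
  intro n d
  obtain ⟨s, hs, e⟩ := h n d
  obtain ⟨t, ht, e'⟩ := h' n d
  refine ⟨s ∪ t, fun i hi => ?_, ?_⟩
  · rw [Finset.notMem_union] at hi
    simp [hs i hi.1, ht i hi.2]
  · simp only [PDO.add_apply, comp_add, Finset.sum_add_distrib, e, e']
    rw [Finset.sum_subset Finset.subset_union_left fun i _ hi => hs i hi,
      Finset.sum_subset Finset.subset_union_right fun i _ hi => ht i hi]

theorem HasS.neg (h : HasS x a) : HasS (fun i => -x i) (-a) := by
  intro n d
  obtain ⟨s, hs, e⟩ := h n d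
  exact ⟨s, fun i hi => by simp [hs i hi], by simp [e]⟩

theorem HasS.sub (h : HasS x a) (h' : HasS y b) : HasS (fun i => x i - y i) (a - b) := by
  simpa only [sub_eq_add_neg] using h.add h'.neg

theorem HasS.comp_equiv {κ : Type*} (h : HasS x a) (e : κ ≃ ι) : HasS (fun i => x (e i)) a := by
  intro n d
  obtain ⟨s, hs, h⟩ := h n d
  refine ⟨s.map e.symm.toEmbedding, fun i hi => hs _ fun h' => hi ?_, ?_⟩
  · simpa using h'
  · simpa using h

theorem HasS.single (i : ι) (h : ∀ j, j ≠ i → x j = 0) : HasS x (x i) := fun n d =>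
  ⟨{i}, fun j hj => by rw [h j (by simpa using hj)]; simp, by simp⟩

end HasS

/-- An additive map defined on a group of operators such that each homogeneous component of each
coefficient of the value depends on finitely many homogeneous components of coefficients of the
argument. -/
structure LocalOn (K : AddSubgroup (PDO M)) (T : PDO M → PDO M) : Prop where
  add : ∀ a ∈ K, ∀ b ∈ K, T (a + b) = T a + T b
  loc : ∀ n d, ∃ F : Finset (ℤ × ℕ), ∀ a ∈ K, (∀ p ∈ F, comp p.2 (a p.1) = 0) → comp d (T a n) = 0

namespace LocalOn
variable {K : AddSubgroup (PDO M)} {T : PDO M → PDO M}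

/-- The restriction to the domain as a homomorphism. -/
def hom (h : LocalOn K T) : K →+ PDO M :=
  AddMonoidHom.mk' (fun a => T a.1) fun a b => h.add a.1 a.2 b.1 b.2

theorem hom_apply (h : LocalOn K T) (a : K) : h.hom a = T a.1 := rfl

theorem zsmul (h : LocalOn K T) (c : ℤ) {a : PDO M} (ha : a ∈ K) : T (c • a) = c • T a := by
  have e := h.hom.map_zsmul c ⟨a, ha⟩
  rwa [hom_apply, hom_apply, AddSubgroup.coe_zsmul] at e

theorem map_zero (h : LocalOn K T) : T 0 = 0 := _root_.map_zero h.hom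

/-- Local maps commute with locally finite sums. -/
theorem map_hasS (h : LocalOn K T) {ι : Type*} {x : ι → PDO M} {a : PDO M} (hx : ∀ i, x i ∈ K)
    (ha : a ∈ K) (hs : HasS x a) : HasS (fun i => T (x i)) (T a) := by
  classical
  intro n d
  obtain ⟨F, hF⟩ := h.loc n d
  choose s hs0 hse using fun p : ℤ × ℕ => hs p.1 p.2
  refine ⟨F.biUnion s, fun i hi => hF _ (hx i) fun p hp => hs0 p i fun h' => hi ?_, ?_⟩
  · exact Finset.mem_biUnion.2 ⟨p, hp, h'⟩
  · have hmem : ∑ i ∈ F.biUnion s, x i ∈ K := K.sum_mem fun i _ => hx i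
    have h0 : comp d (T (a - ∑ i ∈ F.biUnion s, x i) n) = 0 := by
      refine hF _ (K.sub_mem ha hmem) fun p hp => ?_
      rw [PDO.sub_apply, comp_sub, hse p, sub_eq_zero, PDO.sum_apply, comp_sum]
      exact Finset.sum_subset (Finset.subset_biUnion_of_mem s hp) fun i _ hi => hs0 p i hi
    have e1 : T (a - ∑ i ∈ F.biUnion s, x i) = T a - ∑ i ∈ F.biUnion s, T (x i) := by
      have := h.hom.map_sub ⟨a, ha⟩ (∑ i ∈ F.biUnion s, ⟨x i, hx i⟩)
      rw [map_sum] at this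
      have e2 : ((⟨a, ha⟩ - ∑ i ∈ F.biUnion s, ⟨x i, hx i⟩ : K) : PDO M) =
          a - ∑ i ∈ F.biUnion s, x i := by
        rw [AddSubgroup.coe_sub, AddSubgroup.val_finsetSum]
      rw [← e2]
      exact this
    rwa [e1, PDO.sub_apply, comp_sub, sub_eq_zero, PDO.sum_apply, comp_sum] at h0

theorem map_hasS_top (h : LocalOn ⊤ T) {ι : Type*} {x : ι → PDO M} {a : PDO M}
    (hs : HasS x a) : HasS (fun i => T (x i)) (T a) :=
  h.map_hasS (fun _ => trivial) trivial hs

end LocalOn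

/-! ### Left multiplication by powers of `D` -/

theorem comp_mul_congr {d : ℕ} (f : DiffAlg M) {g g' : DiffAlg M}
    (h : ∀ e ≤ d, comp e g = comp e g') : comp d (f * g) = comp d (f * g') := by
  rw [comp_mul, comp_mul]
  refine Finset.sum_congr rfl fun p hp => ?_
  rw [h p.2 (Finset.HasAntidiagonal.antidiagonal.snd_le hp)]

/-- The operator `D^i · b`. -/
def Dl (i : ℤ) (b : PDO M) : PDO M := fun n =>
  ofComp (fun d => ∑ r ∈ Finset.range (d + 1), Ring.choose i r • comp d (der^[r] (b (n - i + r))))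
    fun d => MvPolynomial.IsWeightedHomogeneous.sum _ _ _ fun _ _ => JetHom.zsmul _ (comp_hom d _)

theorem comp_Dl (i : ℤ) (b : PDO M) (n : ℤ) {d N : ℕ} (h : d < N) : comp d (Dl i b n) =
    comp d (∑ r ∈ Finset.range N, Ring.choose i r • der^[r] (b (n - i + r))) := by
  rw [Dl, comp_ofComp, comp_sum]
  simp only [comp_zsmul]
  refine Finset.sum_subset (Finset.range_mono (by omega)) fun r _ hr => ?_
  rw [comp_der_iterate_of_lt (by simpa using hr), smul_zero]

theorem comp_Dl_eq_zero {i : ℤ} {b : PDO M} {n : ℤ} {d : ℕ}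
    (h : ∀ r : ℕ, r ≤ d → comp (d - r) (b (n - i + r)) = 0) : comp d (Dl i b n) = 0 := by
  rw [comp_Dl i b n d.lt_succ_self, comp_sum]
  refine Finset.sum_eq_zero fun r hr => ?_
  have hr : r ≤ d := by simpa [Nat.lt_succ_iff] using hr
  rw [comp_zsmul, comp_der_iterate, if_pos hr, h r hr, ← Function.iterate_fixed (f := jetD) (x := 0)
    (by rw [jetD_eq, map_zero]) r]
  simp [Function.iterate_fixed (f := jetD (M := M)) (x := 0) (by rw [jetD_eq, map_zero]) r]

theorem Dl_add (i : ℤ) (a b : PDO M) : Dl i (a + b) = Dl i a + Dl i b :=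
  PDO.ext_comp fun n d => by
    simp only [PDO.add_apply, comp_add, comp_Dl i _ n d.lt_succ_self, comp_sum, derIt_add,
      comp_zsmul, smul_add, Finset.sum_add_distrib]

theorem Dl_local (i : ℤ) : LocalOn ⊤ (Dl (M := M) i) where
  add a _ b _ := Dl_add i a b
  loc n d := ⟨(Finset.range (d + 1)).image fun r : ℕ => (n - i + r, d - r), fun a _ h =>
    comp_Dl_eq_zero fun r hr => h _ (Finset.mem_image.2 ⟨r, by simpa [Nat.lt_succ_iff], rfl⟩)⟩

theorem Dl_zero (b : PDO M) : Dl 0 b = b :=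
  PDO.ext_comp fun n d => by
    rw [comp_Dl 0 b n d.lt_succ_self, comp_sum, Finset.sum_eq_single 0]
    · simp
    · intro r _ hr
      rw [Ring.choose_zero_pos ℤ (Nat.pos_of_ne_zero hr), zero_smul, comp_zero]
    · simp

theorem Dl_one_apply (b : PDO M) (n : ℤ) : Dl 1 b n = b (n - 1) + der (b n) :=
  DiffAlg.ext fun d => by
    rw [comp_Dl 1 b n (N := d + 2) (by omega), Finset.sum_range_succ', Finset.sum_range_succ',
      Finset.sum_eq_zero]
    · simp [add_comm]
    · intro r _
      have : Ring.choose (1 : ℤ) (r + 1 + 1) = 0 := by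
        have := Ring.choose_natCast (R := ℤ) 1 (r + 1 + 1)
        rw [Nat.choose_eq_zero_of_lt (by omega)] at this
        exact_mod_cast this
      rw [this, zero_smul]

theorem sum_pascal (i : ℤ) (N : ℕ) (f : ℕ → DiffAlg M) :
    ∑ r ∈ Finset.range (N + 1), Ring.choose (i + 1) r • f r =
      ∑ r ∈ Finset.range (N + 1), Ring.choose i r • f r +
        ∑ r ∈ Finset.range N, Ring.choose i r • f (r + 1) := by
  rw [Finset.sum_range_succ', Finset.sum_range_succ' (n := N)]
  simp only [Ring.choose_succ_succ, add_smul, Finset.sum_add_distrib, Ring.choose_zero_right]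
  abel

theorem Dl_one_Dl (i : ℤ) (b : PDO M) : Dl 1 (Dl i b) = Dl (i + 1) b :=
  PDO.ext_comp fun n d => by
    rw [Dl_one_apply, comp_Dl (i + 1) b n (N := d + 2) (by omega), sum_pascal, comp_add, comp_add,
      comp_Dl i b (n - 1) (N := d + 2) (by omega)]
    congr 1
    · simp only [show ∀ r : ℕ, n - 1 - i + r = n - (i + 1) + r from fun r => by ring]
    · cases d with
      | zero => simp
      | succ d =>
        rw [comp_der_succ, comp_Dl i b n (N := d + 2) (by omega), ← comp_der_succ, der_sum]
        refine congrArg _ (Finset.sum_congr rfl fun r _ => ?_)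
        rw [der_zsmul, Function.iterate_succ_apply',
          show n - (i + 1) + ((r + 1 : ℕ) : ℤ) = n - i + r by push_cast; ring]

theorem Dl_Dl_one (i : ℤ) (b : PDO M) : Dl i (Dl 1 b) = Dl (i + 1) b :=
  PDO.ext_comp fun n d => by
    rw [comp_Dl (i + 1) b n (N := d + 2) (by omega), sum_pascal,
      comp_Dl i (Dl 1 b) n (N := d + 1) (by omega)]
    simp only [Dl_one_apply, derIt_add, smul_add, Finset.sum_add_distrib]
    rw [Finset.sum_range_succ (n := d + 1), comp_add, comp_add, comp_add]
    simp only [comp_zsmul]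
    rw [comp_der_iterate_of_lt (r := d + 1) (by omega), smul_zero, add_zero]
    refine congrArg₂ (· + ·) ?_ ?_
    · refine congrArg _ (Finset.sum_congr rfl fun r _ => ?_)
      rw [show n - (i + 1) + (r : ℤ) = n - i + r - 1 by ring]
    · refine congrArg _ (Finset.sum_congr rfl fun r _ => ?_)
      rw [show n - (i + 1) + ((r + 1 : ℕ) : ℤ) = n - i + r by push_cast; ring,
        Function.iterate_succ_apply]

theorem Dl_one_injective : Function.Injective (Dl (M := M) 1) := fun a b h => by
  have := congrArg (Dl (-1)) h
  rwa [Dl_Dl_one, Dl_Dl_one, neg_add_cancel, Dl_zero, Dl_zero] at this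

theorem Dl_Dl (i j : ℤ) (b : PDO M) : Dl i (Dl j b) = Dl (i + j) b := by
  induction i using Int.induction_on with
  | zero => rw [Dl_zero, zero_add]
  | succ i ih => rw [← Dl_one_Dl, ih, Dl_one_Dl, add_right_comm]
  | pred i ih =>
    refine Dl_one_injective ?_
    rw [Dl_one_Dl, Dl_one_Dl, sub_add_cancel, ih]
    congr 1
    ring

theorem Dl_one_fsmul (f : DiffAlg M) (b : PDO M) : Dl 1 (f • b) = der f • b + f • Dl 1 b :=
  PDO.ext fun n => by
    simp only [Dl_one_apply, PDO.fsmul_apply, PDO.add_apply, der_mul]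
    ring

theorem fsmul_local (f : DiffAlg M) : LocalOn ⊤ (fun a : PDO M => f • a) where
  add a _ b _ := smul_add f a b
  loc n d := ⟨(Finset.range (d + 1)).image fun e => (n, e), fun a _ h => by
    rw [PDO.fsmul_apply, comp_mul]
    refine Finset.sum_eq_zero fun p hp => ?_
    rw [h (n, p.2) (Finset.mem_image.2 ⟨p.2, ?_, rfl⟩), mul_zero]
    simpa [Nat.lt_succ_iff] using Finset.HasAntidiagonal.antidiagonal.snd_le hp⟩

/-- Right multiplication by `D^j`, that is, the shift of the coefficients. -/
def shift (j : ℤ) (a : PDO M) : PDO M := fun n => a (n - j)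

theorem shift_local (j : ℤ) : LocalOn ⊤ (shift (M := M) j) where
  add _ _ _ _ := rfl
  loc n d := ⟨{(n - j, d)}, fun a _ h => h (n - j, d) (by simp)⟩

theorem Dl_shift (i j : ℤ) (a : PDO M) : Dl i (shift j a) = shift j (Dl i a) :=
  PDO.ext_comp fun n d => by
    simp only [shift, Dl, comp_ofComp]
    refine Finset.sum_congr rfl fun r _ => ?_
    rw [show n - i + (r : ℤ) - j = n - j - i + r by ring]

/-! ### The two classes of operators -/

/-- The weight of the degree `d` part of the coefficient at `D^i`: it is `-i` for operators of the
first type and `i + d` for operators of the second type. -/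
def wt : Bool → ℤ → ℕ → ℤ
  | false, i, _ => -i
  | true, i, d => i + d

/-- The operators all of whose terms have weight at least `m`. -/
def cone (t : Bool) (m : ℤ) : AddSubgroup (PDO M) where
  carrier := {a | ∀ i d, wt t i d < m → comp d (a i) = 0}
  zero_mem' i d _ := comp_zero d
  add_mem' := fun ha hb i d h => by rw [PDO.add_apply, comp_add, ha i d h, hb i d h, add_zero]
  neg_mem' := fun ha i d h => by rw [PDO.neg_apply, comp_neg, ha i d h, neg_zero]

theorem cone_mono {t : Bool} {m m' : ℤ} (h : m' ≤ m) {a : PDO M} (ha : a ∈ cone t m) :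
    a ∈ cone t m' := fun i d hd => ha i d (by omega)

/-- Operators of the first type (`t = false`) and of the second type (`t = true`). -/
def InT (t : Bool) (a : PDO M) : Prop := ∃ m, a ∈ cone t m

theorem inMinus_iff {a : PDO M} : InMinus a ↔ InT false a := by
  constructor
  · rintro ⟨N, h⟩
    refine ⟨-N, fun i d hi => ?_⟩
    rw [h i (by simp only [wt] at hi; omega), comp_zero]
  · rintro ⟨m, h⟩
    refine ⟨-m, fun i hi => DiffAlg.ext fun d => ?_⟩
    rw [h i d (by simp only [wt]; omega), comp_zero]

theorem inPlus_iff {a : PDO M} : InPlus a ↔ InT true a := Iff.rfl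

theorem InT.zero (t : Bool) : InT t (0 : PDO M) := ⟨0, zero_mem _⟩

theorem InT.common {t : Bool} {a b : PDO M} (ha : InT t a) (hb : InT t b) :
    ∃ m, a ∈ cone t m ∧ b ∈ cone t m := by
  obtain ⟨m, hm⟩ := ha
  obtain ⟨m', hm'⟩ := hb
  exact ⟨min m m', cone_mono (min_le_left _ _) hm, cone_mono (min_le_right _ _) hm'⟩

theorem InT.add {t : Bool} {a b : PDO M} (ha : InT t a) (hb : InT t b) : InT t (a + b) := by
  obtain ⟨m, h1, h2⟩ := ha.common hb
  exact ⟨m, add_mem h1 h2⟩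

theorem InT.neg {t : Bool} {a : PDO M} (ha : InT t a) : InT t (-a) :=
  ha.imp fun _ h => neg_mem h

theorem InT.sub {t : Bool} {a b : PDO M} (ha : InT t a) (hb : InT t b) : InT t (a - b) := by
  rw [sub_eq_add_neg]; exact ha.add hb.neg

theorem Dl_mem_cone {t : Bool} {m : ℤ} {b : PDO M} (i : ℤ) (hb : b ∈ cone t m) :
    Dl i b ∈ cone t (m + wt t i 0) := fun n d h => by
  refine comp_Dl_eq_zero fun r hr => hb _ _ ?_
  cases t <;> simp only [wt] at h ⊢ <;> push_cast [hr] <;> omega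

theorem InT.Dl {t : Bool} {b : PDO M} (i : ℤ) (hb : InT t b) : InT t (Dl i b) := by
  obtain ⟨m, hm⟩ := hb
  exact ⟨_, Dl_mem_cone i hm⟩

theorem mul_mem_aux {t : Bool} {m m' : ℤ} {a b : PDO M} (ha : a ∈ cone t m) (hb : b ∈ cone t m')
    {i n : ℤ} {d : ℕ} (h : comp d (a i * Dl i b n) ≠ 0) :
    ∃ p q : ℕ, p + q = d ∧ m ≤ wt t i p ∧ m' + wt t i 0 ≤ wt t n q := by
  rw [comp_mul] at h
  obtain ⟨p, hp, hne⟩ := Finset.exists_ne_zero_of_sum_ne_zero h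
  refine ⟨p.1, p.2, Finset.HasAntidiagonal.mem_antidiagonal.1 hp, ?_, ?_⟩
  · by_contra hlt
    exact hne (by rw [ha i p.1 (by omega), zero_mul])
  · by_contra hlt
    exact hne (by rw [Dl_mem_cone i hb n p.2 (by omega), mul_zero])

theorem fsmul_Dl_mem {t : Bool} {m m' : ℤ} {a b : PDO M} (ha : a ∈ cone t m) (hb : b ∈ cone t m')
    (i : ℤ) : a i • Dl i b ∈ cone t (m + m') := fun n d h => by
  by_contra hne
  obtain ⟨p, q, hpq, h1, h2⟩ := mul_mem_aux ha hb hne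
  cases t <;> simp only [wt] at h h1 h2 <;> omega

/-- The indices `i` for which `a_i D^i b` can contribute to the degree `d` part of the coefficient
of `a b` at `D^n`. -/
def window (t : Bool) (m m' n : ℤ) (d : ℕ) : Finset ℤ :=
  if t then Finset.Icc (m - d) (n + d - m') else Finset.Icc (n + m') (-m)

theorem mem_window {t : Bool} {m m' : ℤ} {a b : PDO M} (ha : a ∈ cone t m) (hb : b ∈ cone t m')
    {i n : ℤ} {d : ℕ} (h : comp d (a i * Dl i b n) ≠ 0) : i ∈ window t m m' n d := by
  obtain ⟨p, q, hpq, h1, h2⟩ := mul_mem_aux ha hb h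
  cases t <;> simp only [wt, window] at h1 h2 ⊢ <;> simp only [if_true, Bool.false_eq_true,
    if_false, Finset.mem_Icc] <;> omega

theorem comp_PDO_mul (a b : PDO M) (n : ℤ) (d : ℕ) :
    comp d ((a * b) n) = ∑ᶠ i : ℤ, comp d (a i * Dl i b n) := by
  change comp d (PDO.mul a b n) = _
  rw [PDO.mul, comp_ofComp]
  refine finsum_congr fun i => ?_
  rw [comp_mul_congr (a i) (g' := ∑ r ∈ Finset.range (d + 1),
    Ring.choose i r • der^[r] (b (n - i + r))) fun e he => comp_Dl i b n (by omega),
    Finset.mul_sum, comp_sum]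
  refine Finset.sum_congr rfl fun r _ => ?_
  rw [mul_smul_comm, comp_zsmul]

/-- Turns the coefficientwise `finsum` of the definition of the product into a locally finite
expansion; the finite sets `w n d` certify that the `finsum` has finite support. -/
theorem hasS_of_eq_finsum {x : ℤ → PDO M} {a : PDO M} (w : ℤ → ℕ → Finset ℤ)
    (hw : ∀ n d i, comp d (x i n) ≠ 0 → i ∈ w n d)
    (h : ∀ n d, comp d (a n) = ∑ᶠ i, comp d (x i n)) : HasS x a := fun n d =>
  ⟨w n d, fun i hi => by by_contra h'; exact hi (hw n d i h'), by
    rw [h, finsum_eq_sum_of_support_subset]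
    exact fun i hi => hw n d i hi⟩

/-- The product of two operators of the same type is the locally finite sum of its terms. -/
theorem hasS_mul {t : Bool} {m m' : ℤ} {a b : PDO M} (ha : a ∈ cone t m) (hb : b ∈ cone t m') :
    HasS (fun i => a i • Dl i b) (a * b) :=
  hasS_of_eq_finsum (window t m m') (fun _ _ _ h => mem_window ha hb h) fun n d =>
    comp_PDO_mul a b n d

theorem mul_mem_cone {t : Bool} {m m' : ℤ} {a b : PDO M} (ha : a ∈ cone t m)
    (hb : b ∈ cone t m') : a * b ∈ cone t (m + m') := fun n d h => by
  rw [(hasS_mul ha hb).eq_finsum]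
  exact finsum_eq_zero_of_forall_eq_zero fun i => fsmul_Dl_mem ha hb i n d h

theorem InT.mul {t : Bool} {a b : PDO M} (ha : InT t a) (hb : InT t b) : InT t (a * b) := by
  obtain ⟨m, hm⟩ := ha
  obtain ⟨m', hm'⟩ := hb
  exact ⟨_, mul_mem_cone hm hm'⟩

theorem InT.hasS_mul {t : Bool} {a b : PDO M} (ha : InT t a) (hb : InT t b) :
    HasS (fun i => a i • TwoBKP.Dl i b) (a * b) := by
  obtain ⟨m, hm⟩ := ha
  obtain ⟨m', hm'⟩ := hb
  exact TwoBKP.hasS_mul hm hm'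

theorem PDO.left_distrib' {t : Bool} {a b c : PDO M} (ha : InT t a) (hb : InT t b) (hc : InT t c) :
    a * (b + c) = a * b + a * c :=
  (ha.hasS_mul (hb.add hc)).unique (((ha.hasS_mul hb).add (ha.hasS_mul hc)).congr fun i => by
    rw [Dl_add, smul_add])

theorem PDO.right_distrib' {t : Bool} {a b c : PDO M} (ha : InT t a) (hb : InT t b)
    (hc : InT t c) : (a + b) * c = a * c + b * c :=
  ((ha.add hb).hasS_mul hc).unique (((ha.hasS_mul hc).add (hb.hasS_mul hc)).congr fun i => by
    rw [PDO.add_apply, add_smul])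

theorem mul_left_local {t : Bool} {m : ℤ} {a : PDO M} (ha : a ∈ cone t m) (m' : ℤ) :
    LocalOn (cone t m') (fun b => a * b) where
  add b hb c hc := PDO.left_distrib' ⟨m, ha⟩ ⟨m', hb⟩ ⟨m', hc⟩
  loc n d := by
    refine ⟨((window t m m' n d ×ˢ Finset.range (d + 1)) ×ˢ Finset.range (d + 1)).image
      fun q => (n - q.1.1 + (q.1.2 : ℤ), q.2), fun b hb h => ?_⟩
    rw [(hasS_mul ha hb).eq_finsum]
    refine finsum_eq_zero_of_forall_eq_zero fun i => ?_
    by_contra hne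
    have hw := mem_window ha hb hne
    refine hne ?_
    rw [PDO.fsmul_apply, comp_mul]
    refine Finset.sum_eq_zero fun p hp => ?_
    have hp2 := Finset.HasAntidiagonal.antidiagonal.snd_le hp
    rw [comp_Dl_eq_zero, mul_zero]
    intro r hr
    refine h (n - i + r, p.2 - r) (Finset.mem_image.2 ⟨((i, r), p.2 - r), ?_, rfl⟩)
    simp only [Finset.mem_product, Finset.mem_range]
    exact ⟨⟨hw, by omega⟩, by omega⟩

theorem mul_right_local {t : Bool} {m' : ℤ} {c : PDO M} (hc : c ∈ cone t m') (m : ℤ) :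
    LocalOn (cone t m) (fun a => a * c) where
  add a ha b hb := PDO.right_distrib' ⟨m, ha⟩ ⟨m, hb⟩ ⟨m', hc⟩
  loc n d := by
    refine ⟨window t m m' n d ×ˢ Finset.range (d + 1), fun a ha h => ?_⟩
    rw [(hasS_mul ha hc).eq_finsum]
    refine finsum_eq_zero_of_forall_eq_zero fun i => ?_
    by_contra hne
    have hw := mem_window ha hc hne
    refine hne ?_
    rw [PDO.fsmul_apply, comp_mul]
    refine Finset.sum_eq_zero fun p hp => ?_
    have hp1 := Finset.HasAntidiagonal.antidiagonal.fst_le hp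
    rw [h (i, p.1) (by simp only [Finset.mem_product, Finset.mem_range]; exact ⟨hw, by omega⟩),
      zero_mul]

theorem fsmul_mem_cone {t : Bool} {m : ℤ} {a : PDO M} (f : DiffAlg M) (ha : a ∈ cone t m) :
    f • a ∈ cone t m := fun n d h => by
  rw [PDO.fsmul_apply, comp_mul]
  refine Finset.sum_eq_zero fun p hp => ?_
  have hp2 := Finset.HasAntidiagonal.antidiagonal.snd_le hp
  rw [ha n p.2 (by cases t <;> simp only [wt] at h ⊢ <;> omega), mul_zero]

theorem InT.fsmul {t : Bool} {a : PDO M} (f : DiffAlg M) (ha : InT t a) : InT t (f • a) :=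
  ha.imp fun _ h => fsmul_mem_cone f h

theorem fsmul_mul {t : Bool} (f : DiffAlg M) {a c : PDO M} (ha : InT t a) (hc : InT t c) :
    (f • a) * c = f • (a * c) :=
  ((ha.fsmul f).hasS_mul hc).unique (((fsmul_local f).map_hasS_top (ha.hasS_mul hc)).congr
    fun i => by rw [PDO.fsmul_apply, mul_smul])

/-- The derivative of the coefficients. -/
def derOp (a : PDO M) : PDO M := fun n => der (a n)

theorem InT.derOp {t : Bool} {a : PDO M} (ha : InT t a) : InT t (derOp a) := by
  obtain ⟨m, hm⟩ := ha
  refine ⟨m, fun n d h => ?_⟩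
  cases d with
  | zero => exact comp_der_zero _
  | succ d =>
    refine (comp_der_succ _ _).trans ?_
    rw [hm n d (by cases t <;> simp only [wt] at h ⊢ <;> push_cast at h <;> omega), jetD_eq,
      map_zero]

/-- `(D a) c = D (a c)`: together with the same fact for functions in place of `D`, this is the
special case to which associativity is reduced. -/
theorem Dl_one_mul {t : Bool} {a c : PDO M} (ha : InT t a) (hc : InT t c) :
    Dl 1 a * c = Dl 1 (a * c) := by
  have h1 := (Dl_local 1).map_hasS_top (ha.hasS_mul hc)
  have h2 := ha.derOp.hasS_mul hc
  have h3 := (h1.sub h2).comp_equiv (Equiv.subRight (1 : ℤ))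
  refine ((ha.Dl 1).hasS_mul hc).unique ?_
  rw [← sub_add_cancel (Dl 1 (a * c)) (derOp a * c)]
  refine (h3.add h2).congr fun i => ?_
  simp only [Dl_one_fsmul, Dl_one_Dl, Dl_one_apply, derOp, Equiv.subRight_apply, sub_add_cancel,
    add_smul]
  abel

theorem Dl_mul {t : Bool} (i : ℤ) {a c : PDO M} (ha : InT t a) (hc : InT t c) :
    Dl i a * c = Dl i (a * c) := by
  induction i using Int.induction_on with
  | zero => rw [Dl_zero, Dl_zero]
  | succ i ih => rw [← Dl_one_Dl, Dl_one_mul (ha.Dl _) hc, ih, Dl_one_Dl]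
  | pred i ih =>
    refine Dl_one_injective ?_
    rw [← Dl_one_mul (ha.Dl _) hc, Dl_one_Dl, Dl_one_Dl, sub_add_cancel, ih]

/-- The product of operators of the same type is associative. -/
theorem PDO.mul_assoc' {t : Bool} {a b c : PDO M} (ha : InT t a) (hb : InT t b) (hc : InT t c) :
    a * b * c = a * (b * c) := by
  refine HasS.unique ?_ (ha.hasS_mul (hb.mul hc))
  obtain ⟨m, hm⟩ := ha
  obtain ⟨m', hm'⟩ := hb
  obtain ⟨m'', hm''⟩ := hc
  refine ((mul_right_local hm'' (m + m')).map_hasS (fun i => fsmul_Dl_mem hm hm' i)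
    (mul_mem_cone hm hm') (hasS_mul hm hm')).congr fun i => ?_
  rw [fsmul_mul _ (InT.Dl i ⟨m', hm'⟩) ⟨m'', hm''⟩, Dl_mul i ⟨m', hm'⟩ ⟨m'', hm''⟩]

/-! ### Monomials -/

theorem Dpow_apply (j n : ℤ) : (Dpow j : PDO M) n = if n = j then 1 else 0 := rfl

theorem const_apply (f : DiffAlg M) (n : ℤ) : PDO.const f n = if n = 0 then f else 0 := rfl

theorem Dpow_mem_cone (t : Bool) (j : ℤ) : (Dpow j : PDO M) ∈ cone t (wt t j 0) := fun n d h => by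
  rw [Dpow_apply]
  split_ifs with hn
  · subst hn
    rw [comp_one, if_neg]
    rintro rfl
    exact lt_irrefl _ h
  · exact comp_zero d

theorem InT.Dpow (t : Bool) (j : ℤ) : InT t (Dpow j : PDO M) := ⟨_, Dpow_mem_cone t j⟩

theorem const_mem_cone (t : Bool) (f : DiffAlg M) : PDO.const f ∈ cone t 0 := fun n d h => by
  rw [const_apply, if_neg, comp_zero]
  rintro rfl
  cases t <;> simp only [wt] at h <;> omega

theorem InT.const (t : Bool) (f : DiffAlg M) : InT t (PDO.const f) := ⟨0, const_mem_cone t f⟩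

theorem Dpow_mul (j : ℤ) (b : PDO M) : Dpow j * b = Dl j b := PDO.ext_comp fun n d => by
  rw [comp_PDO_mul, finsum_eq_single _ j]
  · rw [Dpow_apply, if_pos rfl, one_mul]
  · intro i hi
    rw [Dpow_apply, if_neg hi, zero_mul, comp_zero]

theorem const_mul (f : DiffAlg M) (b : PDO M) : PDO.const f * b = f • b :=
  PDO.ext_comp fun n d => by
    rw [comp_PDO_mul, finsum_eq_single _ 0]
    · rw [const_apply, if_pos rfl, Dl_zero]; rfl
    · intro i hi
      rw [const_apply, if_neg hi, zero_mul, comp_zero]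

theorem const_eq_smul (f : DiffAlg M) : PDO.const f = f • (Dpow 0 : PDO M) := PDO.ext fun n => by
  rw [PDO.fsmul_apply, const_apply, Dpow_apply]
  split_ifs <;> simp

theorem Dl_Dpow (i j : ℤ) : Dl i (Dpow j : PDO M) = Dpow (i + j) := by
  have h1 : ∀ j : ℤ, Dl 1 (Dpow j : PDO M) = Dpow (1 + j) := fun j => PDO.ext fun n => by
    rw [Dl_one_apply, Dpow_apply, Dpow_apply, Dpow_apply]
    have : der (if n = j then 1 else 0 : DiffAlg M) = 0 := by split_ifs <;> simp
    rw [this, add_zero]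
    simp only [sub_eq_iff_eq_add']
  induction i using Int.induction_on with
  | zero => rw [Dl_zero, zero_add]
  | succ i ih => rw [← Dl_one_Dl, ih, h1]; congr 1; ring
  | pred i ih =>
    refine Dl_one_injective ?_
    rw [Dl_one_Dl, sub_add_cancel, ih, h1]
    congr 1; ring

theorem mul_Dpow (a : PDO M) (j : ℤ) : a * Dpow j = shift j a := PDO.ext_comp fun n d => by
  rw [comp_PDO_mul, finsum_eq_single _ (n - j)]
  · rw [Dl_Dpow, Dpow_apply, if_pos (by ring), mul_one]; rfl
  · intro i hi
    rw [Dl_Dpow, Dpow_apply, if_neg (by omega), mul_zero, comp_zero]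

theorem one_eq_Dpow : (1 : PDO M) = Dpow 0 := rfl

theorem PDO.one_mul' (a : PDO M) : 1 * a = a := by rw [one_eq_Dpow, Dpow_mul, Dl_zero]

theorem PDO.mul_one' (a : PDO M) : a * 1 = a := by
  rw [one_eq_Dpow, mul_Dpow]
  exact PDO.ext fun n => by rw [shift, sub_zero]

/-- The monomial `f D^j`. -/
def mon (f : DiffAlg M) (j : ℤ) : PDO M := f • Dpow j

theorem mon_apply (f : DiffAlg M) (j n : ℤ) : mon f j n = if n = j then f else 0 := by
  rw [mon, PDO.fsmul_apply, Dpow_apply]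
  split_ifs <;> simp

theorem hasS_mon (a : PDO M) : HasS (fun i => mon (a i) i) a := fun n d =>
  ⟨{n}, fun i hi => by
    dsimp only
    rw [mon_apply, if_neg fun h => hi (Finset.mem_singleton.2 h.symm), comp_zero], by
    rw [Finset.sum_singleton]
    dsimp only
    rw [mon_apply, if_pos rfl]⟩

theorem mon_mem_cone {t : Bool} {m : ℤ} {a : PDO M} (ha : a ∈ cone t m) (i : ℤ) :
    mon (a i) i ∈ cone t m := fun n d h => by
  rw [mon_apply]
  split_ifs with hn
  · subst hn; exact ha n d h
  · exact comp_zero d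

theorem mon_zero (f : DiffAlg M) : mon f 0 = PDO.const f := (const_eq_smul f).symm

theorem Dl_one_mon (f : DiffAlg M) (j : ℤ) : Dl 1 (mon f j) = mon (der f) j + mon f (j + 1) := by
  rw [mon, Dl_one_fsmul, Dl_Dpow, add_comm 1 j]; rfl

theorem shift_const (f : DiffAlg M) (j : ℤ) : shift j (PDO.const f) = mon f j :=
  PDO.ext fun n => by
    rw [shift, const_apply, mon_apply]
    simp only [sub_eq_zero]

theorem shift_shift (i j : ℤ) (a : PDO M) : shift i (shift j a) = shift (i + j) a :=
  PDO.ext fun n => by simp only [shift, sub_sub]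

theorem shift_zero (a : PDO M) : shift 0 a = a := PDO.ext fun n => by rw [shift, sub_zero]

theorem InT.shift {t : Bool} {a : PDO M} (j : ℤ) (ha : InT t a) : InT t (shift j a) := by
  rw [← mul_Dpow]; exact ha.mul (InT.Dpow t j)

/-! ### The adjoint -/

theorem comp_Dl_const (i : ℤ) (f : DiffAlg M) (n : ℤ) (d : ℕ) :
    comp d (Dl i (PDO.const f) n) = ∑ r ∈ Finset.range (d + 1),
      if n + r = i then Ring.choose i r • comp d (der^[r] f) else 0 := by
  rw [comp_Dl i _ n d.lt_succ_self, comp_sum]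
  refine Finset.sum_congr rfl fun r _ => ?_
  rw [const_apply]
  by_cases h : n + r = i
  · rw [if_pos (by omega), if_pos h, comp_zsmul]
  · rw [if_neg (by omega), if_neg h, derIt_zero, smul_zero, comp_zero]

/-- The adjoint is the sum of the adjoints `(-D)^i · a_i` of the terms. -/
theorem hasS_adj (a : PDO M) :
    HasS (fun i => ((i.negOnePow : ℤˣ) : ℤ) • Dl i (PDO.const (a i))) (adj a) := fun n d => by
  classical
  refine ⟨(Finset.range (d + 1)).image fun r : ℕ => n + r, fun i hi => ?_, ?_⟩
  · dsimp only
    rw [PDO.zsmul_apply, comp_zsmul, comp_Dl_const, Finset.sum_eq_zero, smul_zero]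
    intro r hr
    rw [if_neg fun h => hi (Finset.mem_image.2 ⟨r, hr, h⟩)]
  · rw [Finset.sum_image fun r _ s _ h => by
      have : n + (r : ℤ) = n + s := h
      omega, adj, comp_ofComp]
    refine Finset.sum_congr rfl fun r hr => ?_
    dsimp only
    rw [PDO.zsmul_apply, comp_zsmul, comp_Dl_const, Finset.sum_eq_single r, if_pos rfl, mul_smul]
    · intro s _ hs
      rw [if_neg (by omega)]
    · exact fun h => absurd hr h

theorem adj_add (a b : PDO M) : adj (a + b) = adj a + adj b := PDO.ext_comp fun n d => by
  simp only [adj, comp_ofComp, PDO.add_apply, comp_add, derIt_add, smul_add,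
    Finset.sum_add_distrib]

theorem comp_adj_eq_zero {a : PDO M} {n : ℤ} {d : ℕ}
    (h : ∀ r : ℕ, r ≤ d → comp (d - r) (a (n + r)) = 0) : comp d (adj a n) = 0 := by
  rw [adj, comp_ofComp]
  refine Finset.sum_eq_zero fun r hr => ?_
  have hr : r ≤ d := by simpa [Nat.lt_succ_iff] using hr
  rw [comp_der_iterate, if_pos hr, h r hr,
    Function.iterate_fixed (f := jetD (M := M)) (x := 0) (by rw [jetD_eq, map_zero]) r, smul_zero]

theorem adj_local : LocalOn ⊤ (adj (M := M)) where
  add a _ b _ := adj_add a b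
  loc n d := ⟨(Finset.range (d + 1)).image fun r : ℕ => (n + (r : ℤ), d - r), fun a _ h =>
    comp_adj_eq_zero fun r hr => h _ (Finset.mem_image.2 ⟨r, by simpa [Nat.lt_succ_iff], rfl⟩)⟩

theorem adj_mem_cone {t : Bool} {m : ℤ} {a : PDO M} (ha : a ∈ cone t m) : adj a ∈ cone t m :=
  fun n d h => by
    refine comp_adj_eq_zero fun r hr => ha _ _ ?_
    cases t <;> simp only [wt] at h ⊢ <;> push_cast [hr] <;> omega

theorem InT.adj {t : Bool} {a : PDO M} (ha : InT t a) : InT t (adj a) :=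
  ha.imp fun _ h => adj_mem_cone h

theorem adj_zsmul (c : ℤ) (a : PDO M) : adj (c • a) = c • adj a :=
  adj_local.zsmul c trivial
theorem adj_neg (a : PDO M) : adj (-a) = -adj a := by
  have := adj_zsmul (-1) a
  simpa using this
theorem adj_sub (a b : PDO M) : adj (a - b) = adj a - adj b := by
  rw [sub_eq_add_neg, adj_add, adj_neg, sub_eq_add_neg]
theorem Dl_zsmul (i c : ℤ) (a : PDO M) : Dl i (c • a) = c • Dl i a :=
  (Dl_local i).zsmul c trivial

theorem adj_mon (f : DiffAlg M) (j : ℤ) :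
    adj (mon f j) = ((j.negOnePow : ℤˣ) : ℤ) • Dl j (PDO.const f) := by
  have h := (hasS_adj (mon f j)).unique (HasS.single j fun i hi => by
    rw [mon_apply, if_neg hi, show PDO.const (0 : DiffAlg M) = 0 from
      PDO.ext fun n => by rw [const_apply]; split_ifs <;> rfl, (Dl_local i).map_zero, smul_zero])
  rw [h, mon_apply, if_pos rfl]

theorem adj_const (f : DiffAlg M) : adj (PDO.const f) = PDO.const f := by
  rw [← mon_zero, adj_mon, Int.negOnePow_zero, Dl_zero, mon_zero, Units.val_one, one_smul]

theorem adj_fsmul {t : Bool} (f : DiffAlg M) {a : PDO M} (ha : InT t a) :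
    adj (f • a) = adj a * PDO.const f := by
  obtain ⟨m, hm⟩ := ha
  have h1 := adj_local.map_hasS_top ((fsmul_local f).map_hasS_top (hasS_mon a))
  have h2 := (mul_right_local (const_mem_cone t f) m).map_hasS
    (fun i => adj_mem_cone (mon_mem_cone hm i)) (adj_mem_cone hm)
    (adj_local.map_hasS_top (hasS_mon a))
  refine h1.unique (h2.congr fun i => ?_)
  have e : f • mon (a i) i = mon (f * a i) i := by rw [mon, mon, mul_smul]
  rw [e, adj_mon, adj_mon, (mul_right_local (const_mem_cone t f) _).zsmul _
    (Dl_mem_cone i (const_mem_cone t _)), Dl_mul i (InT.const t _) (InT.const t _), const_mul,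
    mul_comm f, const_eq_smul f, const_eq_smul, mul_smul]

theorem adj_Dl_one (a : PDO M) : adj (Dl 1 a) = -shift 1 (adj a) := by
  have h1 := adj_local.map_hasS_top ((Dl_local 1).map_hasS_top (hasS_mon a))
  have h2 := ((shift_local 1).map_hasS_top (adj_local.map_hasS_top (hasS_mon a))).neg
  refine h1.unique (h2.congr fun i => ?_)
  rw [Dl_one_mon, adj_add, adj_mon, adj_mon, adj_mon, (shift_local 1).zsmul _ trivial, ← Dl_shift,
    shift_const, Int.negOnePow_succ, Units.val_neg, neg_smul, ← Dl_Dl_one]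
  have e : Dl 1 (PDO.const (a i)) = PDO.const (der (a i)) + mon (a i) 1 := by
    rw [← mon_zero, Dl_one_mon, mon_zero, zero_add]
  rw [e, Dl_add, smul_add]
  abel

theorem adj_Dl (i : ℤ) (a : PDO M) :
    adj (Dl i a) = ((i.negOnePow : ℤˣ) : ℤ) • shift i (adj a) := by
  induction i using Int.induction_on with
  | zero => rw [Dl_zero, shift_zero, Int.negOnePow_zero, Units.val_one, one_smul]
  | succ i ih =>
    rw [← Dl_one_Dl, adj_Dl_one, ih, (shift_local 1).zsmul _ trivial, shift_shift,
      Int.negOnePow_succ, Units.val_neg, neg_smul, add_comm (1 : ℤ)]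
  | pred i ih =>
    have h := adj_Dl_one (Dl (-(i : ℤ) - 1) a)
    rw [Dl_one_Dl, sub_add_cancel, ih, eq_neg_iff_add_eq_zero] at h
    have h' := congrArg (shift (-1)) h
    have hadd : ∀ a b : PDO M, shift (-1) (a + b) = shift (-1) a + shift (-1) b := fun _ _ => rfl
    rw [hadd, (shift_local (-1)).zsmul _ trivial, shift_shift, shift_shift, neg_add_cancel,
      shift_zero, (shift_local (-1)).map_zero, add_comm, ← eq_neg_iff_add_eq_zero] at h'
    rw [h', Int.negOnePow_sub, Int.negOnePow_one, mul_neg_one, Units.val_neg, neg_smul]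
    congr 3
    ring

theorem negOnePow_smul_smul (i : ℤ) (a : PDO M) :
    ((i.negOnePow : ℤˣ) : ℤ) • ((i.negOnePow : ℤˣ) : ℤ) • a = a := by
  rw [smul_smul, ← Units.val_mul, Int.units_mul_self, Units.val_one, one_smul]

theorem adj_adj (a : PDO M) : adj (adj a) = a := by
  refine (adj_local.map_hasS_top (hasS_adj a)).unique ((hasS_mon a).congr fun i => ?_)
  rw [adj_zsmul, adj_Dl, adj_const, shift_const, negOnePow_smul_smul]

theorem shift_mul {t : Bool} (j : ℤ) {a c : PDO M} (ha : InT t a) (hc : InT t c) :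
    shift j a * c = a * Dl j c := by
  rw [← mul_Dpow, PDO.mul_assoc' ha (InT.Dpow t j) hc, Dpow_mul]

/-- The adjoint is an anti-homomorphism. -/
theorem adj_mul {t : Bool} {a b : PDO M} (ha : InT t a) (hb : InT t b) :
    adj (a * b) = adj b * adj a := by
  have h1 := adj_local.map_hasS_top (ha.hasS_mul hb)
  obtain ⟨m, hm⟩ := ha
  have hb' := hb
  obtain ⟨m', hm'⟩ := hb
  have h2 := (mul_left_local (adj_mem_cone hm') m).map_hasS (fun i => ?_) (adj_mem_cone hm)
    (hasS_adj a)
  · refine h1.unique (h2.congr fun i => ?_)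
    rw [adj_fsmul _ (hb'.Dl i), adj_Dl, (mul_left_local (adj_mem_cone hm') _).zsmul _
      (Dl_mem_cone i (const_mem_cone t _))]
    have := hb'.adj.shift i
    obtain ⟨m₁, hm₁⟩ := this
    rw [(mul_right_local (const_mem_cone t (a i)) m₁).zsmul _ hm₁,
      shift_mul i hb'.adj (InT.const t _)]
  · rw [← adj_mon]
    exact adj_mem_cone (mon_mem_cone hm i)

theorem adj_Dpow (j : ℤ) : adj (Dpow j : PDO M) = ((j.negOnePow : ℤˣ) : ℤ) • Dpow j := by
  have h := adj_mon (1 : DiffAlg M) j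
  have e : ∀ j, mon (1 : DiffAlg M) j = Dpow j := fun j => one_smul _ _
  rwa [← mon_zero, e, e, Dl_Dpow, add_zero] at h

/-! ### The trace -/

/-- Repeated integration by parts. -/
theorem mul_derIt_mem_range (r : ℕ) (f g : DiffAlg M) :
    f * der^[r] g - ((-1) ^ r : ℤ) • (g * der^[r] f) ∈ LinearMap.range derD.toLinearMap := by
  induction r generalizing f with
  | zero => simp [mul_comm]
  | succ r ih =>
    have e : f * der^[r + 1] g - ((-1) ^ (r + 1) : ℤ) • (g * der^[r + 1] f) =
        der (f * der^[r] g) - (der f * der^[r] g - ((-1) ^ r : ℤ) • (g * der^[r] (der f))) := by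
      rw [der_mul, Function.iterate_succ_apply', Function.iterate_succ_apply, pow_succ, mul_neg_one,
        neg_zsmul]
      abel
    rw [e]
    exact Submodule.sub_mem _ ⟨_, rfl⟩ (ih (der f))

/-- Matches the binomial coefficients of the residues of `a * b` and `b * a`, whose terms
correspond under `i ↦ r - 1 - i`. -/
theorem choose_reflect (i : ℤ) (r : ℕ) :
    Ring.choose ((r : ℤ) - 1 - i) r = (-1) ^ r * Ring.choose i r := by
  have h := Ring.choose_neg (-i) r
  rw [neg_neg] at h
  rw [h, show -i + (r : ℤ) - 1 = r - 1 - i by ring]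
  change _ = _ * (((Int.negOnePow r : ℤˣ) : ℤ) * _)
  rw [← mul_assoc, Int.negOnePow_def, zpow_natCast, Units.val_pow_eq_pow_val, Units.val_neg,
    Units.val_one, ← mul_pow]
  simp

theorem res_term_window {t : Bool} {m m' : ℤ} {a b : PDO M} (ha : a ∈ cone t m)
    (hb : b ∈ cone t m') {i n : ℤ} {d r : ℕ}
    (h : comp d (a i * der^[r] (b (n - i + r))) ≠ 0) : i ∈ window t m m' n d := by
  rw [comp_mul] at h
  obtain ⟨p, hp, hne⟩ := Finset.exists_ne_zero_of_sum_ne_zero h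
  have hp := Finset.HasAntidiagonal.mem_antidiagonal.1 hp
  rw [comp_der_iterate] at hne
  split_ifs at hne with hr
  · have h1 : m ≤ wt t i p.1 := by
      by_contra hlt
      exact hne (by rw [ha i p.1 (by omega), zero_mul])
    have h2 : m' ≤ wt t (n - i + r) (p.2 - r) := by
      by_contra hlt
      refine hne ?_
      rw [hb _ _ (by omega), Function.iterate_fixed (f := jetD (M := M)) (x := 0)
        (by rw [jetD_eq, map_zero]) r, mul_zero]
    cases t <;> simp only [wt, window] at h1 h2 ⊢ <;> simp only [if_true, Bool.false_eq_true,
      if_false, Finset.mem_Icc] <;> push_cast [hr] at h2 <;> omega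
  · simp at hne

theorem comp_mul_eq_sum {t : Bool} {m m' : ℤ} {a b : PDO M} (ha : a ∈ cone t m)
    (hb : b ∈ cone t m') (n : ℤ) (d : ℕ) : comp d ((a * b) n) =
      ∑ r ∈ Finset.range (d + 1), ∑ᶠ i : ℤ,
        Ring.choose i r • comp d (a i * der^[r] (b (n - i + r))) := by
  change comp d (PDO.mul a b n) = _
  rw [PDO.mul, comp_ofComp]
  refine finsum_sum_comm _ _ fun r _ => ?_
  refine (window t m m' n d).finite_toSet.subset fun i hi => ?_
  refine res_term_window ha hb (d := d) (r := r) fun h => hi ?_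
  simp only [h, smul_zero]

/-- The residue of a commutator is a total derivative. -/
theorem res_comm {t : Bool} {a b : PDO M} (ha : InT t a) (hb : InT t b) :
    ∃ g, (a * b) (-1) - (b * a) (-1) = der g := by
  obtain ⟨m, hm⟩ := ha
  obtain ⟨m', hm'⟩ := hb
  refine mem_range_der fun d => ?_
  suffices h : comp d ((a * b) (-1) - (b * a) (-1)) ∈
      (LinearMap.range derD.toLinearMap).map (compL (M := M) d) by
    obtain ⟨_, ⟨g, rfl⟩, hg⟩ := h
    exact ⟨g, hg.symm⟩
  rw [comp_sub, comp_mul_eq_sum hm hm', comp_mul_eq_sum hm' hm, ← Finset.sum_sub_distrib]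
  refine Submodule.sum_mem _ fun r _ => ?_
  have e : ∑ᶠ j : ℤ, Ring.choose j r • comp d (b j * der^[r] (a (-1 - j + r))) =
      ∑ᶠ i : ℤ, Ring.choose ((r : ℤ) - 1 - i) r •
        comp d (b (-1 - i + r) * der^[r] (a i)) := by
    rw [← finsum_comp_equiv (Equiv.subLeft ((r : ℤ) - 1))]
    refine finsum_congr fun i => ?_
    simp only [Equiv.subLeft_apply]
    rw [show -1 - ((r : ℤ) - 1 - i) + r = i by ring, show (r : ℤ) - 1 - i = -1 - i + r by ring]
  have fin1 : (Function.support fun i : ℤ =>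
      Ring.choose i r • comp d (a i * der^[r] (b (-1 - i + r)))).Finite :=
    (window t m m' (-1) d).finite_toSet.subset fun i hi =>
      res_term_window hm hm' (d := d) (r := r) fun h => hi (by simp only [h, smul_zero])
  have fin2 : (Function.support fun i : ℤ => Ring.choose ((r : ℤ) - 1 - i) r •
        comp d (b (-1 - i + r) * der^[r] (a i))).Finite := by
    refine ((window t m' m (-1) d).image fun j => (r : ℤ) - 1 - j).finite_toSet.subset
      fun i hi => ?_
    refine Finset.mem_coe.2 (Finset.mem_image.2 ⟨(r : ℤ) - 1 - i, ?_, by ring⟩)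
    refine res_term_window hm' hm (d := d) (r := r) fun h => hi ?_
    rw [show -1 - ((r : ℤ) - 1 - i) + r = i by ring, show (r : ℤ) - 1 - i = -1 - i + r by ring]
      at h
    simp only [h, smul_zero]
  rw [e, ← finsum_sub_distrib fin1 fin2]
  refine finsum_induction (· ∈ (LinearMap.range derD.toLinearMap).map (compL (M := M) d))
    (Submodule.zero_mem _) (fun _ _ => Submodule.add_mem _) fun i => ?_
  refine ⟨Ring.choose i r • (a i * der^[r] (b (-1 - i + r)) -
    ((-1) ^ r : ℤ) • (b (-1 - i + r) * der^[r] (a i))), ?_, ?_⟩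
  · exact zsmul_mem (mul_derIt_mem_range r _ _) _
  · rw [compL_apply, comp_zsmul, comp_sub, comp_zsmul, choose_reflect, smul_sub, smul_smul,
      mul_comm (Ring.choose i r)]

theorem tr_mul_comm {t : Bool} {a b : PDO M} (ha : InT t a) (hb : InT t b) :
    tr (a * b) = tr (b * a) := by
  obtain ⟨g, hg⟩ := res_comm ha hb
  rw [← sub_eq_zero, tr, tr, ← integral_sub, hg, integral_der]

theorem choose_eq_zero_of_lt {k r : ℕ} (h : k < r) : Ring.choose (k : ℤ) r = 0 := by
  rw [Ring.choose_natCast, Nat.choose_eq_zero_of_lt h, Nat.cast_zero]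

theorem adj_res (a : PDO M) : adj a (-1) = -a (-1) := DiffAlg.ext fun d => by
  rw [adj, comp_ofComp, Finset.sum_range_succ', Finset.sum_eq_zero]
  · simp
  · intro r _
    rw [show (-1 + ((r + 1 : ℕ) : ℤ)) = (r : ℤ) by push_cast; ring, choose_eq_zero_of_lt
      r.lt_succ_self, mul_zero, zero_smul]

theorem tr_adj (a : PDO M) : tr (adj a) = -tr a := by
  rw [tr, adj_res, integral_neg]; rfl

theorem tr_add (a b : PDO M) : tr (a + b) = tr a + tr b := rfl
theorem tr_smul (c : ℂ) (a : PDO M) : tr (c • a) = c • tr a := rfl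

/-! ### Positive and negative parts -/

/-- Differential operators. -/
def IsPos (a : PDO M) : Prop := ∀ i < 0, a i = 0

/-- Operators of negative order. -/
def IsNeg (a : PDO M) : Prop := ∀ i, 0 ≤ i → a i = 0

theorem pos_apply (a : PDO M) (i : ℤ) : pos a i = if 0 ≤ i then a i else 0 := rfl
theorem neg_apply (a : PDO M) (i : ℤ) : neg a i = if i < 0 then a i else 0 := rfl

theorem isPos_pos (a : PDO M) : IsPos (pos a) := fun i hi => by rw [pos_apply, if_neg (by omega)]
theorem isNeg_neg (a : PDO M) : IsNeg (neg a) := fun i hi => by rw [neg_apply, if_neg (by omega)]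

theorem pos_add_neg (a : PDO M) : pos a + neg a = a := PDO.ext fun i => by
  rw [PDO.add_apply, pos_apply, neg_apply]
  split_ifs <;> first | omega | simp

theorem IsPos.add {a b : PDO M} (ha : IsPos a) (hb : IsPos b) : IsPos (a + b) := fun i hi => by
  rw [PDO.add_apply, ha i hi, hb i hi, add_zero]
theorem IsPos.neg {a : PDO M} (ha : IsPos a) : IsPos (-a) := fun i hi => by
  rw [PDO.neg_apply, ha i hi, neg_zero]
theorem IsPos.sub {a b : PDO M} (ha : IsPos a) (hb : IsPos b) : IsPos (a - b) := fun i hi => by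
  rw [PDO.sub_apply, ha i hi, hb i hi, sub_zero]
theorem IsNeg.add {a b : PDO M} (ha : IsNeg a) (hb : IsNeg b) : IsNeg (a + b) := fun i hi => by
  rw [PDO.add_apply, ha i hi, hb i hi, add_zero]
theorem IsNeg.neg {a : PDO M} (ha : IsNeg a) : IsNeg (-a) := fun i hi => by
  rw [PDO.neg_apply, ha i hi, neg_zero]
theorem IsNeg.sub {a b : PDO M} (ha : IsNeg a) (hb : IsNeg b) : IsNeg (a - b) := fun i hi => by
  rw [PDO.sub_apply, ha i hi, hb i hi, sub_zero]

theorem pos_add (a b : PDO M) : pos (a + b) = pos a + pos b := PDO.ext fun i => by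
  simp only [PDO.add_apply, pos_apply]; split_ifs <;> simp
theorem neg_add' (a b : PDO M) : neg (a + b) = neg a + neg b := PDO.ext fun i => by
  simp only [PDO.add_apply, neg_apply]; split_ifs <;> simp
theorem pos_neg' (a : PDO M) : pos (-a) = -pos a := PDO.ext fun i => by
  simp only [PDO.neg_apply, pos_apply]; split_ifs <;> simp
theorem neg_neg' (a : PDO M) : neg (-a) = -neg a := PDO.ext fun i => by
  simp only [PDO.neg_apply, neg_apply]; split_ifs <;> simp
theorem neg_sub' (a b : PDO M) : neg (a - b) = neg a - neg b := by
  rw [sub_eq_add_neg, neg_add', neg_neg', sub_eq_add_neg]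

theorem IsPos.pos_eq {a : PDO M} (ha : IsPos a) : pos a = a := PDO.ext fun i => by
  rw [pos_apply]; split_ifs with h
  · rfl
  · rw [ha i (by omega)]
theorem IsPos.neg_eq {a : PDO M} (ha : IsPos a) : TwoBKP.neg a = 0 := PDO.ext fun i => by
  rw [neg_apply]; split_ifs with h
  · rw [ha i h]; rfl
  · rfl
theorem IsNeg.neg_eq {a : PDO M} (ha : IsNeg a) : TwoBKP.neg a = a := PDO.ext fun i => by
  rw [neg_apply]; split_ifs with h
  · rfl
  · rw [ha i (by omega)]
theorem IsNeg.pos_eq {a : PDO M} (ha : IsNeg a) : pos a = 0 := PDO.ext fun i => by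
  rw [pos_apply]; split_ifs with h
  · rw [ha i h]; rfl
  · rfl

theorem Ring_choose_eq_zero {i : ℤ} {r : ℕ} (h0 : 0 ≤ i) (h : i < r) : Ring.choose i r = 0 := by
  obtain ⟨k, rfl⟩ := Int.eq_ofNat_of_zero_le h0
  exact choose_eq_zero_of_lt (by omega)

theorem IsPos.Dl {b : PDO M} (hb : IsPos b) {i : ℤ} (hi : 0 ≤ i) : IsPos (Dl i b) := fun n hn =>
  DiffAlg.ext fun d => by
    rw [comp_Dl i b n d.lt_succ_self, comp_sum, comp_zero]
    refine Finset.sum_eq_zero fun r _ => ?_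
    by_cases h : n - i + r < 0
    · rw [hb _ h, derIt_zero, smul_zero, comp_zero]
    · rw [Ring_choose_eq_zero hi (by omega), zero_smul, comp_zero]

theorem Dl_apply_eq_zero {b : PDO M} {i n : ℤ} (h : ∀ r : ℕ, b (n - i + r) = 0) :
    Dl i b n = 0 := DiffAlg.ext fun d =>
  (comp_Dl_eq_zero fun r _ => by rw [h r, comp_zero]).trans (comp_zero d).symm

theorem mul_apply_eq_zero {a b : PDO M} {n : ℤ} (h : ∀ i, a i * Dl i b n = 0) :
    (a * b) n = 0 := DiffAlg.ext fun d => by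
  rw [comp_PDO_mul, comp_zero]
  exact finsum_eq_zero_of_forall_eq_zero fun i => by rw [h i, comp_zero]

theorem IsPos.mul {a b : PDO M} (ha : IsPos a) (hb : IsPos b) : IsPos (a * b) := fun n hn =>
  mul_apply_eq_zero fun i => by
    by_cases hi : i < 0
    · rw [ha i hi, zero_mul]
    · rw [hb.Dl (by omega) n hn, mul_zero]

/-- `a` vanishes above order `N`. -/
def OrdLE (N : ℤ) (a : PDO M) : Prop := ∀ i, N < i → a i = 0

theorem OrdLE.mul {N N' : ℤ} {a b : PDO M} (ha : OrdLE N a) (hb : OrdLE N' b) :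
    OrdLE (N + N') (a * b) := fun n hn => mul_apply_eq_zero fun i => by
  by_cases hi : N < i
  · rw [ha i hi, zero_mul]
  · rw [Dl_apply_eq_zero fun r => hb _ (by omega), mul_zero]

theorem isNeg_iff {a : PDO M} : IsNeg a ↔ OrdLE (-1) a :=
  ⟨fun h i hi => h i (by omega), fun h i hi => h i (by omega)⟩

theorem OrdLE.mono {N N' : ℤ} (h : N ≤ N') {a : PDO M} (ha : OrdLE N a) : OrdLE N' a :=
  fun i hi => ha i (by omega)

theorem IsNeg.ordLE_mul {a b : PDO M} (ha : IsNeg a) (hb : IsNeg b) : OrdLE (-2) (a * b) :=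
  (isNeg_iff.1 ha).mul (isNeg_iff.1 hb)

theorem IsNeg.mul {a b : PDO M} (ha : IsNeg a) (hb : IsNeg b) : IsNeg (a * b) :=
  isNeg_iff.2 ((ha.ordLE_mul hb).mono (by norm_num))

theorem IsNeg.tr_mul {a b : PDO M} (ha : IsNeg a) (hb : IsNeg b) : tr (a * b) = 0 := by
  rw [tr, ha.ordLE_mul hb (-1) (by norm_num), integral_zero]

theorem IsPos.tr_eq {a : PDO M} (ha : IsPos a) : tr a = 0 := by
  rw [tr, ha (-1) (by norm_num), integral_zero]

theorem IsNeg.adj {a : PDO M} (ha : IsNeg a) : IsNeg (adj a) := fun n hn =>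
  DiffAlg.ext fun d => (comp_adj_eq_zero fun r _ => by rw [ha _ (by omega), comp_zero]).trans
    (comp_zero d).symm

theorem IsPos.adj {a : PDO M} (ha : IsPos a) : IsPos (adj a) := fun n hn =>
  DiffAlg.ext fun d => by
    rw [TwoBKP.adj, comp_ofComp, comp_zero]
    refine Finset.sum_eq_zero fun r _ => ?_
    by_cases h : n + r < 0
    · rw [ha _ h, derIt_zero, comp_zero, smul_zero]
    · rw [Ring_choose_eq_zero (by omega) (by omega), mul_zero, zero_smul]

theorem adj_pos_add_adj_neg (a : PDO M) : adj a = adj (pos a) + adj (neg a) := by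
  rw [← adj_add, pos_add_neg]

theorem adj_pos (a : PDO M) : adj (pos a) = pos (adj a) := by
  rw [adj_pos_add_adj_neg a, pos_add, (isPos_pos a).adj.pos_eq, (isNeg_neg a).adj.pos_eq, add_zero]

theorem neg_adj (a : PDO M) : neg (adj a) = adj (neg a) := by
  rw [adj_pos_add_adj_neg a, neg_add', (isPos_pos a).adj.neg_eq, (isNeg_neg a).adj.neg_eq, zero_add]

theorem IsNeg.inT_false {a : PDO M} (h : IsNeg a) : InT false a :=
  ⟨1, fun i d hi => by rw [h i (by simp only [wt] at hi; omega), comp_zero]⟩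

theorem IsPos.inT_true {a : PDO M} (h : IsPos a) : InT true a :=
  ⟨0, fun i d hi => by rw [h i (by simp only [wt] at hi; omega), comp_zero]⟩

theorem InT.pos {t : Bool} {a : PDO M} (ha : InT t a) : InT t (pos a) := by
  obtain ⟨m, hm⟩ := ha
  refine ⟨m, fun i d h => ?_⟩
  rw [pos_apply]
  split_ifs
  · exact hm i d h
  · exact comp_zero d

theorem InT.neg_part {t : Bool} {a : PDO M} (ha : InT t a) : InT t (TwoBKP.neg a) := by
  obtain ⟨m, hm⟩ := ha
  refine ⟨m, fun i d h => ?_⟩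
  rw [neg_apply]
  split_ifs
  · exact hm i d h
  · exact comp_zero d

theorem OrdLE.inT {N : ℤ} {a : PDO M} (h : OrdLE N a) : InT false a := inMinus_iff.1 ⟨N, h⟩

/-! ### The rings of operators -/

theorem InT.smul {t : Bool} (c : ℂ) {a : PDO M} (ha : InT t a) : InT t (c • a) :=
  ha.imp fun m h i d hi => by rw [PDO.smul_apply, comp_smul, h i d hi, smul_zero]

/-- The space `𝒟⁻` (`t = false`) or `𝒟⁺` (`t = true`). -/
def opSub (M : Opens (Coord → ℝ)) (t : Bool) : Submodule ℂ (PDO M) where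
  carrier := {a | InT t a}
  zero_mem' := InT.zero t
  add_mem' := InT.add
  smul_mem' c _ h := InT.smul c h

/-- The algebra `𝒟⁻` (`t = false`) or `𝒟⁺` (`t = true`). -/
abbrev Op (M : Opens (Coord → ℝ)) (t : Bool) : Type := opSub M t

theorem InT.one (t : Bool) : InT t (1 : PDO M) := InT.Dpow t 0

instance (t : Bool) : Ring (Op M t) :=
  { (inferInstance : AddCommGroup (Op M t)) with
    mul := fun a b => ⟨a.1 * b.1, InT.mul a.2 b.2⟩
    one := ⟨1, InT.one t⟩
    left_distrib := fun a b c => Subtype.ext (PDO.left_distrib' a.2 b.2 c.2)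
    right_distrib := fun a b c => Subtype.ext (PDO.right_distrib' a.2 b.2 c.2)
    zero_mul := fun a => Subtype.ext ((mul_right_local a.2.choose_spec 0).map_zero)
    mul_zero := fun a => Subtype.ext ((mul_left_local a.2.choose_spec 0).map_zero)
    mul_assoc := fun a b c => Subtype.ext (PDO.mul_assoc' a.2 b.2 c.2)
    one_mul := fun a => Subtype.ext (PDO.one_mul' a.1)
    mul_one := fun a => Subtype.ext (PDO.mul_one' a.1) }

namespace Op
variable {t : Bool}

@[simp] theorem coe_mul (a b : Op M t) : ((a * b : Op M t) : PDO M) = (a : PDO M) * b := rfl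
@[simp] theorem coe_one : ((1 : Op M t) : PDO M) = 1 := rfl
@[simp] theorem coe_add (a b : Op M t) : ((a + b : Op M t) : PDO M) = a + b := rfl
@[simp] theorem coe_sub (a b : Op M t) : ((a - b : Op M t) : PDO M) = a - b := rfl
@[simp] theorem coe_neg (a : Op M t) : ((-a : Op M t) : PDO M) = -a := rfl
@[simp] theorem coe_pow (a : Op M t) (k : ℕ) : ((a ^ k : Op M t) : PDO M) = (a : PDO M) ^ k := by
  induction k with
  | zero => rfl
  | succ k ih =>
    rw [pow_succ, coe_mul, ih]
    rfl

theorem ext {a b : Op M t} (h : (a : PDO M) = b) : a = b := Subtype.ext h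

/-- The power `D^j`. -/
def D (t : Bool) (j : ℤ) : Op M t := ⟨Dpow j, InT.Dpow t j⟩

@[simp] theorem coe_D (j : ℤ) : ((D t j : Op M t) : PDO M) = Dpow j := rfl

theorem D_mul_D (i j : ℤ) : (D t i : Op M t) * D t j = D t (i + j) :=
  ext (by rw [coe_mul, coe_D, coe_D, Dpow_mul, Dl_Dpow]; rfl)

theorem D_zero : (D t 0 : Op M t) = 1 := rfl

/-- The operator of multiplication by a function. -/
def const (t : Bool) (f : DiffAlg M) : Op M t := ⟨PDO.const f, InT.const t f⟩

@[simp] theorem coe_const (f : DiffAlg M) : ((const t f : Op M t) : PDO M) = PDO.const f := rfl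

/-- The adjoint. -/
def star (t : Bool) : Op M t →+ Op M t where
  toFun a := ⟨adj a.1, InT.adj a.2⟩
  map_zero' := ext adj_local.map_zero
  map_add' a b := ext (adj_add a.1 b.1)

@[simp] theorem coe_star (a : Op M t) : (star t a : PDO M) = adj a := rfl
theorem star_mul (a b : Op M t) : star t (a * b) = star t b * star t a := ext (adj_mul a.2 b.2)
theorem star_star (a : Op M t) : star t (star t a) = a := ext (adj_adj a.1)
theorem star_D (j : ℤ) : star t (D t j : Op M t) = ((j.negOnePow : ℤˣ) : ℤ) • D t j :=
  ext (by
    rw [coe_star, coe_D, adj_Dpow]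
    rcases Int.units_eq_one_or j.negOnePow with h | h <;> simp [h])
theorem star_D_one : star t (D t 1 : Op M t) = -D t 1 := by
  rw [star_D, Int.negOnePow_one]; simp
theorem star_D_neg_one : star t (D t (-1) : Op M t) = -D t (-1) := by
  rw [star_D, Int.negOnePow_neg, Int.negOnePow_one]; simp
theorem star_const (f : DiffAlg M) : star t (const t f) = const t f := ext (adj_const f)

theorem star_pow (a : Op M t) (k : ℕ) : star t (a ^ k) = star t a ^ k := by
  induction k with
  | zero => exact ext (by
      rw [pow_zero, pow_zero, coe_star, coe_one, one_eq_Dpow, adj_Dpow]; simp)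
  | succ k ih => rw [pow_succ, star_mul, ih, pow_succ']

end Op

/-! ### Evolutionary derivations of operators -/

section ev
variable (Y : Coord → DiffAlg M)

theorem evOp_apply (a : PDO M) (n : ℤ) : evOp Y a n = ev Y (a n) := rfl

theorem evOp_add (a b : PDO M) : evOp Y (a + b) = evOp Y a + evOp Y b :=
  PDO.ext fun _ => ev_add Y _ _
theorem evOp_zsmul (c : ℤ) (a : PDO M) : evOp Y (c • a) = c • evOp Y a :=
  PDO.ext fun _ => ev_zsmul Y _ _

theorem comp_ev_eq_zero {f : DiffAlg M} {d : ℕ} (h : ∀ e ≤ d, comp e f = 0) :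
    comp d (ev Y f) = 0 := by
  rw [comp_ev]
  refine Finset.sum_eq_zero fun p hp => ?_
  rw [h p.2 (Finset.HasAntidiagonal.antidiagonal.snd_le hp), map_zero]

theorem evOp_local : LocalOn ⊤ (evOp (M := M) Y) where
  add a _ b _ := evOp_add Y a b
  loc n d := ⟨(Finset.range (d + 1)).image fun e => (n, e), fun a _ h =>
    comp_ev_eq_zero Y fun e he => h (n, e)
      (Finset.mem_image.2 ⟨e, Finset.mem_range.2 (by omega), rfl⟩)⟩

theorem InT.evOp {t : Bool} {a : PDO M} (ha : InT t a) : InT t (evOp Y a) := by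
  obtain ⟨m, hm⟩ := ha
  refine ⟨m, fun n d h => comp_ev_eq_zero Y fun e he => hm n e ?_⟩
  cases t <;> simp only [wt] at h ⊢ <;> omega

theorem evOp_Dl (i : ℤ) (a : PDO M) : evOp Y (Dl i a) = Dl i (evOp Y a) := by
  have h1 : ∀ a : PDO M, evOp Y (Dl 1 a) = Dl 1 (evOp Y a) := fun a => PDO.ext fun n => by
    rw [Dl_one_apply, evOp_apply, Dl_one_apply, ev_add, ev_der, evOp_apply, evOp_apply]
  induction i using Int.induction_on with
  | zero => rw [Dl_zero, Dl_zero]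
  | succ i ih => rw [← Dl_one_Dl, h1, ih, Dl_one_Dl]
  | pred i ih =>
    refine Dl_one_injective ?_
    rw [← h1, Dl_one_Dl, Dl_one_Dl, sub_add_cancel, ih]

theorem evOp_fsmul (f : DiffAlg M) (a : PDO M) :
    evOp Y (f • a) = f • evOp Y a + ev Y f • a := PDO.ext fun n => ev_mul Y f (a n)

theorem evOp_mul {t : Bool} {a b : PDO M} (ha : InT t a) (hb : InT t b) :
    evOp Y (a * b) = a * evOp Y b + evOp Y a * b := by
  refine ((evOp_local Y).map_hasS_top (ha.hasS_mul hb)).unique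
    (((ha.hasS_mul (hb.evOp Y)).add ((ha.evOp Y).hasS_mul hb)).congr fun i => ?_)
  rw [evOp_fsmul, evOp_Dl, evOp_apply]

theorem evOp_const (f : DiffAlg M) : evOp Y (PDO.const f) = PDO.const (ev Y f) :=
  PDO.ext fun n => by
    rw [evOp_apply, const_apply, const_apply]
    split_ifs
    · rfl
    · exact ev_zero Y

theorem evOp_Dpow (j : ℤ) : evOp Y (Dpow j : PDO M) = 0 := PDO.ext fun n => by
  rw [evOp_apply, Dpow_apply]
  split_ifs
  · exact ev_one Y
  · exact ev_zero Y

theorem evOp_adj (a : PDO M) : evOp Y (adj a) = adj (evOp Y a) := by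
  refine ((evOp_local Y).map_hasS_top (hasS_adj a)).unique ((hasS_adj (evOp Y a)).congr fun i => ?_)
  rw [evOp_zsmul, evOp_Dl, evOp_const, evOp_apply]

theorem evOp_pos (a : PDO M) : evOp Y (pos a) = pos (evOp Y a) := PDO.ext fun n => by
  rw [evOp_apply, pos_apply, pos_apply]
  split_ifs
  · rfl
  · exact ev_zero Y

theorem evOp_neg_part (a : PDO M) : evOp Y (neg a) = neg (evOp Y a) := PDO.ext fun n => by
  rw [evOp_apply, neg_apply, neg_apply]
  split_ifs
  · rfl
  · exact ev_zero Y

theorem tr_evOp (a : PDO M) : tr (evOp Y a) = evLoc Y (tr a) := rfl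

theorem evOp_commutator (Z : Coord → DiffAlg M) (a : PDO M) :
    evOp Y (evOp Z a) - evOp Z (evOp Y a) = evOp (fun k => ev Y (Z k) - ev Z (Y k)) a :=
  PDO.ext fun _ => ev_commutator Y Z _

/-- The evolutionary derivation of the algebra of operators. -/
def Op.ev (t : Bool) : Op M t →+ Op M t where
  toFun a := ⟨evOp Y a.1, InT.evOp Y a.2⟩
  map_zero' := Op.ext (evOp_local Y).map_zero
  map_add' a b := Op.ext (evOp_add Y a.1 b.1)

theorem Op.ev_mul {t : Bool} (a b : Op M t) :
    Op.ev Y t (a * b) = a * Op.ev Y t b + Op.ev Y t a * b := Op.ext (evOp_mul Y a.2 b.2)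

theorem Op.ev_D (t : Bool) (j : ℤ) : Op.ev Y t (Op.D t j) = 0 := Op.ext (evOp_Dpow Y j)

end ev

/-! ### Quadratic brackets of split rings with involution -/

/-- A ring with an involution `st`, an invariant trace `t` for which `st` is skew, and a projection
`π` whose image and kernel are isotropic Lie subrings. -/
structure SplitRing (R V : Type*) [Ring R] [AddCommGroup V] where
  /-- the involution -/
  st : R →+ R
  /-- the trace -/
  t : R →+ V
  /-- the projection -/
  π : R →+ R
  st_mul : ∀ x y, st (x * y) = st y * st x
  st_st : ∀ x, st (st x) = x
  t_comm : ∀ x y, t (x * y) = t (y * x)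
  t_st : ∀ x, t (st x) = -t x
  π_π : ∀ x, π (π x) = π x
  π_range : ∀ x y, π (π x * π y - π y * π x) = π x * π y - π y * π x
  π_ker : ∀ x y, π ((x - π x) * (y - π y) - (y - π y) * (x - π x)) = 0
  isotropic_range : ∀ x y, t (π x * π y) = 0
  isotropic_ker : ∀ x y, t ((x - π x) * (y - π y)) = 0

namespace SplitRing

variable {R V : Type*} [Ring R] [AddCommGroup V] (S : SplitRing R V)

/-- The infinitesimal action `A w + w^* A` of `w` on `A`. -/
def act (A w : R) : R := A * w + S.st w * A

/-- The Poisson tensor `X ↦ A π(XA) + π(XA)^* A`. -/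
def tensor (A X : R) : R := S.act A (S.π (X * A))

theorem act_add (A w w' : R) : S.act A (w + w') = S.act A w + S.act A w' := by
  simp only [act, map_add]; noncomm_ring

theorem st_act {A : R} (hA : S.st A = -A) (w : R) : S.st (S.act A w) = -S.act A w := by
  simp only [act, map_add, S.st_mul, S.st_st, hA]; noncomm_ring

/-- The projections onto the two isotropic complements are adjoint to each other. -/
theorem t_mul_π (x y : R) : S.t (x * S.π y) = S.t ((x - S.π x) * y) := by
  have h1 : S.t (x * S.π y) = S.t ((x - S.π x) * S.π y) := by
    rw [sub_mul, map_sub, S.isotropic_range, sub_zero]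
  have h2 : S.t ((x - S.π x) * y) = S.t ((x - S.π x) * S.π y) := by
    rw [← sub_eq_zero, ← map_sub, ← mul_sub, S.isotropic_ker]
  rw [h1, h2]

theorem t_mul_act {A X : R} (hA : S.st A = -A) (hX : S.st X = X) (w : R) :
    S.t (X * S.act A w) = S.t (X * A * w) + S.t (X * A * w) := by
  have h : S.t (X * (S.st w * A)) = S.t (X * A * w) := by
    rw [← neg_neg (S.t (X * (S.st w * A))), ← S.t_st, S.st_mul, S.st_mul, S.st_st, hA, hX,
      neg_mul, neg_mul, map_neg, neg_neg, S.t_comm, mul_assoc]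
  rw [act, mul_add, map_add, h, mul_assoc]

theorem t_sym_mul {A X Y : R} (hA : S.st A = -A) (hX : S.st X = X) (hY : S.st Y = Y) :
    S.t (X * A * (Y * A)) + S.t (X * A * (Y * A)) = 0 := by
  have h : S.t (X * A * (Y * A)) = -S.t (A * Y * (A * X)) := by
    rw [← S.t_st]
    simp only [S.st_mul, hA, hX, hY]
    congr 1
    noncomm_ring
  nth_rw 2 [h]
  rw [show A * Y * (A * X) = A * (Y * A * X) by noncomm_ring, S.t_comm A,
    show Y * A * X * A = Y * A * (X * A) by noncomm_ring, S.t_comm, add_neg_cancel]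

/-- The tensor is skew-symmetric. -/
theorem tensor_skew {A X Y : R} (hA : S.st A = -A) (hX : S.st X = X) (hY : S.st Y = Y) :
    S.t (X * S.tensor A Y) = -S.t (Y * S.tensor A X) := by
  rw [tensor, tensor, S.t_mul_act hA hX, S.t_mul_act hA hY, eq_neg_iff_add_eq_zero]
  have h : S.t (X * A * S.π (Y * A)) = S.t (X * A * (Y * A)) - S.t (Y * A * S.π (X * A)) := by
    rw [S.t_mul_π, sub_mul, map_sub, S.t_comm (S.π (X * A))]
  rw [h, ← S.t_sym_mul hA hX hY]
  abel

/-- The algebraic part of the gradient of the bracket of functionals with gradients `X`, `Y`. -/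
def gradAlg (A X Y : R) : R :=
  S.π (Y * A) * X + X * S.st (S.π (Y * A)) - (S.π (X * A) * Y + Y * S.st (S.π (X * A))) +
    (X * A * Y - Y * A * X)

theorem st_gradAlg {A X Y : R} (hA : S.st A = -A) (hX : S.st X = X) (hY : S.st Y = Y) :
    S.st (S.gradAlg A X Y) = S.gradAlg A X Y := by
  simp only [gradAlg, map_add, map_sub, S.st_mul, S.st_st, hA, hX, hY]
  noncomm_ring

theorem t_anti_mul {B : R} (hB : S.st B = -B) {Y : R} (hY : S.st Y = Y) (w : R) :
    S.t (w * Y * B) = S.t (Y * S.st w * B) := by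
  rw [← neg_neg (S.t (w * Y * B)), ← S.t_st]
  simp only [S.st_mul, hB, hY, neg_mul, map_neg, neg_neg]
  rw [S.t_comm]

/-- The variation of the bracket. -/
theorem variation_tensor {A X Y : R} (hA : S.st A = -A) (hX : S.st X = X) (hY : S.st Y = Y)
    (δ : R →+ R) (hδ : ∀ x y, δ (x * y) = x * δ y + δ x * y) (hst : ∀ x, δ (S.st x) = S.st (δ x))
    (hπ : ∀ x, δ (S.π x) = S.π (δ x)) :
    S.t (δ (X * S.tensor A Y)) = S.t (δ X * S.tensor A Y) - S.t (δ Y * S.tensor A X) +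
      S.t (S.gradAlg A X Y * δ A) := by
  have hB : S.st (δ A) = -δ A := by rw [← hst, hA, map_neg]
  have hδY : S.st (δ Y) = δ Y := by rw [← hst, hY]
  have e1 : X * δ (S.tensor A Y) = X * S.act A (S.π (δ (Y * A))) +
      (X * (δ A * S.π (Y * A)) + X * S.st (S.π (Y * A)) * δ A) := by
    simp only [tensor, act, hδ, hst, hπ, map_add, mul_add, add_mul]
    noncomm_ring
  have e2 : S.t (X * (δ A * S.π (Y * A))) = S.t (S.π (Y * A) * X * δ A) := by
    rw [← mul_assoc, S.t_comm, mul_assoc]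
  have e3 : S.t (X * A * (δ Y * A)) + S.t (X * A * (δ Y * A)) = 0 := S.t_sym_mul hA hX hδY
  have e4 : S.t (δ Y * S.tensor A X) =
      S.t (S.π (X * A) * (δ Y * A)) + S.t (S.π (X * A) * (δ Y * A)) := by
    rw [tensor, S.t_mul_act hA hδY, S.t_comm]
  have e5 : S.t (X * A * Y * δ A) = -S.t (Y * A * X * δ A) := by
    rw [← S.t_st]
    simp only [S.st_mul, hA, hB, hX, hY]
    rw [S.t_comm (X * A * Y)]
    congr 1
    noncomm_ring
  have e6 : S.t (S.π (X * A) * Y * δ A) = S.t (Y * S.st (S.π (X * A)) * δ A) :=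
    S.t_anti_mul hB hY _
  have e7 : S.t (X * A * S.π (δ (Y * A))) = S.t (X * A * (δ Y * A)) + S.t (X * A * Y * δ A) -
      S.t (S.π (X * A) * (δ Y * A)) - S.t (S.π (X * A) * Y * δ A) := by
    rw [S.t_mul_π, hδ, sub_mul, mul_add, mul_add, map_sub, map_add, map_add,
      ← mul_assoc (X * A) Y, ← mul_assoc (S.π (X * A)) Y]
    abel
  rw [hδ, map_add, e1, map_add, map_add, e2, S.t_mul_act hA hX, e4, gradAlg]
  simp only [add_mul, sub_mul, map_add, map_sub]
  rw [e7, ← e6]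
  have e3' : S.t (X * A * (δ Y * A)) = -S.t (X * A * (δ Y * A)) := eq_neg_of_add_eq_zero_left e3
  have e5' := e5
  have e8 : S.t (X * A * Y * δ A) - S.t (Y * A * X * δ A) =
      S.t (X * A * Y * δ A) + S.t (X * A * Y * δ A) := by
    nth_rw 3 [e5]; abel
  rw [e8]
  have e9 : ∀ a b c d e f g : V, a + a = 0 →
      a + b - c - d + (a + b - c - d) + (e + f) + g = g - (c + c) + (e + f - (d + d) + (b + b)) := by
    intro a b c d e f g h
    have : a + b - c - d + (a + b - c - d) + (e + f) + g =
      (a + a) + (g - (c + c) + (e + f - (d + d) + (b + b))) := by abel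
    rw [this, h, zero_add]
  exact e9 _ _ _ _ _ _ _ e3

/-- The Hamiltonian vector fields of two functionals commute up to the Hamiltonian vector field of
their bracket. -/
theorem commutator_tensor {A X Y : R} (δX δY : R →+ R)
    (hX : ∀ x y, δX (x * y) = x * δX y + δX x * y) (hY : ∀ x y, δY (x * y) = x * δY y + δY x * y)
    (hstX : ∀ x, δX (S.st x) = S.st (δX x)) (hstY : ∀ x, δY (S.st x) = S.st (δY x))
    (hπX : ∀ x, δX (S.π x) = S.π (δX x)) (hπY : ∀ x, δY (S.π x) = S.π (δY x))
    (hAX : δX A = S.tensor A X) (hAY : δY A = S.tensor A Y) :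
    δY (δX A) - δX (δY A) = S.tensor A (δY X - δX Y + S.gradAlg A X Y) := by
  set w := S.π (X * A) with hw
  set u := S.π (Y * A) with hu
  have hδX : δX A = A * w + S.st w * A := hAX
  have hδY : δY A = A * u + S.st u * A := hAY
  have h1 : δY (δX A) - δX (δY A) = S.act A (u * w - w * u + (δY w - δX u)) := by
    rw [hδX, hδY]
    simp only [map_add, hX, hY, hstX, hstY, hδX, hδY, act, map_sub, S.st_mul]
    noncomm_ring
  rw [h1, tensor]
  congr 1
  have h2 : δY w - δX u = S.π ((δY X - δX Y) * A + (X * (A * u) + X * (S.st u * A)) -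
      (Y * (A * w) + Y * (S.st w * A))) := by
    rw [hw, hu, hπX, hπY, hX, hY, hδX, hδY, ← map_sub]
    congr 1
    noncomm_ring
  have h3 : (δY X - δX Y + S.gradAlg A X Y) * A =
      ((δY X - δX Y) * A + (X * (A * u) + X * (S.st u * A)) -
      (Y * (A * w) + Y * (S.st w * A))) +
      ((X * A - w) * (Y * A - u) - (Y * A - u) * (X * A - w)) + (u * w - w * u) := by
    simp only [gradAlg, ← hw, ← hu]
    noncomm_ring
  rw [h3, map_add, map_add, ← h2, hw, hu, S.π_ker, S.π_range, add_zero, add_comm]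

end SplitRing

/-! ### The splitting of `𝒟⁻ × 𝒟⁺` -/

/-- The ring `𝔇 = 𝒟⁻ × 𝒟⁺`. -/
abbrev Dd (M : Opens (Coord → ℝ)) : Type := Op M false × Op M true

/-- The negative part, as an element of `𝒟⁻`. -/
def nn (t : Bool) : Op M t →+ Op M false :=
  AddMonoidHom.mk' (fun a => ⟨neg a.1, (isNeg_neg _).inT_false⟩) fun a b =>
    Op.ext (neg_add' a.1 b.1)

/-- The positive part, as an element of `𝒟⁺`. -/
def pp (t : Bool) : Op M t →+ Op M true :=
  AddMonoidHom.mk' (fun a => ⟨pos a.1, (isPos_pos _).inT_true⟩) fun a b =>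
    Op.ext (pos_add a.1 b.1)

@[simp] theorem coe_nn {t : Bool} (a : Op M t) : (nn t a : PDO M) = neg a := rfl
@[simp] theorem coe_pp {t : Bool} (a : Op M t) : (pp t a : PDO M) = pos a := rfl

/-- The adjoint on `𝔇`. -/
def stD (M : Opens (Coord → ℝ)) : Dd M →+ Dd M := (Op.star false).prodMap (Op.star true)

theorem stD_apply (x : Dd M) : stD M x = (Op.star false x.1, Op.star true x.2) := rfl

/-- The trace on `𝔇`. -/
def trD (M : Opens (Coord → ℝ)) : Dd M →+ LocalFun M :=
  AddMonoidHom.mk' (fun x => tr (x.1 : PDO M) + tr (x.2 : PDO M)) fun x y => by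
    simp only [Prod.fst_add, Prod.snd_add, Op.coe_add, tr_add]
    abel

theorem trD_apply (x : Dd M) : trD M x = tr (x.1 : PDO M) + tr (x.2 : PDO M) := rfl

/-- The projection of `𝔇` onto the operators `(W, Ŵ)` with `W` of negative order and `Ŵ`
differential, along the subspace of the pairs `(Z, -Z^*)`. -/
def prD (M : Opens (Coord → ℝ)) : Dd M →+ Dd M :=
  AddMonoidHom.mk' (fun x => (nn false x.1 + Op.star false (nn true x.2),
    pp true x.2 + Op.star true (pp false x.1))) fun x y => by
    simp only [Prod.fst_add, Prod.snd_add, map_add, Prod.mk_add_mk, Prod.mk.injEq]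
    constructor <;> abel

theorem prD_apply (x : Dd M) : prD M x = (nn false x.1 + Op.star false (nn true x.2),
    pp true x.2 + Op.star true (pp false x.1)) := rfl

theorem Dd.ext {x y : Dd M} (h1 : (x.1 : PDO M) = y.1) (h2 : (x.2 : PDO M) = y.2) : x = y :=
  Prod.ext (Op.ext h1) (Op.ext h2)

theorem isNeg_prD (x : Dd M) : IsNeg ((prD M x).1 : PDO M) :=
  (isNeg_neg _).add (isNeg_neg _).adj

theorem isPos_prD (x : Dd M) : IsPos ((prD M x).2 : PDO M) :=
  (isPos_pos _).add (isPos_pos _).adj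

theorem prD_eq_self {x : Dd M} (h1 : IsNeg (x.1 : PDO M)) (h2 : IsPos (x.2 : PDO M)) :
    prD M x = x := by
  refine Dd.ext ?_ ?_
  · change neg (x.1 : PDO M) + adj (neg (x.2 : PDO M)) = _
    rw [h1.neg_eq, h2.neg_eq, adj_local.map_zero, add_zero]
  · change pos (x.2 : PDO M) + adj (pos (x.1 : PDO M)) = _
    rw [h1.pos_eq, h2.pos_eq, adj_local.map_zero, add_zero]

theorem prD_eq_zero {x : Dd M} (h : (x.2 : PDO M) = -adj (x.1 : PDO M)) : prD M x = 0 := by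
  refine Dd.ext ?_ ?_
  · change neg (x.1 : PDO M) + adj (neg (x.2 : PDO M)) = 0
    rw [h, neg_neg', adj_neg, neg_adj, adj_adj, add_neg_cancel]
  · change pos (x.2 : PDO M) + adj (pos (x.1 : PDO M)) = 0
    rw [h, pos_neg', adj_pos, neg_add_cancel]

theorem sub_prD (x : Dd M) : InT true (((x - prD M x).1 : Op M false) : PDO M) ∧
    ((x - prD M x).2 : PDO M) = -adj ((x - prD M x).1 : PDO M) := by
  have e1 : ((x - prD M x).1 : PDO M) = pos (x.1 : PDO M) - adj (neg (x.2 : PDO M)) := by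
    change (x.1 : PDO M) - (neg (x.1 : PDO M) + adj (neg (x.2 : PDO M))) = _
    nth_rw 1 [← pos_add_neg (x.1 : PDO M)]
    abel
  refine ⟨?_, ?_⟩
  · rw [e1]
    exact (isPos_pos _).inT_true.sub x.2.2.neg_part.adj
  · rw [e1, adj_sub, adj_adj]
    change (x.2 : PDO M) - (pos (x.2 : PDO M) + adj (pos (x.1 : PDO M))) = _
    nth_rw 1 [← pos_add_neg (x.2 : PDO M)]
    abel

theorem sub_prD_eq (x : Dd M) : ∃ z : Op M true, (z : PDO M) = (x - prD M x).1 ∧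
    (x - prD M x).2 = -Op.star true z :=
  ⟨⟨_, (sub_prD x).1⟩, rfl, Op.ext (sub_prD x).2⟩

/-- The algebra `𝔇` with the adjoint, the trace and the splitting into the isotropic Lie
subalgebras `{(W, Ŵ) | W = W_-, Ŵ = Ŵ_+}` and `{(Z, -Z^*)}`. -/
def splitD (M : Opens (Coord → ℝ)) : SplitRing (Dd M) (LocalFun M) where
  st := stD M
  t := trD M
  π := prD M
  st_mul x y := Prod.ext (Op.star_mul _ _) (Op.star_mul _ _)
  st_st x := Prod.ext (Op.star_star _) (Op.star_star _)
  t_comm x y := congrArg₂ (· + ·) (tr_mul_comm x.1.2 y.1.2) (tr_mul_comm x.2.2 y.2.2)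
  t_st x := by
    rw [trD_apply, trD_apply, stD_apply]
    simp only [Op.coe_star, tr_adj]
    abel
  π_π x := prD_eq_self (isNeg_prD x) (isPos_prD x)
  π_range x y := prD_eq_self
    (((isNeg_prD x).mul (isNeg_prD y)).sub ((isNeg_prD y).mul (isNeg_prD x)))
    (((isPos_prD x).mul (isPos_prD y)).sub ((isPos_prD y).mul (isPos_prD x)))
  π_ker x y := by
    obtain ⟨z, hz1, hz2⟩ := sub_prD_eq x
    obtain ⟨w, hw1, hw2⟩ := sub_prD_eq y
    refine prD_eq_zero ?_
    simp only [Prod.fst_sub, Prod.snd_sub, Prod.fst_mul, Prod.snd_mul] at hz1 hz2 hw1 hw2 ⊢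
    rw [hz2, hw2]
    have e : -Op.star true z * -Op.star true w - -Op.star true w * -Op.star true z =
        -Op.star true (z * w - w * z) := by
      rw [map_sub, Op.star_mul, Op.star_mul]; noncomm_ring
    rw [e]
    simp only [Op.coe_neg, Op.coe_star, Op.coe_sub, Op.coe_mul, hz1, hw1]
  isotropic_range x y := by
    rw [trD_apply]
    have h1 : tr (((prD M x * prD M y).1 : Op M false) : PDO M) = 0 :=
      (isNeg_prD x).tr_mul (isNeg_prD y)
    have h2 : tr (((prD M x * prD M y).2 : Op M true) : PDO M) = 0 :=
      ((isPos_prD x).mul (isPos_prD y)).tr_eq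
    rw [h1, h2, add_zero]
  isotropic_ker x y := by
    obtain ⟨z, hz1, hz2⟩ := sub_prD_eq x
    obtain ⟨w, hw1, hw2⟩ := sub_prD_eq y
    rw [trD_apply, Prod.fst_mul, Prod.snd_mul, hz2, hw2, neg_mul_neg, ← Op.star_mul, Op.coe_star,
      tr_adj, Op.coe_mul, Op.coe_mul, ← hz1, ← hw1, tr_mul_comm w.2 z.2, add_neg_cancel]

/-- The evolutionary derivation of `𝔇`. -/
def evDd (Y : Coord → DiffAlg M) : Dd M →+ Dd M := (Op.ev Y false).prodMap (Op.ev Y true)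

theorem evDd_apply (Y : Coord → DiffAlg M) (x : Dd M) :
    evDd Y x = (Op.ev Y false x.1, Op.ev Y true x.2) := rfl

theorem evDd_mul (Y : Coord → DiffAlg M) (x y : Dd M) :
    evDd Y (x * y) = x * evDd Y y + evDd Y x * y :=
  Prod.ext (Op.ev_mul Y _ _) (Op.ev_mul Y _ _)

theorem evDd_st (Y : Coord → DiffAlg M) (x : Dd M) : evDd Y (stD M x) = stD M (evDd Y x) :=
  Dd.ext (evOp_adj Y _) (evOp_adj Y _)

theorem evDd_pr (Y : Coord → DiffAlg M) (x : Dd M) : evDd Y (prD M x) = prD M (evDd Y x) := by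
  refine Dd.ext ?_ ?_
  · change evOp Y (neg (x.1 : PDO M) + adj (neg (x.2 : PDO M))) = _
    rw [evOp_add, evOp_adj, evOp_neg_part, evOp_neg_part]
    rfl
  · change evOp Y (pos (x.2 : PDO M) + adj (pos (x.1 : PDO M))) = _
    rw [evOp_add, evOp_adj, evOp_pos, evOp_pos]
    rfl

theorem trD_evDd (Y : Coord → DiffAlg M) (x : Dd M) : trD M (evDd Y x) = evLoc Y (trD M x) := by
  rw [trD_apply, trD_apply, map_add, ← tr_evOp, ← tr_evOp]
  rfl

theorem evDd_commutator (Y Z : Coord → DiffAlg M) (x : Dd M) :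
    evDd Y (evDd Z x) - evDd Z (evDd Y x) = evDd (fun k => ev Y (Z k) - ev Z (Y k)) x :=
  Dd.ext (evOp_commutator Y Z _) (evOp_commutator Y Z _)

/-! ### Poisson brackets of functionals with a gradient -/

/-- `x` is a variational gradient of `F` with respect to `a`. -/
structure IsGrad (a : Dd M) (F : LocalFun M) (x : Dd M) : Prop where
  st : stD M x = x
  var : ∀ Y, evLoc Y F = trD M (x * evDd Y a)

/-- The tensor at `b` takes values in the tangent space at `a`. -/
def Tangent (a b : Dd M) : Prop :=
  ∀ x, stD M x = x → ∃ Y, evDd Y a = (splitD M).tensor b x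

section Poisson

variable {a b : Dd M}

theorem IsGrad.add {F G : LocalFun M} {x y : Dd M} (hx : IsGrad a F x) (hy : IsGrad a G y) :
    IsGrad a (F + G) (x + y) :=
  ⟨by rw [map_add, hx.st, hy.st], fun Y => by rw [map_add, hx.var, hy.var, add_mul, map_add]⟩

theorem Op.smul_mul {t : Bool} (c : ℂ) (x y : Op M t) : (c • x) * y = c • (x * y) := by
  refine Op.ext ?_
  have h : ∀ z : PDO M, c • z = (algebraMap ℂ (DiffAlg M) c) • z := fun z => PDO.ext fun n => by
    rw [PDO.smul_apply, PDO.fsmul_apply, Algebra.smul_def]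
  change (c • (x : PDO M)) * (y : PDO M) = c • ((x : PDO M) * y)
  rw [h, h, fsmul_mul _ x.2 y.2]

theorem trD_smul_mul (c : ℂ) (x y : Dd M) : trD M ((c • x) * y) = c • trD M (x * y) := by
  rw [trD_apply, trD_apply, smul_add, ← tr_smul, ← tr_smul]
  have e1 := congrArg (fun z : Op M false => (z : PDO M)) (Op.smul_mul c x.1 y.1)
  have e2 := congrArg (fun z : Op M true => (z : PDO M)) (Op.smul_mul c x.2 y.2)
  exact congrArg₂ (· + ·) (congrArg tr e1) (congrArg tr e2)

theorem adj_smul (c : ℂ) (z : PDO M) : adj (c • z) = c • adj z := PDO.ext_comp fun n d => by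
  simp only [adj, comp_ofComp, PDO.smul_apply, derIt_smul, comp_smul, Finset.smul_sum]
  exact Finset.sum_congr rfl fun r _ => smul_comm _ _ _

theorem IsGrad.smul (c : ℂ) {F : LocalFun M} {x : Dd M} (hx : IsGrad a F x) :
    IsGrad a (c • F) (c • x) := by
  refine ⟨?_, fun Y => by rw [map_smul, hx.var, trD_smul_mul]⟩
  nth_rw 2 [← hx.st]
  exact Dd.ext (adj_smul c _) (adj_smul c _)

theorem IsGrad.zero (a : Dd M) : IsGrad a 0 0 :=
  ⟨map_zero _, fun Y => by rw [map_zero, zero_mul, map_zero]⟩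

/-- The point `b` is a translate of `a` by constants at which the quadratic tensor is tangent. -/
structure IsAdmissible (a b : Dd M) : Prop where
  st : stD M b = -b
  ev : ∀ Y, evDd Y b = evDd Y a
  tangent : Tangent a b

theorem IsGrad.eq_trD_tensor {F : LocalFun M} {x y : Dd M} (hx : IsGrad a F x) {Y}
    (hY : evDd Y a = (splitD M).tensor b y) : evLoc Y F = trD M (x * (splitD M).tensor b y) := by
  rw [hx.var, hY]

theorem trD_tensor_skew (hb : IsAdmissible a b) {x y : Dd M} (hx : stD M x = x)
    (hy : stD M y = y) :
    trD M (x * (splitD M).tensor b y) = -trD M (y * (splitD M).tensor b x) :=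
  (splitD M).tensor_skew hb.st hx hy

/-- The value of the bracket does not depend on the choice of the gradients. -/
theorem trD_tensor_unique (hb : IsAdmissible a b) {F G : LocalFun M} {x x' y y' : Dd M}
    (hx : IsGrad a F x) (hx' : IsGrad a F x') (hy : IsGrad a G y) (hy' : IsGrad a G y') :
    trD M (x * (splitD M).tensor b y) = trD M (x' * (splitD M).tensor b y') := by
  obtain ⟨Y, hY⟩ := hb.tangent y hy.st
  obtain ⟨X, hX⟩ := hb.tangent x' hx'.st
  rw [← hx.eq_trD_tensor hY, hx'.eq_trD_tensor hY, trD_tensor_skew hb hx'.st hy.st,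
    ← hy.eq_trD_tensor hX, hy'.eq_trD_tensor hX, ← trD_tensor_skew hb hx'.st hy'.st]

theorem trD_second_variation {F : LocalFun M} {x : Dd M} (hx : IsGrad a F x)
    (Y Z : Coord → DiffAlg M) :
    trD M (evDd Y x * evDd Z a) = trD M (evDd Z x * evDd Y a) := by
  have h := evLoc_commutator Y Z F
  rw [hx.var, hx.var, hx.var, ← trD_evDd, ← trD_evDd, ← map_sub, evDd_mul, evDd_mul,
    ← evDd_commutator, mul_sub, ← sub_eq_zero, ← map_sub] at h
  rw [← sub_eq_zero, ← map_sub, ← h]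
  congr 1
  noncomm_ring

/-- The gradient of the bracket of two functionals. -/
theorem isGrad_bracket (hb : IsAdmissible a b) {F G : LocalFun M} {x y : Dd M}
    (hx : IsGrad a F x) (hy : IsGrad a G y) {X Y : Coord → DiffAlg M}
    (hX : evDd X a = (splitD M).tensor b x) (hY : evDd Y a = (splitD M).tensor b y) :
    IsGrad a (trD M (x * (splitD M).tensor b y))
      (evDd Y x - evDd X y + (splitD M).gradAlg b x y) := by
  refine ⟨?_, fun Z => ?_⟩
  · have h := (splitD M).st_gradAlg (A := b) hb.st hx.st hy.st
    rw [map_add, map_sub, ← evDd_st, ← evDd_st, hx.st, hy.st]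
    congr 1
  · have h := (splitD M).variation_tensor (A := b) hb.st hx.st hy.st (evDd Z) (evDd_mul Z)
      (evDd_st Z) (evDd_pr Z)
    rw [← trD_evDd]
    refine h.trans ?_
    change trD M _ - trD M _ + trD M _ = _
    rw [hb.ev, ← hX, ← hY, trD_second_variation hx, trD_second_variation hy, add_mul, sub_mul,
      map_add, map_sub]

/-- The Jacobi identity. -/
theorem trD_tensor_jacobi (hb : IsAdmissible a b) {F G H : LocalFun M} {x y z u v w : Dd M}
    (hx : IsGrad a F x) (hy : IsGrad a G y) (hz : IsGrad a H z)
    (hu : IsGrad a (trD M (x * (splitD M).tensor b y)) u)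
    (hv : IsGrad a (trD M (y * (splitD M).tensor b z)) v)
    (hw : IsGrad a (trD M (z * (splitD M).tensor b x)) w) :
    trD M (u * (splitD M).tensor b z) + trD M (v * (splitD M).tensor b x) +
      trD M (w * (splitD M).tensor b y) = 0 := by
  obtain ⟨X, hX⟩ := hb.tangent x hx.st
  obtain ⟨Y, hY⟩ := hb.tangent y hy.st
  obtain ⟨Z, hZ⟩ := hb.tangent z hz.st
  have hv' := isGrad_bracket hb hy hz hY hZ
  have key : evDd Z (evDd Y b) - evDd Y (evDd Z b) =
      (splitD M).tensor b (evDd Z y - evDd Y z + (splitD M).gradAlg b y z) :=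
    (splitD M).commutator_tensor (evDd Y) (evDd Z) (evDd_mul Y) (evDd_mul Z) (evDd_st Y)
      (evDd_st Z) (evDd_pr Y) (evDd_pr Z) ((hb.ev Y).trans hY) ((hb.ev Z).trans hZ)
  rw [trD_tensor_unique hb hv hv' hx hx, trD_tensor_skew hb hv'.st hx.st, ← key, hb.ev, hb.ev,
    evDd_commutator, ← hx.var, ← evLoc_commutator, ← hu.eq_trD_tensor hZ, ← hw.eq_trD_tensor hY,
    ← hx.eq_trD_tensor hY, trD_tensor_skew hb hz.st hx.st, ← hx.eq_trD_tensor hZ, map_neg]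
  abel

theorem isPoissonBracket_of_val (hb : IsAdmissible a b) (S : Set (LocalFun M))
    (hS : ∀ F, F ∈ S ↔ ∃ x, IsGrad a F x) (br : LocalFun M → LocalFun M → LocalFun M)
    (hbr : ∀ F G x y, IsGrad a F x → IsGrad a G y →
      br F G = trD M (x * (splitD M).tensor b y)) : IsPoissonBracket S br := by
  have hgrad : ∀ F ∈ S, ∀ G ∈ S, ∃ u, IsGrad a (br F G) u := by
    intro F hF G hG
    obtain ⟨x, hx⟩ := (hS F).1 hF
    obtain ⟨y, hy⟩ := (hS G).1 hG
    obtain ⟨X, hX⟩ := hb.tangent x hx.st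
    obtain ⟨Y, hY⟩ := hb.tangent y hy.st
    rw [hbr F G x y hx hy]
    exact ⟨_, isGrad_bracket hb hx hy hX hY⟩
  constructor
  · exact (hS 0).2 ⟨0, IsGrad.zero a⟩
  · intro F hF G hG
    obtain ⟨x, hx⟩ := (hS F).1 hF
    obtain ⟨y, hy⟩ := (hS G).1 hG
    exact (hS _).2 ⟨_, hx.add hy⟩
  · intro c F hF
    obtain ⟨x, hx⟩ := (hS F).1 hF
    exact (hS _).2 ⟨_, hx.smul c⟩
  · exact fun F hF G hG => (hS _).2 (hgrad F hF G hG)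
  · intro F hF G hG H hH
    obtain ⟨x, hx⟩ := (hS F).1 hF
    obtain ⟨y, hy⟩ := (hS G).1 hG
    obtain ⟨z, hz⟩ := (hS H).1 hH
    rw [hbr _ _ _ _ (hx.add hy) hz, hbr _ _ _ _ hx hz, hbr _ _ _ _ hy hz, add_mul, map_add]
  · intro c F hF G hG
    obtain ⟨x, hx⟩ := (hS F).1 hF
    obtain ⟨y, hy⟩ := (hS G).1 hG
    rw [hbr _ _ _ _ (hx.smul c) hy, hbr _ _ _ _ hx hy, trD_smul_mul]
  · intro F hF G hG
    obtain ⟨x, hx⟩ := (hS F).1 hF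
    obtain ⟨y, hy⟩ := (hS G).1 hG
    rw [hbr _ _ _ _ hx hy, hbr _ _ _ _ hy hx, trD_tensor_skew hb hx.st hy.st]
  · intro F hF G hG H hH
    obtain ⟨x, hx⟩ := (hS F).1 hF
    obtain ⟨y, hy⟩ := (hS G).1 hG
    obtain ⟨z, hz⟩ := (hS H).1 hH
    obtain ⟨u, hu⟩ := hgrad F hF G hG
    obtain ⟨v, hv⟩ := hgrad G hG H hH
    obtain ⟨w, hw⟩ := hgrad H hH F hF
    rw [hbr _ _ _ _ hu hz, hbr _ _ _ _ hv hx, hbr _ _ _ _ hw hy]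
    rw [hbr _ _ _ _ hx hy] at hu
    rw [hbr _ _ _ _ hy hz] at hv
    rw [hbr _ _ _ _ hz hx] at hw
    exact trD_tensor_jacobi hb hx hy hz hu hv hw

end Poisson

/-- Two brackets are compatible if the second one and its sum and difference with the first one are
Poisson brackets. -/
theorem IsPoissonBracket.pencil {V : Type*} [AddCommGroup V] [Module ℂ V] {S : Set V}
    {b₁ b₂ : V → V → V} (h0 : IsPoissonBracket S b₂)
    (hp : IsPoissonBracket S fun F G => b₂ F G + b₁ F G)
    (hm : IsPoissonBracket S fun F G => b₂ F G - b₁ F G) (a b : ℂ) :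
    IsPoissonBracket S fun F G => a • b₁ F G + b • b₂ F G := by
  have hsub : ∀ F ∈ S, ∀ G ∈ S, F - G ∈ S := fun F hF G hG => by
    have := h0.add_mem F hF _ (h0.smul_mem (-1) G hG)
    rwa [neg_one_smul, ← sub_eq_add_neg] at this
  have m2 := h0.bracket_mem
  have m1 : ∀ F ∈ S, ∀ G ∈ S, b₁ F G ∈ S := fun F hF G hG => by
    have := hsub _ (hp.bracket_mem F hF G hG) _ (m2 F hF G hG)
    rwa [add_sub_cancel_left] at this
  have a2 := h0.add_left
  have a1 : ∀ F ∈ S, ∀ G ∈ S, ∀ H ∈ S, b₁ (F + G) H = b₁ F H + b₁ G H := fun F hF G hG H hH => by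
    have := hp.add_left F hF G hG H hH
    simp only [a2 F hF G hG H hH] at this
    have e : b₁ (F + G) H = (b₂ F H + b₂ G H + b₁ (F + G) H) - (b₂ F H + b₂ G H) := by abel
    rw [e, this]; abel
  have s2 := h0.smul_left
  have s1 : ∀ c : ℂ, ∀ F ∈ S, ∀ G ∈ S, b₁ (c • F) G = c • b₁ F G := fun c F hF G hG => by
    have := hp.smul_left c F hF G hG
    simp only [s2 c F hF G hG, smul_add] at this
    exact add_left_cancel this
  have k2 := h0.skew
  have k1 : ∀ F ∈ S, ∀ G ∈ S, b₁ F G = -b₁ G F := fun F hF G hG => by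
    have := hp.skew F hF G hG
    simp only [k2 F hF G hG, neg_add] at this
    exact add_left_cancel this
  have sum_expand : ∀ c d c' d' : ℂ, ∀ F ∈ S, ∀ G ∈ S, ∀ H ∈ S,
      c • b₁ (c' • b₁ F G + d' • b₂ F G) H + d • b₂ (c' • b₁ F G + d' • b₂ F G) H =
      (c * c') • b₁ (b₁ F G) H + (c * d') • b₁ (b₂ F G) H + (d * c') • b₂ (b₁ F G) H +
        (d * d') • b₂ (b₂ F G) H := fun c d c' d' F hF G hG H hH => by
    have n1 := m1 F hF G hG
    have n2 := m2 F hF G hG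
    rw [a1 _ (h0.smul_mem c' _ n1) _ (h0.smul_mem d' _ n2) H hH,
      a2 _ (h0.smul_mem c' _ n1) _ (h0.smul_mem d' _ n2) H hH, s1 c' _ n1 H hH, s1 d' _ n2 H hH,
      s2 c' _ n1 H hH, s2 d' _ n2 H hH]
    module
  refine ⟨h0.zero_mem, h0.add_mem, h0.smul_mem, fun F hF G hG => ?_, fun F hF G hG H hH => ?_,
    fun c F hF G hG => ?_, fun F hF G hG => ?_, fun F hF G hG H hH => ?_⟩
  · exact h0.add_mem _ (h0.smul_mem a _ (m1 F hF G hG)) _ (h0.smul_mem b _ (m2 F hF G hG))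
  · simp only [a1 F hF G hG H hH, a2 F hF G hG H hH]
    module
  · simp only [s1 c F hF G hG, s2 c F hF G hG]
    module
  · simp only [k1 F hF G hG, k2 F hF G hG]
    module
  · have j2 := h0.jacobi F hF G hG H hH
    have jp := hp.jacobi F hF G hG H hH
    have jm := hm.jacobi F hF G hG H hH
    have ep : ∀ F ∈ S, ∀ G ∈ S, ∀ H ∈ S, b₂ (b₂ F G + b₁ F G) H + b₁ (b₂ F G + b₁ F G) H =
        b₁ (b₁ F G) H + b₁ (b₂ F G) H + b₂ (b₁ F G) H + b₂ (b₂ F G) H :=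
      fun F hF G hG H hH => by
        have := sum_expand 1 1 1 1 F hF G hG H hH
        simp only [one_smul, one_mul] at this
        rw [← this, add_comm (b₂ F G), add_comm]
    have em : ∀ F ∈ S, ∀ G ∈ S, ∀ H ∈ S, b₂ (b₂ F G - b₁ F G) H - b₁ (b₂ F G - b₁ F G) H =
        b₁ (b₁ F G) H - b₁ (b₂ F G) H - b₂ (b₁ F G) H + b₂ (b₂ F G) H :=
      fun F hF G hG H hH => by
        have := sum_expand (-1) 1 (-1) 1 F hF G hG H hH
        simp only [one_smul, one_mul, neg_smul, neg_mul, neg_neg, mul_one] at this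
        have e : b₂ F G - b₁ F G = -b₁ F G + b₂ F G := by abel
        rw [e, sub_eq_neg_add, this]
        abel
    simp only [ep F hF G hG H hH, ep G hG H hH F hF, ep H hH F hF G hG] at jp
    simp only [em F hF G hG H hH, em G hG H hH F hF, em H hH F hF G hG] at jm
    simp only [sum_expand a b a b F hF G hG H hH, sum_expand a b a b G hG H hH F hF,
      sum_expand a b a b H hH F hF G hG]
    have j11 : b₁ (b₁ F G) H + b₁ (b₁ G H) F + b₁ (b₁ H F) G = 0 := by
      linear_combination (norm := module) (1 / 2 : ℂ) • jp + (1 / 2 : ℂ) • jm - j2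
    linear_combination (norm := module) (a * a - a * b) • j11 + (a * b) • jp + (b * b - a * b) • j2

/-! ### The two Poisson tensors -/

theorem eq_zero_of_eq_neg {V : Type*} [AddCommGroup V] [Module ℂ V] {x : V} (h : x = -x) :
    x = 0 := by
  have h2 : (2 : ℂ) • x = 0 := by
    rw [two_smul]
    nth_rw 2 [h]
    exact add_neg_cancel x
  exact (smul_eq_zero.1 h2).resolve_left two_ne_zero

theorem Dl_neg_one_zero (T : PDO M) : Dl (-1) T 0 = adj (shift (-1) T) 0 := by
  refine DiffAlg.ext fun d => ?_
  rw [comp_Dl _ _ _ (Nat.lt_succ_self d), comp_sum]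
  simp only [adj, comp_ofComp]
  refine Finset.sum_congr rfl fun r _ => ?_
  have h1 : Ring.choose (-1 : ℤ) r = (-1) ^ r := by
    have := choose_reflect (-1) r
    simp only [sub_neg_eq_add, sub_add_cancel] at this
    rw [Ring.choose_natCast, Nat.choose_self, Nat.cast_one] at this
    have h : ((-1 : ℤ) ^ r) * (-1) ^ r = 1 := by rw [← mul_pow]; simp
    calc Ring.choose (-1 : ℤ) r = ((-1) ^ r * (-1) ^ r) * Ring.choose (-1 : ℤ) r := by
          rw [h, one_mul]
      _ = (-1) ^ r := by rw [mul_assoc, ← this, mul_one]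
  have h2 : (((0 + (r : ℤ)).negOnePow : ℤˣ) : ℤ) * Ring.choose (0 + (r : ℤ)) r = (-1) ^ r := by
    rw [zero_add, Ring.choose_natCast, Nat.choose_self, Int.negOnePow_def]
    simp
  rw [comp_zsmul, h1, h2]
  congr 3
  change T _ = T _
  congr 1
  ring

/-- The zeroth coefficient of `D⁻¹T` vanishes for a symmetric operator `T`. -/
theorem Dl_neg_one_zero_of_symm {T : PDO M} (h : adj T = T) : Dl (-1) T 0 = 0 := by
  refine eq_zero_of_eq_neg ?_
  have e := adj_Dl (-1) T
  rw [h] at e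
  have e1 : shift (-1) T = -adj (Dl (-1) T) := by
    rw [e]; simp
  nth_rw 1 [Dl_neg_one_zero, e1, adj_neg, adj_adj]
  rfl

theorem res_eq_zero_of_symm {T : PDO M} (h : adj T = T) : T (-1) = 0 := by
  refine eq_zero_of_eq_neg ?_
  nth_rw 1 [← h]
  exact adj_res T

theorem Dl_one_neg {u v : PDO M} (h : Dl 1 u = shift 1 v) (h0 : u 0 = 0) :
    Dl 1 (neg u) = shift 1 (neg v) := PDO.ext fun n => by
  have hn := congrFun h n
  rw [Dl_one_apply] at hn ⊢
  change _ = neg v (n - 1)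
  change _ = v (n - 1) at hn
  simp only [neg_apply]
  by_cases h1 : n < 0
  · rw [if_pos (by omega), if_pos h1, if_pos (by omega), hn]
  · by_cases h2 : n = 0
    · subst h2
      rw [h0, der_zero, add_zero] at hn
      rw [if_pos (by omega), if_neg h1, if_pos (by omega), der_zero, add_zero, hn]
    · rw [if_neg (by omega), if_neg h1, if_neg (by omega), der_zero, add_zero]

theorem Dl_one_pos {u v : PDO M} (h : Dl 1 u = shift 1 v) (h0 : u 0 = 0) :
    Dl 1 (pos u) = shift 1 (pos v) := by
  have h1 := Dl_one_neg h h0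
  have h2 : Dl 1 (pos u) + Dl 1 (neg u) = shift 1 (pos v) + shift 1 (neg v) := by
    rw [← Dl_add, pos_add_neg, h, ← (shift_local 1).add _ trivial _ trivial, pos_add_neg]
  rw [h1] at h2
  exact add_right_cancel h2

theorem coe_D_mul {t : Bool} (j : ℤ) (x : Op M t) :
    ((Op.D t j * x : Op M t) : PDO M) = Dl j x := Dpow_mul j _

theorem coe_mul_D {t : Bool} (j : ℤ) (x : Op M t) :
    ((x * Op.D t j : Op M t) : PDO M) = shift j x := mul_Dpow _ j

/-- The polarization of the quadratic tensor. -/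
def bilD (b c x : Dd M) : Dd M :=
  (b.1 * (nn _ (x.1 * c.1) - nn _ (c.2 * x.2)) + (nn _ (x.2 * c.2) - nn _ (c.1 * x.1)) * b.1,
    b.2 * (pp _ (x.2 * c.2) - pp _ (c.1 * x.1)) + (pp _ (x.1 * c.1) - pp _ (c.2 * x.2)) * b.2)

theorem star_nn {t : Bool} (x : Op M t) : Op.star false (nn t x) = nn t (Op.star t x) :=
  Op.ext (neg_adj x.1).symm

theorem star_pp {t : Bool} (x : Op M t) : Op.star true (pp t x) = pp t (Op.star t x) :=
  Op.ext (adj_pos x.1)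

theorem tensor_eq_bilD {b x : Dd M} (hb : stD M b = -b) (hx : stD M x = x) :
    (splitD M).tensor b x = bilD b b x := by
  obtain ⟨b1, b2⟩ := b
  obtain ⟨x1, x2⟩ := x
  simp only [stD_apply, Prod.mk.injEq, Prod.neg_mk] at hb hx
  change (b1, b2) * prD M ((x1, x2) * (b1, b2)) +
    stD M (prD M ((x1, x2) * (b1, b2))) * (b1, b2) = _
  simp only [Prod.mk_mul_mk, prD_apply, stD_apply, Prod.mk_add_mk, bilD, Prod.mk.injEq]
  have e1 : Op.star false (nn true (x2 * b2)) = -nn true (b2 * x2) := by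
    rw [star_nn, Op.star_mul, hb.2, hx.2, neg_mul, map_neg]
  have e2 : Op.star false (nn false (x1 * b1)) = -nn false (b1 * x1) := by
    rw [star_nn, Op.star_mul, hb.1, hx.1, neg_mul, map_neg]
  have e3 : Op.star true (pp true (x2 * b2)) = -pp true (b2 * x2) := by
    rw [star_pp, Op.star_mul, hb.2, hx.2, neg_mul, map_neg]
  have e4 : Op.star true (pp false (x1 * b1)) = -pp false (b1 * x1) := by
    rw [star_pp, Op.star_mul, hb.1, hx.1, neg_mul, map_neg]
  have e5 : Op.star false (nn true (b2 * x2)) = -nn true (x2 * b2) := by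
    rw [star_nn, Op.star_mul, hb.2, hx.2, mul_neg, map_neg]
  have e6 : Op.star true (pp false (b1 * x1)) = -pp false (x1 * b1) := by
    rw [star_pp, Op.star_mul, hb.1, hx.1, mul_neg, map_neg]
  rw [e1, e4, map_add, map_neg, map_add, map_neg, e2, e3, e5, e6]
  constructor <;> noncomm_ring

/-- The constant operators `(D⁻¹, D)`, along which the first tensor is the derivative of the second
one. -/
def JD (M : Opens (Coord → ℝ)) : Dd M := (Op.D false (-1), Op.D true 1)

theorem stD_JD : stD M (JD M) = -JD M := Prod.ext Op.star_D_neg_one Op.star_D_one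

theorem bilD_JD {x : Dd M} (hx : stD M x = x) : bilD (JD M) (JD M) x = 0 := by
  obtain ⟨x1, x2⟩ := x
  simp only [stD_apply, Prod.mk.injEq] at hx
  have s1 : adj (x1 : PDO M) = x1 := congrArg Subtype.val hx.1
  have s2 : adj (x2 : PDO M) = x2 := congrArg Subtype.val hx.2
  have a1 : Dl 1 (Dl (-1) (x1 : PDO M)) = shift 1 (shift (-1) (x1 : PDO M)) := by
    rw [Dl_Dl, shift_shift]; simp [Dl_zero, shift_zero]
  have a2 : Dl 1 (shift 1 (x2 : PDO M)) = shift 1 (Dl 1 (x2 : PDO M)) := Dl_shift 1 1 _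
  have z1 : Dl (-1) (x1 : PDO M) 0 = 0 := Dl_neg_one_zero_of_symm s1
  have z2 : shift 1 (x2 : PDO M) 0 = 0 := res_eq_zero_of_symm s2
  have n1 := Dl_one_neg a1 z1
  have n2 := Dl_one_neg a2 z2
  have p1 := Dl_one_pos a1 z1
  have p2 := Dl_one_pos a2 z2
  -- multiplied by `D` from both sides, the identities for `D⁻¹` become those for `D`
  have m1 : Dl (-1) (neg (shift (-1) (x1 : PDO M))) = shift (-1) (neg (Dl (-1) (x1 : PDO M))) := by
    have := congrArg (fun y => Dl (-1) (shift (-1) y)) n1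
    simp only [shift_shift] at this
    simpa [Dl_zero, shift_zero, Dl_Dl, Dl_shift] using this.symm
  have m2 : Dl (-1) (neg (Dl 1 (x2 : PDO M))) = shift (-1) (neg (shift 1 (x2 : PDO M))) := by
    have := congrArg (fun y => Dl (-1) (shift (-1) y)) n2
    simp only [shift_shift] at this
    simpa [Dl_zero, shift_zero, Dl_Dl, Dl_shift] using this.symm
  simp only [bilD, JD, Prod.mk_eq_zero]
  have q1 : Op.D false (-1) * nn _ (x1 * Op.D false (-1)) =
      nn _ (Op.D false (-1) * x1) * Op.D false (-1) := Op.ext <| by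
    rw [coe_D_mul, coe_mul_D, coe_nn, coe_nn, coe_D_mul, coe_mul_D, m1]
  have q2 : Op.D false (-1) * nn _ (Op.D true 1 * x2) =
      nn _ (x2 * Op.D true 1) * Op.D false (-1) := Op.ext <| by
    rw [coe_D_mul, coe_mul_D, coe_nn, coe_nn, coe_D_mul, coe_mul_D, m2]
  have q3 : Op.D true 1 * pp _ (Op.D false (-1) * x1) =
      pp _ (x1 * Op.D false (-1)) * Op.D true 1 := Op.ext <| by
    rw [coe_D_mul, coe_mul_D, coe_pp, coe_pp, coe_D_mul, coe_mul_D, p1]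
  have q4 : Op.D true 1 * pp _ (x2 * Op.D true 1) =
      pp _ (Op.D true 1 * x2) * Op.D true 1 := Op.ext <| by
    rw [coe_D_mul, coe_mul_D, coe_pp, coe_pp, coe_D_mul, coe_mul_D, p2]
  rw [mul_sub, mul_sub, sub_mul, sub_mul, q1, q2, q3, q4]
  constructor <;> abel

/-- The first Poisson tensor, on `𝔇`. -/
def tensD (b x : Dd M) : Dd M := bilD b (JD M) x + bilD (JD M) b x

theorem bilD_add_add (b c x : Dd M) :
    bilD (b + c) (b + c) x = bilD b b x + (bilD b c x + bilD c b x) + bilD c c x := by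
  simp only [bilD, Prod.fst_add, Prod.snd_add, mul_add, add_mul, mul_sub, sub_mul, map_add,
    Prod.mk_add_mk, Prod.mk.injEq]
  constructor <;> abel

theorem bilD_sub_sub (b c x : Dd M) :
    bilD (b - c) (b - c) x = bilD b b x - (bilD b c x + bilD c b x) + bilD c c x := by
  simp only [bilD, Prod.fst_sub, Prod.snd_sub, mul_sub, sub_mul, map_sub,
    Prod.mk_add_mk, Prod.mk_sub_mk, Prod.mk.injEq]
  constructor <;> abel

theorem tensor_add_JD {b x : Dd M} (hb : stD M b = -b) (hx : stD M x = x) :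
    (splitD M).tensor (b + JD M) x = (splitD M).tensor b x + tensD b x := by
  rw [tensor_eq_bilD hb hx, tensor_eq_bilD (by rw [map_add, hb, stD_JD, neg_add]) hx,
    bilD_add_add, bilD_JD hx, add_zero, tensD]

theorem tensor_sub_JD {b x : Dd M} (hb : stD M b = -b) (hx : stD M x = x) :
    (splitD M).tensor (b - JD M) x = (splitD M).tensor b x - tensD b x := by
  rw [tensor_eq_bilD hb hx, tensor_eq_bilD (by rw [map_sub, hb, stD_JD, neg_sub]; abel) hx,
    bilD_sub_sub, bilD_JD hx, add_zero, tensD]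

theorem coe_bilD_self (b x : Dd M) :
    (((bilD b b x).1 : PDO M), ((bilD b b x).2 : PDO M)) =
      tensor₂ ((b.1 : PDO M), (b.2 : PDO M)) ((x.1 : PDO M), (x.2 : PDO M)) := by
  have e1 : (bilD b b x).1 = b.1 * nn _ (x.1 * b.1) - nn _ (b.1 * x.1) * b.1 -
      b.1 * nn _ (b.2 * x.2) + nn _ (x.2 * b.2) * b.1 := by
    simp only [bilD]; noncomm_ring
  have e2 : (bilD b b x).2 = b.2 * pp _ (x.2 * b.2) - pp _ (b.2 * x.2) * b.2 -
      b.2 * pp _ (b.1 * x.1) + pp _ (x.1 * b.1) * b.2 := by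
    simp only [bilD]; noncomm_ring
  rw [e1, e2]
  rfl

theorem coe_tensD (b x : Dd M) :
    (((tensD b x).1 : PDO M), ((tensD b x).2 : PDO M)) =
      tensor₁ ((b.1 : PDO M), (b.2 : PDO M)) ((x.1 : PDO M), (x.2 : PDO M)) := by
  have e1 : (tensD b x).1 = b.1 * nn _ (x.1 * Op.D _ (-1)) + Op.D _ (-1) * nn _ (x.1 * b.1)
      - nn _ (Op.D _ (-1) * x.1) * b.1 - nn _ (b.1 * x.1) * Op.D _ (-1)
      - b.1 * nn _ (Op.D _ 1 * x.2) - Op.D _ (-1) * nn _ (b.2 * x.2)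
      + nn _ (x.2 * Op.D _ 1) * b.1 + nn _ (x.2 * b.2) * Op.D _ (-1) := by
    simp only [tensD, bilD, JD, Prod.mk_add_mk]; noncomm_ring
  have e2 : (tensD b x).2 = b.2 * pp _ (x.2 * Op.D _ 1) + Op.D _ 1 * pp _ (x.2 * b.2)
      - pp _ (Op.D _ 1 * x.2) * b.2 - pp _ (b.2 * x.2) * Op.D _ 1
      - b.2 * pp _ (Op.D _ (-1) * x.1) - Op.D _ 1 * pp _ (b.1 * x.1)
      + pp _ (x.1 * Op.D _ (-1)) * b.2 + pp _ (x.1 * b.1) * Op.D _ 1 := by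
    simp only [tensD, bilD, JD, Prod.mk_add_mk]; noncomm_ring
  rw [e1, e2]
  rfl

/-! ### Variational gradients -/

theorem IsGradient.lift {L : PDO M × PDO M} {F : LocalFun M} {X : PDO M × PDO M}
    (h : IsGradient L F X) {a : Dd M} (ha1 : (a.1 : PDO M) = (bfA L).1)
    (ha2 : (a.2 : PDO M) = (bfA L).2) :
    ∃ x : Dd M, (x.1 : PDO M) = X.1 ∧ (x.2 : PDO M) = X.2 ∧ IsGrad a F x := by
  refine ⟨(⟨X.1, inMinus_iff.1 h.mem_minus⟩, ⟨X.2, inPlus_iff.1 h.mem_plus⟩), rfl, rfl,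
    Dd.ext h.adj_fst h.adj_snd, fun Y => ?_⟩
  obtain ⟨f, rfl⟩ := Submodule.Quotient.mk_surjective _ F
  refine (h.variation f rfl Y).trans ?_
  rw [← ha1, ← ha2]
  rfl

theorem IsGrad.isGradient {L : PDO M × PDO M} {F : LocalFun M} {a x : Dd M} (h : IsGrad a F x)
    (ha1 : (a.1 : PDO M) = (bfA L).1) (ha2 : (a.2 : PDO M) = (bfA L).2) :
    IsGradient L F ((x.1 : PDO M), (x.2 : PDO M)) := by
  refine ⟨inMinus_iff.2 x.1.2, inPlus_iff.2 x.2.2, congrArg (fun y : Dd M => (y.1 : PDO M)) h.st,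
    congrArg (fun y : Dd M => (y.2 : PDO M)) h.st, fun f hf Y => ?_⟩
  subst hf
  rw [← ha1, ← ha2]
  exact h.var Y

theorem mem_F0_iff {L : PDO M × PDO M} {a : Dd M} (ha1 : (a.1 : PDO M) = (bfA L).1)
    (ha2 : (a.2 : PDO M) = (bfA L).2) (F : LocalFun M) : F ∈ F0 L ↔ ∃ x, IsGrad a F x := by
  constructor
  · rintro ⟨X, hX⟩
    obtain ⟨x, -, -, hx⟩ := hX.lift ha1 ha2
    exact ⟨x, hx⟩
  · rintro ⟨x, hx⟩
    exact ⟨_, hx.isGradient ha1 ha2⟩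

theorem pair_eq_trD {x y : Dd M} {X Y : PDO M × PDO M} (hx1 : (x.1 : PDO M) = X.1)
    (hx2 : (x.2 : PDO M) = X.2) (hy : ((y.1 : PDO M), (y.2 : PDO M)) = Y) :
    pair X Y = trD M (x * y) := by
  subst hy
  rw [pair, ← hx1, ← hx2]
  rfl

/-! ### Fixed points of contracting maps -/

/-- A map on families of differential polynomials has a fixed point if the terms of rank `k` of its
values only depend on the terms of rank less than `k` of its argument. -/
theorem exists_fixedPoint {ι : Type*} (Φ : (ι → DiffAlg M) → ι → DiffAlg M) (rk : ι → ℕ → ℕ)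
    (h : ∀ a b i d, (∀ j e, rk j e < rk i d → comp e (a j) = comp e (b j)) →
      comp d (Φ a i) = comp d (Φ b i)) : ∃ a, Φ a = a := by
  set x : ℕ → ι → DiffAlg M := fun k => Φ^[k] 0 with hx
  have hs : ∀ k, x (k + 1) = Φ (x k) := fun k => Function.iterate_succ_apply' Φ k 0
  have stab : ∀ N k l, N < k → N < l → ∀ i d, rk i d ≤ N → comp d (x k i) = comp d (x l i) := by
    intro N
    induction N using Nat.strong_induction_on with
    | _ N ih =>
      intro k l hk hl i d hr
      obtain ⟨k, rfl⟩ : ∃ k', k = k' + 1 := ⟨k - 1, by omega⟩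
      obtain ⟨l, rfl⟩ : ∃ l', l = l' + 1 := ⟨l - 1, by omega⟩
      rw [hs, hs]
      refine h _ _ _ _ fun j e hj => ?_
      exact ih (rk j e) (by omega) k l (by omega) (by omega) j e le_rfl
  refine ⟨fun i => ofComp (fun d => comp d (x (rk i d + 1) i)) fun d => comp_hom _ _, ?_⟩
  refine funext fun i => DiffAlg.ext fun d => ?_
  rw [comp_ofComp, hs]
  refine h _ _ _ _ fun j e hj => ?_
  rw [comp_ofComp]
  exact stab _ _ _ (Nat.lt_succ_self _) hj j e le_rfl

/-! ### Operators `T` with `T^* = -DTD⁻¹` -/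

/-- The condition `T^* = -D T D⁻¹`, i.e. the operator `D T` is symmetric. -/
def IsLax (T : PDO M) : Prop := adj (Dl 1 T) = Dl 1 T

theorem isLax_iff' {T : PDO M} : IsLax T ↔ adj T = -shift (-1) (Dl 1 T) := by
  rw [IsLax, adj_Dl_one]
  constructor <;> intro h
  · rw [← h, ← Dl_zero (adj T)]
    refine PDO.ext fun n => ?_
    change _ = - -_
    rw [neg_neg, Dl_zero]
    change _ = adj T (n - -1 - 1)
    congr 1; ring
  · rw [h]
    refine PDO.ext fun n => ?_
    change - -_ = _
    rw [neg_neg]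
    change Dl 1 T (n - 1 - -1) = _
    congr 1; ring

theorem isLax_iff {T : PDO M} : IsLax T ↔ adj T = -(DD * T * DDinv) := by
  rw [isLax_iff', mul_Dpow, Dpow_mul]

theorem IsLax.adj_apply {T : PDO M} (h : IsLax T) (n : ℤ) :
    adj T n = -(T n + der (T (n + 1))) := by
  rw [isLax_iff'.1 h]
  change -(Dl 1 T (n - -1)) = _
  rw [Dl_one_apply, sub_neg_eq_add, add_sub_cancel_right]

theorem IsLax.add {T U : PDO M} (h : IsLax T) (h' : IsLax U) : IsLax (T + U) := by
  rw [IsLax, Dl_add, adj_add, h, h']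

theorem IsLax.neg {T : PDO M} (h : IsLax T) : IsLax (-T) := by
  rw [IsLax, ← neg_one_zsmul, Dl_zsmul, adj_zsmul, h]

theorem IsLax.sub {T U : PDO M} (h : IsLax T) (h' : IsLax U) : IsLax (T - U) := by
  rw [sub_eq_add_neg]
  exact h.add h'.neg

theorem IsLax.apply_zero {T : PDO M} (h : IsLax T) : T 0 = 0 := by
  have := Dl_neg_one_zero_of_symm h
  rwa [Dl_Dl, neg_add_cancel, Dl_zero] at this

/-- Up to terms of lower degree, the adjoint changes the signs of the odd coefficients. -/
theorem comp_adj_of_lower {a : PDO M} {n : ℤ} {d : ℕ}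
    (h : ∀ r : ℕ, 0 < r → r ≤ d → comp (d - r) (a (n + r)) = 0) :
    comp d (adj a n) = ((n.negOnePow : ℤˣ) : ℤ) • comp d (a n) := by
  simp only [adj, comp_ofComp]
  rw [Finset.sum_eq_single_of_mem 0 (by simp)]
  · simp
  · intro r hr h0
    rw [Finset.mem_range] at hr
    rw [comp_der_iterate, h r (by omega) (by omega), jetD_eq, iterate_map_zero, ite_self,
      smul_zero]

/-- An antisymmetric operator is determined by its odd coefficients. -/
theorem antisymm_eq_zero {S : PDO M} (hS : adj S = -S) (hodd : ∀ n, Odd n → S n = 0) : S = 0 := by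
  refine PDO.ext_comp fun n d => ?_
  induction d using Nat.strong_induction_on generalizing n with
  | _ d ih =>
    rcases Int.even_or_odd n with hn | hn
    · have h1 := comp_adj_of_lower (a := S) (n := n) (d := d)
        fun r hr hr' => by rw [ih (d - r) (by omega)]; simp
      rw [hS, Int.negOnePow_even n hn, PDO.neg_apply, comp_neg] at h1
      simp only [Units.val_one, one_smul] at h1
      rw [eq_zero_of_eq_neg h1.symm]
      simp
    · rw [hodd n hn]; simp

/-- An operator `T` with `T^* = -DTD⁻¹` is determined by its odd coefficients. -/
theorem IsLax.vanish {T : PDO M} (hT : IsLax T) (W : ℤ → ℕ → Prop)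
    (hW : ∀ n d, ∀ r : ℕ, r ≤ d → W n d → W (n + r) (d - r))
    (hodd : ∀ n d, Odd n → W n d → comp d (T n) = 0) : ∀ n d, W n d → comp d (T n) = 0 := by
  intro n d hnd
  induction d using Nat.strong_induction_on generalizing n with
  | _ d ih =>
    rcases Int.even_or_odd n with hn | hn
    · have h1 := comp_adj_of_lower (a := T) (n := n) (d := d)
        fun r hr hr' => ih (d - r) (by omega) _ (hW n d r hr' hnd)
      have h2 : comp d (der (T (n + 1))) = 0 := by
        cases d with
        | zero => simp
        | succ d =>
          have := ih d (by omega) (n + 1) (by simpa using hW n (d + 1) 1 (by omega) hnd)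
          rw [comp_der_succ, this, jetD_eq, map_zero]
      rw [hT.adj_apply, Int.negOnePow_even n hn, comp_neg, comp_add, h2, add_zero] at h1
      simp only [Units.val_one, one_smul] at h1
      exact eq_zero_of_eq_neg h1.symm
    · exact hodd n d hn hnd

theorem IsLax.eq_zero {T : PDO M} (hT : IsLax T) (hodd : ∀ n, Odd n → T n = 0) : T = 0 :=
  PDO.ext_comp fun n d => (hT.vanish (fun _ _ => True) (fun _ _ _ _ _ => trivial)
    (fun n d hn _ => by rw [hodd n hn, comp_zero]) n d trivial).trans (comp_zero d).symm

theorem IsLax.ext {T U : PDO M} (hT : IsLax T) (hU : IsLax U) (hodd : ∀ n, Odd n → T n = U n) :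
    T = U :=
  sub_eq_zero.1 ((hT.sub hU).eq_zero fun n hn => by rw [PDO.sub_apply, hodd n hn, sub_self])

/-- The odd coefficients of an operator `T` with `T^* = -DTD⁻¹` can be prescribed. -/
theorem exists_isLax (c : ℤ → DiffAlg M) : ∃ T : PDO M, IsLax T ∧ ∀ n, Odd n → T n = c n := by
  classical
  let E : PDO M → PDO M := fun T => adj T + shift (-1) (Dl 1 T)
  have hEn : ∀ T n, E T n = adj T n + (T n + der (T (n + 1))) := fun T n => by
    change adj T n + Dl 1 T (n - -1) = _
    rw [Dl_one_apply, sub_neg_eq_add, add_sub_cancel_right]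
  let Φ : PDO M → PDO M := fun T n => if Odd n then c n else T n - (1 / 2 : ℂ) • E T n
  have hΦ : ∀ a b : PDO M, ∀ n d, (∀ m, ∀ e < d, comp e (a m) = comp e (b m)) →
      comp d (Φ a n) = comp d (Φ b n) := fun a b n d hab => by
    change comp d (if Odd n then c n else a n - (1 / 2 : ℂ) • E a n) =
      comp d (if Odd n then c n else b n - (1 / 2 : ℂ) • E b n)
    split_ifs with hn
    · rfl
    · rw [← sub_eq_zero, ← comp_sub]
      have e : a n - (1 / 2 : ℂ) • E a n - (b n - (1 / 2 : ℂ) • E b n) =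
          (a - b) n - (1 / 2 : ℂ) • (adj (a - b) n + ((a - b) n + der ((a - b) (n + 1)))) := by
        rw [hEn, hEn, adj_sub, PDO.sub_apply, PDO.sub_apply, PDO.sub_apply, der_sub]
        module
      have hlow : ∀ m, ∀ e < d, comp e ((a - b) m) = 0 := fun m e he => by
        rw [PDO.sub_apply, comp_sub, hab m e he, sub_self]
      have h1 := comp_adj_of_lower (a := a - b) (n := n) (d := d)
        fun r hr hr' => hlow _ _ (by omega)
      rw [Int.negOnePow_even n (Int.not_odd_iff_even.1 hn)] at h1
      simp only [Units.val_one, one_smul] at h1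
      have h2 : comp d (der ((a - b) (n + 1))) = 0 := by
        cases d with
        | zero => simp
        | succ d => rw [comp_der_succ, hlow (n + 1) d (by omega), jetD_eq, map_zero]
      rw [e, comp_sub, comp_smul, comp_add, comp_add, h1, h2]
      module
  obtain ⟨T, hT⟩ : ∃ T : PDO M, Φ T = T :=
    exists_fixedPoint (ι := ℤ) Φ (fun _ d => d) fun a b n d h => hΦ a b n d fun m e he => h m e he
  have hTn : ∀ n, T n = if Odd n then c n else T n - (1 / 2 : ℂ) • E T n := fun n =>
    (congrFun hT n).symm
  have hodd : ∀ n, Odd n → T n = c n := fun n hn => by rw [hTn, if_pos hn]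
  have heven : ∀ n, Even n → E T n = 0 := fun n hn => by
    have := hTn n
    rw [if_neg (Int.not_odd_iff_even.2 hn), eq_comm, sub_eq_self] at this
    exact (smul_eq_zero.1 this).resolve_left (by norm_num)
  refine ⟨T, ?_, hodd⟩
  -- `E(T) D = DT - (DT)^*` is antisymmetric and its odd coefficients vanish
  have key : Dl 1 T - adj (Dl 1 T) = 0 := by
    refine antisymm_eq_zero (by rw [adj_sub, adj_adj, neg_sub]) fun n hn => ?_
    rw [adj_Dl_one, sub_neg_eq_add, PDO.add_apply, Dl_one_apply]
    change _ + adj T (n - 1) = 0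
    have := heven (n - 1) (hn.sub_odd odd_one)
    rw [hEn, sub_add_cancel] at this
    rw [add_comm, this]
  exact (sub_eq_zero.1 key).symm

theorem isLax_D : IsLax (DD : PDO M) := by
  rw [IsLax, Dl_Dpow, adj_Dpow]
  norm_num [Int.negOnePow_even]

theorem isLax_Dinv_mul (f : DiffAlg M) : IsLax (DDinv * PDO.const f : PDO M) := by
  rw [IsLax, Dpow_mul, Dl_Dl, add_neg_cancel, Dl_zero, adj_const]

theorem IsLax.neg_part {T : PDO M} (hT : IsLax T) : IsLax (TwoBKP.neg T) := by
  have h : Dl 1 T = shift 1 (-adj T) := by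
    nth_rw 1 [← hT]
    exact adj_Dl_one T
  have h' := Dl_one_neg h hT.apply_zero
  rw [IsLax, adj_Dl_one, h', neg_neg', neg_adj]
  rfl

theorem IsLax.pos_part {T : PDO M} (hT : IsLax T) : IsLax (pos T) := by
  have := hT.sub hT.neg_part
  rwa [← eq_sub_of_add_eq (pos_add_neg T)] at this

/-- If the coefficients of `T` at the odd negative powers agree with those of `D⁻¹f`, then
`T_- = (D⁻¹f)_-`, and the constant term of `T` vanishes. -/
theorem IsLax.eq_Dinv_mul {T : PDO M} (hT : IsLax T) (f : DiffAlg M)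
    (h : ∀ n, Odd n → n < 0 → T n = (DDinv * PDO.const f : PDO M) n) (n : ℤ) (hn : n ≤ 0) :
    T n = (DDinv * PDO.const f : PDO M) n := by
  have hU := hT.sub (isLax_Dinv_mul f)
  have h0 := hU.neg_part.eq_zero fun m hm => by
    rw [neg_apply]
    split_ifs with hlt
    · rw [PDO.sub_apply, h m hm hlt, sub_self]
    · rfl
  rw [← sub_eq_zero, ← PDO.sub_apply]
  rcases hn.lt_or_eq with hn | rfl
  · have := congrFun h0 n
    rwa [neg_apply, if_pos hn] at this
  · exact hU.apply_zero

/-! ### The Lax pair -/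

theorem IsLaxPair.unique {L L' : PDO M × PDO M} (h : IsLaxPair L) (h' : IsLaxPair L') : L = L' := by
  refine Prod.ext ?_ ?_
  · refine (isLax_iff.2 h.adj_eq).ext (isLax_iff.2 h'.adj_eq) fun n hn => ?_
    rcases le_or_gt 0 n with h0 | h0
    · rw [h.leading n h0, h'.leading n h0]
    · obtain ⟨j, rfl⟩ : ∃ j : ℕ, n = -(2 * j + 1) := by
        obtain ⟨k, rfl⟩ := hn
        exact ⟨(-k - 1).toNat, by omega⟩
      rw [h.odd_coeff, h'.odd_coeff]
  · refine (isLax_iff.2 h.hat_adj_eq).ext (isLax_iff.2 h'.hat_adj_eq) fun n hn => ?_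
    rcases le_or_gt n 0 with h0 | h0
    · rw [h.hat_leading n h0, h'.hat_leading n h0]
    · obtain ⟨j, hj, rfl⟩ : ∃ j : ℕ, 1 ≤ j ∧ n = 2 * j - 1 := by
        obtain ⟨k, rfl⟩ := hn
        exact ⟨(k + 1).toNat, by omega, by omega⟩
      rw [h.hat_odd_coeff j hj, h'.hat_odd_coeff j hj]

theorem exists_isLaxPair (M : Opens (Coord → ℝ)) : ∃ L : PDO M × PDO M, IsLaxPair L := by
  classical
  obtain ⟨P, hP, hPc⟩ := exists_isLax (M := M)
    fun n => if 0 ≤ n then (if n = 1 then 1 else 0) else coord (Sum.inl ((-n - 1) / 2).toNat)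
  obtain ⟨Q, hQ, hQc⟩ := exists_isLax (M := M)
    fun n => if n < 0 then (DDinv * PDO.const (coord rhoLabel) : PDO M) n
      else coord (Sum.inr ((n + 1) / 2).toNat)
  have hQ0 := hQ.eq_Dinv_mul (coord rhoLabel) fun n hn h => by rw [hQc n hn, if_pos h]
  refine ⟨(P, Q), ?_, ?_, isLax_iff.1 hP, ?_, hQ0, ?_, isLax_iff.1 hQ⟩
  · intro i hi
    have h1 : (P - DD : PDO M) i = 0 := DiffAlg.ext fun d => by
      refine Eq.trans ((hP.sub isLax_D).vanish (fun n _ => 0 ≤ n) (fun n _ r _ h => by omega)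
        (fun n d hn h => ?_) i d hi) (comp_zero d).symm
      rw [PDO.sub_apply, hPc n hn, if_pos h, show (DD : PDO M) n = _ from Dpow_apply 1 n, sub_self, comp_zero]
    rw [PDO.sub_apply, show (DD : PDO M) i = _ from Dpow_apply 1 i, sub_eq_zero] at h1
    exact h1
  · intro j
    change P _ = _
    rw [hPc _ ⟨-j - 1, by ring⟩, if_neg (by omega)]
    congr 2
    omega
  · refine ⟨-1, fun i d h => ?_⟩
    change comp d (Q i) = 0
    rw [hQ0 i (by omega), Dpow_mul]
    exact Dl_mem_cone (t := true) (-1) (const_mem_cone true (coord rhoLabel)) i d h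
  · intro j hj
    change Q _ = _
    rw [hQc _ ⟨j - 1, by ring⟩, if_neg (by omega)]
    congr 2
    omega

/-! ### The Lax operators in the rings `𝒟⁻` and `𝒟⁺` -/

theorem IsLax.star_eq {t : Bool} {T : Op M t} (h : IsLax (T : PDO M)) :
    Op.star t T = -(Op.D t 1 * T * Op.D t (-1)) := Op.ext (isLax_iff.1 h)

theorem isLax_of_star_eq {t : Bool} {T : Op M t}
    (h : Op.star t T = -(Op.D t 1 * T * Op.D t (-1))) : IsLax (T : PDO M) :=
  isLax_iff.2 (congrArg Subtype.val h)

theorem Dinv_mul_D_mul {t : Bool} (x : Op M t) : Op.D t (-1) * (Op.D t 1 * x) = x := by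
  rw [← mul_assoc, Op.D_mul_D, neg_add_cancel, Op.D_zero, one_mul]

theorem D_mul_Dinv_mul {t : Bool} (x : Op M t) : Op.D t 1 * (Op.D t (-1) * x) = x := by
  rw [← mul_assoc, Op.D_mul_D, add_neg_cancel, Op.D_zero, one_mul]

theorem D_mul_Dinv {t : Bool} : (Op.D t 1 : Op M t) * Op.D t (-1) = 1 := by
  rw [Op.D_mul_D, add_neg_cancel, Op.D_zero]

theorem Dinv_mul_D {t : Bool} : (Op.D t (-1) : Op M t) * Op.D t 1 = 1 := by
  rw [Op.D_mul_D, neg_add_cancel, Op.D_zero]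

theorem conj_D_pow {t : Bool} (T : Op M t) (k : ℕ) :
    (Op.D t 1 * T * Op.D t (-1)) ^ k = Op.D t 1 * T ^ k * Op.D t (-1) := by
  induction k with
  | zero => rw [pow_zero, pow_zero, mul_one, D_mul_Dinv]
  | succ k ih => rw [pow_succ, ih, pow_succ]; simp only [mul_assoc, Dinv_mul_D_mul]

theorem IsLax.pow {t : Bool} {T : Op M t} (h : IsLax (T : PDO M)) {k : ℕ} (hk : Odd k) :
    IsLax ((T ^ k : Op M t) : PDO M) :=
  isLax_of_star_eq (by rw [Op.star_pow, h.star_eq, hk.neg_pow, conj_D_pow])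

theorem IsLax.star_sq {t : Bool} {T : Op M t} (h : IsLax (T : PDO M)) :
    Op.star t (T ^ 2) = Op.D t 1 * T ^ 2 * Op.D t (-1) := by
  rw [Op.star_pow, h.star_eq, even_two.neg_pow, conj_D_pow]

theorem IsLax.evOp {T : PDO M} (h : IsLax T) (Y : Coord → DiffAlg M) : IsLax (evOp Y T) := by
  rw [IsLax, ← evOp_Dl, ← evOp_adj, h]

theorem IsLaxPair.ordLE {L : PDO M × PDO M} (hL : IsLaxPair L) : OrdLE 1 L.1 := fun i hi => by
  rw [hL.leading i (by omega), if_neg (by omega)]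

theorem IsLaxPair.isLax_fst {L : PDO M × PDO M} (hL : IsLaxPair L) : IsLax L.1 :=
  isLax_iff.2 hL.adj_eq

theorem IsLaxPair.isLax_snd {L : PDO M × PDO M} (hL : IsLaxPair L) : IsLax L.2 :=
  isLax_iff.2 hL.hat_adj_eq

/-- The operator `P` in `𝒟⁻`. -/
def IsLaxPair.P {L : PDO M × PDO M} (hL : IsLaxPair L) : Op M false := ⟨L.1, hL.ordLE.inT⟩

/-- The operator `P̂` in `𝒟⁺`. -/
def IsLaxPair.Ph {L : PDO M × PDO M} (hL : IsLaxPair L) : Op M true := ⟨L.2, hL.hat_mem⟩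

/-- The pair `(A, Â) = (P²D⁻¹, DP̂²)`. -/
def IsLaxPair.A {L : PDO M × PDO M} (hL : IsLaxPair L) : Dd M :=
  (hL.P ^ 2 * Op.D _ (-1), Op.D _ 1 * hL.Ph ^ 2)

theorem IsLaxPair.coe_A_fst {L : PDO M × PDO M} (hL : IsLaxPair L) :
    (hL.A.1 : PDO M) = (bfA L).1 := by
  rw [IsLaxPair.A, Op.coe_mul, Op.coe_pow]
  rfl

theorem IsLaxPair.coe_A_snd {L : PDO M × PDO M} (hL : IsLaxPair L) :
    (hL.A.2 : PDO M) = (bfA L).2 := by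
  rw [IsLaxPair.A, Op.coe_mul, Op.coe_pow]
  rfl

theorem IsLaxPair.star_Ph {L : PDO M × PDO M} (hL : IsLaxPair L) :
    Op.star true hL.Ph = -(Op.D _ 1 * hL.Ph * Op.D _ (-1)) := IsLax.star_eq hL.isLax_snd

theorem IsLaxPair.star_A_fst {L : PDO M × PDO M} (hL : IsLaxPair L) :
    Op.star false hL.A.1 = -hL.A.1 := by
  rw [IsLaxPair.A, Op.star_mul, IsLax.star_sq (T := hL.P) hL.isLax_fst, Op.star_D_neg_one, mul_assoc, neg_mul,
    Dinv_mul_D_mul]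

theorem IsLaxPair.star_A_snd {L : PDO M × PDO M} (hL : IsLaxPair L) :
    Op.star true hL.A.2 = -hL.A.2 := by
  rw [IsLaxPair.A, Op.star_mul, IsLax.star_sq (T := hL.Ph) hL.isLax_snd, Op.star_D_one, mul_neg, mul_assoc,
    Dinv_mul_D, mul_one]

theorem IsLaxPair.stD_A {L : PDO M × PDO M} (hL : IsLaxPair L) : stD M hL.A = -hL.A :=
  Prod.ext hL.star_A_fst hL.star_A_snd

/-! ### Leading coefficients -/

theorem OrdLE.Dl_top {N : ℤ} {b : PDO M} (hb : OrdLE N b) (i : ℤ) : Dl i b (i + N) = b N := by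
  refine DiffAlg.ext fun d => ?_
  rw [comp_Dl _ _ _ (Nat.lt_succ_self d), Finset.sum_eq_single_of_mem 0 (by simp)]
  · simp
  · intro r _ h0
    rw [hb _ (by omega), derIt_zero, smul_zero]

theorem OrdLE.mul_top {N N' : ℤ} {a b : PDO M} (ha : OrdLE N a) (hb : OrdLE N' b) :
    (a * b) (N + N') = a N * b N' := by
  refine DiffAlg.ext fun d => ?_
  rw [comp_PDO_mul, finsum_eq_single _ N, hb.Dl_top]
  intro i hi
  rcases lt_or_gt_of_ne hi with h | h
  · rw [Dl_apply_eq_zero fun r => hb _ (by omega), mul_zero, comp_zero]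
  · rw [ha i h, zero_mul, comp_zero]

theorem OrdLE.isNeg_of_antisymm {S : PDO M} (h : OrdLE 0 S) (hS : TwoBKP.adj S = -S) : IsNeg S := by
  intro i hi
  rcases hi.lt_or_eq with hi | rfl
  · exact h i hi
  · have h0 : TwoBKP.adj S 0 = S 0 := DiffAlg.ext fun d => by
      rw [comp_adj_of_lower fun r hr _ => by rw [h _ (by omega), comp_zero]]
      simp
    rw [hS] at h0
    exact eq_zero_of_eq_neg h0.symm

theorem OrdLE.add {N : ℤ} {a b : PDO M} (ha : OrdLE N a) (hb : OrdLE N b) : OrdLE N (a + b) :=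
  fun i hi => by rw [PDO.add_apply, ha i hi, hb i hi, add_zero]

theorem OrdLE.sub {N : ℤ} {a b : PDO M} (ha : OrdLE N a) (hb : OrdLE N b) : OrdLE N (a - b) :=
  fun i hi => by rw [PDO.sub_apply, ha i hi, hb i hi, sub_zero]

theorem OrdLE.shift {N : ℤ} {a : PDO M} (ha : OrdLE N a) (j : ℤ) : OrdLE (N + j) (shift j a) :=
  fun i hi => ha _ (by omega)

/-- The leading coefficient in the weight `n + 2d` of the product with a differential operator. -/
theorem comp_mul_of_weight {w T : PDO M} (hw : IsPos w) {N : ℤ}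
    (hT : ∀ (m : ℤ) (e : ℕ), m + 2 * e < N → comp e (T m) = 0) {n : ℤ} {d : ℕ}
    (hn : n + 2 * d ≤ N) : comp d ((w * T) n) = comp d (w 0 * T n) := by
  rw [comp_PDO_mul, finsum_eq_single _ 0, Dl_zero]
  intro i hi
  rcases lt_or_gt_of_ne hi with h | h
  · rw [hw i h, zero_mul, comp_zero]
  · rw [comp_mul_congr (g' := 0) _ fun e he => ?_, mul_zero, comp_zero]
    rw [comp_zero]
    refine comp_Dl_eq_zero fun r hr => hT _ _ ?_
    push_cast [hr]
    omega

/-! ### Negative parts modulo differential operators -/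

/-- The operator `f D⁻¹ g`. -/
def fDg (f g : DiffAlg M) : Op M true := Op.const _ f * Op.D _ (-1) * Op.const _ g

theorem star_fDg (f g : DiffAlg M) : Op.star true (fDg f g) = -fDg g f := by
  rw [fDg, Op.star_mul, Op.star_mul, Op.star_const, Op.star_const, Op.star_D_neg_one, fDg]
  noncomm_ring

theorem fDg_res (f g : DiffAlg M) : (fDg f g : PDO M) (-1) = f * g := by
  have : (fDg f g : PDO M) = f • Dl (-1) (PDO.const g) := by
    rw [fDg, mul_assoc, Op.coe_mul, Op.coe_const, const_mul, coe_D_mul, Op.coe_const]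
  have h0 : OrdLE 0 (PDO.const g) := fun i hi => by rw [const_apply, if_neg (by omega)]
  have h1 := h0.Dl_top (-1)
  rw [add_zero, const_apply, if_pos rfl] at h1
  rw [this, PDO.fsmul_apply, h1]

theorem isPos_const (f : DiffAlg M) : IsPos (PDO.const f) := fun i hi => by
  rw [const_apply, if_neg (by omega)]

theorem isPos_D_one (t : Bool) : IsPos ((Op.D t 1 : Op M t) : PDO M) := fun i hi => by
  rw [Op.coe_D, Dpow_apply, if_neg (by omega)]

theorem exists_eq_add_neg {t : Bool} {x y : Op M t} (h : neg (x : PDO M) = neg (y : PDO M)) :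
    ∃ p : Op M t, IsPos (p : PDO M) ∧ x = y + p := by
  refine ⟨x - y, fun i hi => ?_, by abel⟩
  have := congrFun h i
  rw [neg_apply, neg_apply, if_pos hi, if_pos hi] at this
  rw [Op.coe_sub, PDO.sub_apply, this, sub_self]

theorem neg_add_pos {t : Bool} (y : Op M t) {p : Op M t} (hp : IsPos (p : PDO M)) :
    neg ((y + p : Op M t) : PDO M) = neg (y : PDO M) := by
  rw [Op.coe_add, neg_add', hp.neg_eq, add_zero]

/-- A differential operator is its constant term plus a right multiple of `D`. -/
theorem exists_eq_const_add_mul_D {w : Op M true} (hw : IsPos (w : PDO M)) :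
    ∃ v : Op M true, IsPos (v : PDO M) ∧ w = Op.const _ ((w : PDO M) 0) + v * Op.D _ 1 := by
  refine ⟨(w - Op.const _ ((w : PDO M) 0)) * Op.D _ (-1), fun i hi => ?_, ?_⟩
  · rw [coe_mul_D]
    change ((w : PDO M) - PDO.const _ : PDO M) (i - -1) = 0
    rw [PDO.sub_apply, const_apply]
    split_ifs with h
    · rw [h, sub_self]
    · rw [hw _ (by omega), sub_zero]
  · rw [mul_assoc, Dinv_mul_D, mul_one]
    abel

/-- The negative part of `D⁻¹g` for a differential operator `g`. -/
theorem neg_Dinv_mul {g : Op M true} (hg : IsPos (g : PDO M)) :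
    neg ((Op.D _ (-1) * g : Op M true) : PDO M) =
      neg ((Op.D _ (-1) * Op.const _ (adj (g : PDO M) 0) : Op M true) : PDO M) := by
  obtain ⟨v, hv, e⟩ := exists_eq_const_add_mul_D (w := Op.star true g) hg.adj
  have e' : g = Op.const _ (adj (g : PDO M) 0) - Op.D _ 1 * Op.star true v := by
    have := congrArg (Op.star true) e
    rw [Op.star_star, map_add, Op.star_mul, Op.star_const, Op.star_D_one, neg_mul,
      ← sub_eq_add_neg] at this
    exact this
  nth_rw 1 [e']
  rw [mul_sub, Dinv_mul_D_mul, sub_eq_add_neg, neg_add_pos]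
  exact hv.adj.neg

theorem neg_const_mul {t : Bool} (f : DiffAlg M) {x y : Op M t}
    (h : neg (x : PDO M) = neg (y : PDO M)) :
    neg ((Op.const t f * x : Op M t) : PDO M) = neg ((Op.const t f * y : Op M t) : PDO M) := by
  obtain ⟨p, hp, rfl⟩ := exists_eq_add_neg h
  rw [mul_add, neg_add_pos]
  exact (isPos_const f).mul hp

/-- `(w D⁻¹ g)_- = (w_0 D⁻¹ (g^*)_0)_-` for differential operators `w`, `g`. -/
theorem neg_mul_Dinv_mul {w g : Op M true} (hw : IsPos (w : PDO M)) (hg : IsPos (g : PDO M)) :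
    neg ((w * (Op.D _ (-1) * g) : Op M true) : PDO M) =
      neg (fDg ((w : PDO M) 0) (adj (g : PDO M) 0) : PDO M) := by
  obtain ⟨v, hv, e⟩ := exists_eq_const_add_mul_D hw
  nth_rw 1 [e]
  rw [add_mul, mul_assoc v, D_mul_Dinv_mul, neg_add_pos _ (hv.mul hg), fDg, mul_assoc]
  exact neg_const_mul _ (neg_Dinv_mul hg)

/-! ### Variations of the Lax operators -/

/-- The function `û_{-1}` is invertible. -/
theorem exists_rho_inv (hM : ∀ x ∈ M, x rhoLabel ≠ 0) :
    ∃ r : DiffAlg M, coord rhoLabel * r = 1 := by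
  let f : Smooth M := ⟨fun x => (x.1 rhoLabel : ℂ)⁻¹, {rhoLabel},
    fun y => ((y ⟨rhoLabel, Finset.mem_singleton_self _⟩ : ℝ) : ℂ)⁻¹, fun x =>
      ⟨ContDiffAt.inv (Complex.ofRealCLM.contDiff.comp (contDiff_apply ℝ ℝ _)).contDiffAt
        (Complex.ofReal_ne_zero.2 (hM x.1 x.2)), rfl⟩⟩
  have hf : coordFun M rhoLabel * f = 1 :=
    Subtype.ext (funext fun x => mul_inv_cancel₀ (Complex.ofReal_ne_zero.2 (hM x.1 x.2)))
  refine ⟨ofComp (fun d => if d = 0 then MvPolynomial.C f else 0) fun d => ?_,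
    DiffAlg.ext fun d => ?_⟩
  · split_ifs with h
    · subst h
      exact MvPolynomial.isWeightedHomogeneous_C _ _
    · exact MvPolynomial.isWeightedHomogeneous_zero _ _ _
  · rw [comp_mul, comp_one]
    simp only [coord, comp_ofComp]
    split_ifs with h
    · subst h
      simp [← map_mul, hf]
    · refine Finset.sum_eq_zero fun p hp => ?_
      rw [Finset.HasAntidiagonal.mem_antidiagonal] at hp
      by_cases h1 : p.1 = 0
      · rw [if_neg (by omega : ¬ p.2 = 0), mul_zero]
      · rw [if_neg h1, zero_mul]

theorem evDd_sub_left (Y Z : Coord → DiffAlg M) (x : Dd M) :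
    evDd (Y - Z) x = evDd Y x - evDd Z x :=
  Dd.ext (PDO.ext fun _ => ev_sub_left Y Z _) (PDO.ext fun _ => ev_sub_left Y Z _)

section

variable {L : PDO M × PDO M}

theorem IsLaxPair.evOp_fst_isNeg (hL : IsLaxPair L) (Y : Coord → DiffAlg M) :
    IsNeg (evOp Y L.1) := fun i hi => by
  rw [evOp_apply, hL.leading i hi]
  split_ifs
  · exact ev_one Y
  · exact ev_zero Y

theorem IsLaxPair.evOp_fst_odd (hL : IsLaxPair L) (Y : Coord → DiffAlg M) (j : ℕ) :
    evOp Y L.1 (-(2 * j + 1)) = Y (Sum.inl j) := by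
  rw [evOp_apply, hL.odd_coeff, ev_coord]

theorem IsLaxPair.evOp_snd_of_nonpos (hL : IsLaxPair L) (Y : Coord → DiffAlg M) {i : ℤ}
    (hi : i ≤ 0) : evOp Y L.2 i = Dl (-1) (PDO.const (Y rhoLabel)) i := by
  rw [evOp_apply, hL.hat_leading i hi, Dpow_mul, ← evOp_apply, evOp_Dl, evOp_const, ev_coord]

theorem Dl_neg_one_const_res (f : DiffAlg M) : Dl (-1) (PDO.const f) (-1) = f := by
  have h0 : OrdLE 0 (PDO.const f) := fun i hi => by rw [const_apply, if_neg (by omega)]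
  have h1 := h0.Dl_top (-1)
  rwa [add_zero, const_apply, if_pos rfl] at h1

theorem IsLaxPair.evOp_snd_odd (hL : IsLaxPair L) (Y : Coord → DiffAlg M) (j : ℕ) :
    evOp Y L.2 (2 * j - 1) = Y (Sum.inr j) := by
  rcases Nat.eq_zero_or_pos j with rfl | hj
  · rw [Nat.cast_zero, mul_zero, zero_sub, hL.evOp_snd_of_nonpos Y (by omega),
      Dl_neg_one_const_res]
  · rw [evOp_apply, hL.hat_odd_coeff j hj, ev_coord]

/-- The differential operator `D P̂`. -/
def IsLaxPair.W (hL : IsLaxPair L) : Op M true := Op.D _ 1 * hL.Ph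

theorem IsLaxPair.W_of_nonpos (hL : IsLaxPair L) {n : ℤ} (hn : n ≤ 0) :
    (hL.W : PDO M) n = PDO.const (coord rhoLabel) n := by
  have h : (hL.W : PDO M) n = L.2 (n - 1) + der (L.2 n) := by
    rw [IsLaxPair.W, coe_D_mul, Dl_one_apply]
    rfl
  rw [h, hL.hat_leading n hn, hL.hat_leading (n - 1) (by omega), ← Dl_one_apply, Dpow_mul, Dl_Dl,
    add_neg_cancel, Dl_zero]

theorem IsLaxPair.isPos_W (hL : IsLaxPair L) : IsPos (hL.W : PDO M) := fun i hi => by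
  rw [hL.W_of_nonpos hi.le, const_apply, if_neg hi.ne]

theorem IsLaxPair.W_zero (hL : IsLaxPair L) : (hL.W : PDO M) 0 = coord rhoLabel := by
  rw [hL.W_of_nonpos le_rfl, const_apply, if_pos rfl]

theorem IsLaxPair.neg_A_snd (hL : IsLaxPair L) : neg (hL.A.2 : PDO M) =
    neg ((fDg (coord rhoLabel) (coord rhoLabel) : Op M true) : PDO M) := by
  obtain ⟨p, hp, e⟩ := exists_eq_add_neg (x := hL.Ph)
    (y := Op.D _ (-1) * Op.const _ (coord rhoLabel)) (PDO.ext fun i => by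
      rw [neg_apply, neg_apply]
      split_ifs with hi
      · exact hL.hat_leading i hi.le
      · rfl)
  have h1 : hL.A.2 = hL.W * (Op.D _ (-1) * Op.const _ (coord rhoLabel)) + hL.W * p := by
    have h : hL.A.2 = Op.D _ 1 * hL.Ph ^ 2 := rfl
    rw [← mul_add, ← e, IsLaxPair.W, h, pow_two, mul_assoc]
  rw [h1, neg_add_pos _ (hL.isPos_W.mul hp), neg_mul_Dinv_mul hL.isPos_W (isPos_const _),
    Op.coe_const, adj_const, const_apply, if_pos rfl, hL.W_zero]

theorem IsLaxPair.evDd_A_fst (hL : IsLaxPair L) (Y : Coord → DiffAlg M) :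
    (evDd Y hL.A).1 =
      (hL.P * Op.ev Y _ hL.P + Op.ev Y _ hL.P * hL.P) * Op.D _ (-1) := by
  rw [evDd_apply, IsLaxPair.A, Op.ev_mul, Op.ev_D, mul_zero, zero_add, pow_two, Op.ev_mul]

theorem IsLaxPair.evDd_A_snd (hL : IsLaxPair L) (Y : Coord → DiffAlg M) :
    (evDd Y hL.A).2 = hL.W * Op.ev Y _ hL.Ph - Op.star _ (hL.W * Op.ev Y _ hL.Ph) := by
  have hq : Op.star true (Op.ev Y _ hL.Ph) = -(Op.D _ 1 * Op.ev Y _ hL.Ph * Op.D _ (-1)) :=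
    IsLax.star_eq (hL.isLax_snd.evOp Y)
  have h : (evDd Y hL.A).2 = Op.ev Y _ (Op.D _ 1 * hL.Ph ^ 2) := rfl
  rw [h, Op.star_mul, hq, IsLaxPair.W, Op.star_mul, hL.star_Ph, Op.star_D_one, Op.ev_mul, Op.ev_D,
    zero_mul, add_zero, pow_two, Op.ev_mul]
  simp only [neg_mul, mul_neg, neg_neg, mul_assoc, Dinv_mul_D_mul, Dinv_mul_D, mul_one,
    mul_add, sub_neg_eq_add]

theorem IsLaxPair.stD_evDd_A (hL : IsLaxPair L) (Y : Coord → DiffAlg M) :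
    stD M (evDd Y hL.A) = -evDd Y hL.A := by
  rw [← evDd_st, hL.stD_A, map_neg]

theorem IsLaxPair.isNeg_evDd_A (hL : IsLaxPair L) (Y : Coord → DiffAlg M) :
    IsNeg ((evDd Y hL.A).1 : PDO M) := by
  have hq : OrdLE (-1) (evOp Y L.1) := isNeg_iff.1 (hL.evOp_fst_isNeg Y)
  rw [hL.evDd_A_fst, coe_mul_D, isNeg_iff]
  exact (((hL.ordLE.mul hq).add (hq.mul hL.ordLE)).shift (-1)).mono (by norm_num)

/-- The negative part of a variation of `Â = D P̂²` sees only the variation of `ρ`: this is the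
constraint on the tangent vectors of the manifold of the operators `(A, Â)`. -/
theorem IsLaxPair.neg_evDd_A (hL : IsLaxPair L) (Y : Coord → DiffAlg M) :
    neg ((evDd Y hL.A).2 : PDO M) =
      neg ((fDg (coord rhoLabel) (Y rhoLabel) + fDg (Y rhoLabel) (coord rhoLabel) : Op M true) :
        PDO M) := by
  obtain ⟨p, hp, e⟩ := exists_eq_add_neg (x := Op.ev Y _ hL.Ph)
    (y := Op.D _ (-1) * Op.const _ (Y rhoLabel)) (PDO.ext fun i => by
      rw [neg_apply, neg_apply, coe_D_mul]
      split_ifs with hi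
      · exact hL.evOp_snd_of_nonpos Y hi.le
      · rfl)
  have h1 : neg ((hL.W * Op.ev Y _ hL.Ph : Op M true) : PDO M) =
      neg (fDg (coord rhoLabel) (Y rhoLabel) : PDO M) := by
    rw [e, mul_add, neg_add_pos _ (hL.isPos_W.mul hp), neg_mul_Dinv_mul hL.isPos_W (isPos_const _),
      Op.coe_const, adj_const, const_apply, if_pos rfl, hL.W_zero]
  have h2 : adj (fDg (coord rhoLabel) (Y rhoLabel) : PDO M) =
      -(fDg (Y rhoLabel) (coord rhoLabel) : PDO M) :=
    congrArg Subtype.val (star_fDg (coord rhoLabel) (Y rhoLabel))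
  rw [hL.evDd_A_snd, Op.coe_sub, neg_sub', Op.coe_star, neg_adj, h1, ← neg_adj, h2, neg_neg',
    sub_neg_eq_add, Op.coe_add, neg_add']

/-- The leading part of the variation of `A`. -/
theorem IsLaxPair.evDd_A_fst_leading (hL : IsLaxPair L) {Z : Coord → DiffAlg M} {j : ℕ}
    (hZ : ∀ i < j, Z (Sum.inl i) = 0) :
    ((evDd Z hL.A).1 : PDO M) (-(2 * j + 1)) = (2 : ℂ) • Z (Sum.inl j) := by
  have hq : OrdLE (-(2 * j + 1)) (evOp Z L.1) := fun i hi => DiffAlg.ext fun d => by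
    rw [comp_zero]
    refine (hL.isLax_fst.evOp Z).vanish (fun n _ => -(2 * j + 1) < n) (fun _ _ _ _ h => by omega)
      (fun n d hn h => ?_) i d hi
    rcases le_or_gt 0 n with h0 | h0
    · rw [hL.evOp_fst_isNeg Z n h0, comp_zero]
    · obtain ⟨i, rfl⟩ : ∃ i : ℕ, n = -(2 * i + 1) := by
        obtain ⟨k, rfl⟩ := hn
        exact ⟨(-k - 1).toNat, by omega⟩
      rw [hL.evOp_fst_odd, hZ i (by omega), comp_zero]
  have h1 := hL.ordLE.mul_top hq
  have h2 := hq.mul_top hL.ordLE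
  rw [hL.leading 1 (by omega), if_pos rfl, hL.evOp_fst_odd] at h1 h2
  rw [one_mul, add_comm] at h1
  rw [mul_one] at h2
  rw [hL.evDd_A_fst, coe_mul_D, Op.coe_add]
  change (L.1 * evOp Z L.1 + evOp Z L.1 * L.1 : PDO M) (-(2 * j + 1) - -1) = _
  rw [sub_neg_eq_add, PDO.add_apply, h1, h2, two_smul]

/-- The leading part of the variation of `Â` in the weight `n + 2d`. -/
theorem IsLaxPair.comp_evDd_A_snd_leading (hL : IsLaxPair L) {Z : Coord → DiffAlg M} {i d : ℕ}
    (hZ : ∀ j e, j + e < i + d → comp e (Z (Sum.inr j)) = 0) {e : ℕ} (he : e ≤ d) :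
    comp e (((evDd Z hL.A).2 : PDO M) (2 * i - 1)) =
      (2 : ℂ) • comp e (coord rhoLabel * Z (Sum.inr i)) := by
  have hq : ∀ (m : ℤ) (e : ℕ), m + 2 * e < 2 * i - 1 + 2 * d → comp e (evOp Z L.2 m) = 0 := by
    refine (hL.isLax_snd.evOp Z).vanish (fun m e => m + 2 * e < 2 * i - 1 + 2 * d)
      (fun n d r hr h => by push_cast [hr]; omega) fun n e hn h => ?_
    rcases le_or_gt n (-1) with h0 | h0
    · rw [hL.evOp_snd_of_nonpos Z (by omega)]
      refine comp_Dl_eq_zero fun r hr => ?_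
      rw [const_apply]
      split_ifs with h1
      · exact hZ 0 (e - r) (by omega)
      · rw [comp_zero]
    · obtain ⟨j, rfl⟩ : ∃ j : ℕ, n = 2 * j - 1 := by
        obtain ⟨k, rfl⟩ := hn
        exact ⟨(k + 1).toNat, by omega⟩
      rw [hL.evOp_snd_odd]
      exact hZ j e (by omega)
  have hU : ∀ (m : ℤ) (e : ℕ), m + 2 * e ≤ 2 * i - 1 + 2 * d →
      comp e (((hL.W * Op.ev Z _ hL.Ph : Op M true) : PDO M) m) =
        comp e (coord rhoLabel * evOp Z L.2 m) := fun m e h => by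
    rw [← hL.W_zero]
    exact comp_mul_of_weight hL.isPos_W hq h
  have hs := comp_adj_of_lower (a := ((hL.W * Op.ev Z _ hL.Ph : Op M true) : PDO M))
    (n := 2 * i - 1) (d := e) fun r hr hr' => by
      rw [hU _ _ (by push_cast [hr']; omega), comp_mul_congr (g' := 0) _ fun e' he' => ?_, mul_zero,
        comp_zero]
      rw [comp_zero]
      exact hq _ _ (by omega)
  rw [Int.negOnePow_odd _ ⟨i - 1, by ring⟩, hU _ _ (by omega), hL.evOp_snd_odd] at hs
  rw [hL.evDd_A_snd, Op.coe_sub, PDO.sub_apply, comp_sub, hU _ _ (by omega), Op.coe_star, hs,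
    hL.evOp_snd_odd]
  simp only [Units.val_neg, Units.val_one, neg_smul, one_smul]
  rw [two_smul, sub_neg_eq_add]

/-- The tangent space at `(A, Â)`. -/
theorem IsLaxPair.exists_evDd_A_eq (hL : IsLaxPair L) (hM : ∀ x ∈ M, x rhoLabel ≠ 0) {B : Dd M}
    (hB : stD M B = -B) (hB1 : IsNeg (B.1 : PDO M)) (σ : DiffAlg M)
    (hB2 : neg (B.2 : PDO M) = neg ((fDg (coord rhoLabel) σ + fDg σ (coord rhoLabel) : Op M true) :
      PDO M)) : ∃ Y, evDd Y hL.A = B := by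
  obtain ⟨r, hr⟩ := exists_rho_inv hM
  let Φ : (Coord → DiffAlg M) → Coord → DiffAlg M := fun Y => Sum.elim
    (fun j => Y (Sum.inl j) + (1 / 2 : ℂ) •
      ((B.1 : PDO M) (-(2 * j + 1)) - ((evDd Y hL.A).1 : PDO M) (-(2 * j + 1))))
    (fun i => Y (Sum.inr i) + (1 / 2 : ℂ) •
      (r * ((B.2 : PDO M) (2 * i - 1) - ((evDd Y hL.A).2 : PDO M) (2 * i - 1))))
  obtain ⟨Y, hY⟩ := exists_fixedPoint Φ
    (fun c d => Sum.elim (fun j => j) (fun i => i + d) c) fun Y Y' c d h => by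
      rw [← sub_eq_zero, ← comp_sub]
      rcases c with j | i
      · have hZ : ∀ i < j, (Y - Y') (Sum.inl i) = 0 := fun i hi => DiffAlg.ext fun e => by
          rw [Pi.sub_apply, comp_sub, h (Sum.inl i) e hi, sub_self, comp_zero]
        have := hL.evDd_A_fst_leading hZ
        rw [evDd_sub_left, Prod.fst_sub, Op.coe_sub, PDO.sub_apply, Pi.sub_apply] at this
        have e : Φ Y (Sum.inl j) - Φ Y' (Sum.inl j) = (Y (Sum.inl j) - Y' (Sum.inl j)) -
            (1 / 2 : ℂ) • (((evDd Y hL.A).1 : PDO M) (-(2 * j + 1)) -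
              ((evDd Y' hL.A).1 : PDO M) (-(2 * j + 1))) := by
          simp only [Φ, Sum.elim_inl]
          module
        rw [e, this, smul_smul]
        norm_num
      · have hZ : ∀ j e, j + e < i + d → comp e ((Y - Y') (Sum.inr j)) = 0 := fun j e he => by
          rw [Pi.sub_apply, comp_sub, h (Sum.inr j) e he, sub_self]
        have h2 : comp d (r * (((evDd Y hL.A).2 : PDO M) (2 * i - 1) -
            ((evDd Y' hL.A).2 : PDO M) (2 * i - 1))) =
              comp d (r * ((2 : ℂ) • (coord rhoLabel * (Y (Sum.inr i) - Y' (Sum.inr i))))) := by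
          refine comp_mul_congr _ fun e he => ?_
          have := hL.comp_evDd_A_snd_leading hZ he
          rw [evDd_sub_left, Prod.snd_sub, Op.coe_sub, PDO.sub_apply, Pi.sub_apply] at this
          rw [this, comp_smul]
        rw [mul_smul_comm, ← mul_assoc, mul_comm r (coord rhoLabel), hr, one_mul] at h2
        have e : Φ Y (Sum.inr i) - Φ Y' (Sum.inr i) = (Y (Sum.inr i) - Y' (Sum.inr i)) -
            (1 / 2 : ℂ) • (r * (((evDd Y hL.A).2 : PDO M) (2 * i - 1) -
              ((evDd Y' hL.A).2 : PDO M) (2 * i - 1))) := by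
          simp only [Φ, Sum.elim_inr, mul_sub]
          module
        rw [e, comp_sub, comp_smul, h2, comp_smul, smul_smul]
        norm_num
  refine ⟨Y, sub_eq_zero.1 ?_⟩
  have h1 : ∀ j : ℕ, ((evDd Y hL.A).1 : PDO M) (-(2 * j + 1)) = (B.1 : PDO M) (-(2 * j + 1)) :=
    fun j => by
      have := congrFun hY (Sum.inl j)
      simp only [Φ, Sum.elim_inl, add_eq_left] at this
      exact (sub_eq_zero.1 ((smul_eq_zero.1 this).resolve_left (by norm_num))).symm
  have h2 : ∀ i : ℕ, ((evDd Y hL.A).2 : PDO M) (2 * i - 1) = (B.2 : PDO M) (2 * i - 1) :=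
    fun i => by
      have := congrFun hY (Sum.inr i)
      simp only [Φ, Sum.elim_inr, add_eq_left] at this
      have := congrArg (fun x => coord rhoLabel * x)
        ((smul_eq_zero.1 this).resolve_left (by norm_num))
      simp only [← mul_assoc, hr, one_mul, mul_zero] at this
      exact (sub_eq_zero.1 this).symm
  have hst : stD M (evDd Y hL.A - B) = -(evDd Y hL.A - B) := by
    rw [map_sub, hL.stD_evDd_A, hB]
    abel
  have hneg : neg ((evDd Y hL.A).2 : PDO M) = neg (B.2 : PDO M) := by
    have e := h2 0
    have f1 := congrFun (hL.neg_evDd_A Y) (-1)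
    have f2 := congrFun hB2 (-1)
    simp only [neg_apply, if_pos (show (-1 : ℤ) < 0 by norm_num), Op.coe_add, PDO.add_apply,
      fDg_res] at f1 f2
    rw [Nat.cast_zero, mul_zero, zero_sub, f1, f2, mul_comm _ (coord rhoLabel),
      mul_comm σ, ← two_smul ℂ, ← two_smul ℂ] at e
    have e' := congrArg (fun x => r * ((1 / 2 : ℂ) • x)) e
    simp only [smul_smul] at e'
    norm_num at e'
    rw [← mul_assoc, ← mul_assoc, mul_comm r (coord rhoLabel), hr, one_mul, one_mul] at e'
    rw [hL.neg_evDd_A, hB2, e']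
  refine Dd.ext ?_ ?_
  · refine antisymm_eq_zero (congrArg (fun x : Dd M => (x.1 : PDO M)) hst) fun n hn => ?_
    change ((evDd Y hL.A).1 : PDO M) n - (B.1 : PDO M) n = 0
    rcases le_or_gt 0 n with h0 | h0
    · rw [hL.isNeg_evDd_A Y n h0, hB1 n h0, sub_self]
    · obtain ⟨j, rfl⟩ : ∃ j : ℕ, n = -(2 * j + 1) := by
        obtain ⟨k, rfl⟩ := hn
        exact ⟨(-k - 1).toNat, by omega⟩
      rw [h1, sub_self]
  · refine antisymm_eq_zero (congrArg (fun x : Dd M => (x.2 : PDO M)) hst) fun n hn => ?_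
    change ((evDd Y hL.A).2 : PDO M) n - (B.2 : PDO M) n = 0
    rcases lt_or_ge n 0 with h0 | h0
    · have := congrFun hneg n
      rw [neg_apply, neg_apply, if_pos h0, if_pos h0] at this
      rw [this, sub_self]
    · obtain ⟨i, rfl⟩ : ∃ i : ℕ, n = 2 * i - 1 := by
        obtain ⟨k, rfl⟩ := hn
        exact ⟨(k + 1).toNat, by omega⟩
      rw [h2, sub_self]

/-- The quadratic tensor at a translate of `(A, Â)` by constants is tangent. -/
theorem IsLaxPair.isAdmissible (hL : IsLaxPair L) (hM : ∀ x ∈ M, x rhoLabel ≠ 0) {b : Dd M}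
    (hst : stD M b = -b) (hev : ∀ Y, evDd Y b = evDd Y hL.A) (h1 : OrdLE 1 (b.1 : PDO M))
    (h2 : neg (b.2 : PDO M) = neg ((fDg (coord rhoLabel) (coord rhoLabel) : Op M true) : PDO M)) :
    IsAdmissible hL.A b := by
  refine ⟨hst, hev, fun x _ => ?_⟩
  have hT := (splitD M).st_act hst ((splitD M).π (x * b))
  have hW1 : IsNeg ((prD M (x * b)).1 : PDO M) := isNeg_prD _
  have hW2 : IsPos ((prD M (x * b)).2 : PDO M) := isPos_prD _
  set w := prD M (x * b) with hw
  have hO : OrdLE 0 (((splitD M).tensor b x).1 : PDO M) := by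
    have := (h1.mul (isNeg_iff.1 hW1)).add ((isNeg_iff.1 hW1.adj).mul h1)
    exact this.mono (by norm_num)
  have hs2 : Op.star true b.2 = -b.2 := congrArg Prod.snd hst
  obtain ⟨p, hp, e⟩ := exists_eq_add_neg h2
  have hn : neg ((b.2 * w.2 : Op M true) : PDO M) =
      neg (fDg (coord rhoLabel) (adj ((Op.const _ (coord rhoLabel) * w.2 : Op M true) : PDO M) 0) :
        PDO M) := by
    have := neg_mul_Dinv_mul (w := Op.const _ (coord rhoLabel))
      (g := Op.const _ (coord rhoLabel) * w.2) (isPos_const _) ((isPos_const _).mul hW2)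
    rw [Op.coe_const, const_apply, if_pos rfl] at this
    rw [e, add_mul, neg_add_pos _ (hp.mul hW2), ← this, fDg]
    simp only [mul_assoc]
  generalize adj ((Op.const _ (coord rhoLabel) * w.2 : Op M true) : PDO M) 0 = σ at hn
  refine hL.exists_evDd_A_eq hM hT
    (hO.isNeg_of_antisymm (congrArg (fun x : Dd M => (x.1 : PDO M)) hT)) σ ?_
  have e2 : ((splitD M).tensor b x).2 = b.2 * w.2 - Op.star _ (b.2 * w.2) := by
    rw [Op.star_mul, hs2, mul_neg, sub_neg_eq_add]
    rfl
  have h3 : adj (fDg (coord rhoLabel) σ : PDO M) = -(fDg σ (coord rhoLabel) : PDO M) :=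
    congrArg Subtype.val (star_fDg (coord rhoLabel) σ)
  rw [e2, Op.coe_sub, neg_sub', Op.coe_star, neg_adj, hn, ← neg_adj, h3, neg_neg',
    sub_neg_eq_add, Op.coe_add, neg_add']

theorem IsLaxPair.ordLE_A (hL : IsLaxPair L) : OrdLE 1 (hL.A.1 : PDO M) := by
  rw [IsLaxPair.A, coe_mul_D, pow_two]
  exact ((hL.ordLE.mul hL.ordLE).shift (-1)).mono (by norm_num)

theorem IsLaxPair.isAdmissible_A (hL : IsLaxPair L) (hM : ∀ x ∈ M, x rhoLabel ≠ 0) :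
    IsAdmissible hL.A hL.A :=
  hL.isAdmissible hM hL.stD_A (fun _ => rfl) hL.ordLE_A hL.neg_A_snd

theorem ordLE_Dpow (j : ℤ) : OrdLE j (Dpow j : PDO M) := fun i hi => by
  rw [Dpow_apply, if_neg (by omega)]

theorem evDd_JD (Y : Coord → DiffAlg M) : evDd Y (JD M) = 0 :=
  Prod.ext (Op.ev_D Y _ _) (Op.ev_D Y _ _)

theorem IsLaxPair.isAdmissible_add (hL : IsLaxPair L) (hM : ∀ x ∈ M, x rhoLabel ≠ 0) :
    IsAdmissible hL.A (hL.A + JD M) := by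
  refine hL.isAdmissible hM ?_ (fun Y => ?_) ?_ ?_
  · rw [map_add, hL.stD_A, stD_JD, neg_add]
  · rw [map_add, evDd_JD, add_zero]
  · exact hL.ordLE_A.add ((ordLE_Dpow (-1)).mono (by norm_num))
  · exact (neg_add_pos _ (isPos_D_one true)).trans hL.neg_A_snd

theorem IsLaxPair.isAdmissible_sub (hL : IsLaxPair L) (hM : ∀ x ∈ M, x rhoLabel ≠ 0) :
    IsAdmissible hL.A (hL.A - JD M) := by
  refine hL.isAdmissible hM ?_ (fun Y => ?_) ?_ ?_
  · rw [map_sub, hL.stD_A, stD_JD]; abel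
  · rw [map_sub, evDd_JD, sub_zero]
  · exact hL.ordLE_A.sub ((ordLE_Dpow (-1)).mono (by norm_num))
  · rw [Prod.snd_sub, sub_eq_add_neg]
    exact (neg_add_pos _ (isPos_D_one true).neg).trans hL.neg_A_snd

end

/-! ### The flows of the hierarchy -/

/-- An operator `T` with `T^* = -DTD⁻¹` for which `DT` is a differential operator has the negative
part of `D⁻¹f`, where `f` is its residue. -/
theorem IsLax.eq_Dinv_mul_res {T : PDO M} (hT : IsLax T) (hp : IsPos (Dl 1 T)) {n : ℤ}
    (hn : n ≤ 0) : T n = Dl (-1) (PDO.const (T (-1))) n := by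
  set U : PDO M := T - DDinv * PDO.const (T (-1)) with hU
  have hUn : ∀ n, U n = T n - Dl (-1) (PDO.const (T (-1))) n := fun n => by
    rw [hU, PDO.sub_apply, Dpow_mul]
  have hUL : IsLax U := hT.sub (isLax_Dinv_mul _)
  have hD : ∀ n < 0, U (n - 1) + der (U n) = 0 := fun n hn => by
    have h1 : Dl 1 T n = 0 := hp n hn
    have h2 : Dl 1 (Dl (-1) (PDO.const (T (-1)))) n = 0 := by
      rw [Dl_Dl, add_neg_cancel, Dl_zero, const_apply, if_neg hn.ne]
    rw [Dl_one_apply] at h1 h2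
    have e : U (n - 1) + der (U n) = (T (n - 1) + der (T n)) -
        (Dl (-1) (PDO.const (T (-1))) (n - 1) + der (Dl (-1) (PDO.const (T (-1))) n)) := by
      rw [hUn, hUn, der_sub]; abel
    rw [e, h1, h2, sub_zero]
  have hk : ∀ k : ℕ, U (-1 - k) = 0 := fun k => by
    induction k with
    | zero => rw [Nat.cast_zero, sub_zero, hUn, Dl_neg_one_const_res, sub_self]
    | succ k ih =>
      have := hD (-1 - k) (by omega)
      rw [ih, der_zero, add_zero] at this
      rw [← this]
      congr 1
      push_cast
      ring
  rw [← sub_eq_zero, ← hUn]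
  rcases hn.lt_or_eq with h | rfl
  · rw [← hk (-1 - n).toNat]
    congr 1
    omega
  · exact hUL.apply_zero

theorem IsLax.comm {t : Bool} {B T : Op M t} (hB : IsLax (B : PDO M)) (hT : IsLax (T : PDO M)) :
    IsLax (comm (B : PDO M) T) := by
  refine isLax_of_star_eq (T := B * T - T * B) ?_
  rw [map_sub, Op.star_mul, Op.star_mul, hB.star_eq, hT.star_eq]
  simp only [neg_mul_neg, mul_assoc, Dinv_mul_D_mul, mul_sub, sub_mul, neg_sub]

theorem isPos_Dl_comm {B T : Op M true} (hB : IsPos (B : PDO M)) (hBL : IsLax (B : PDO M))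
    (hT : IsPos (Dl 1 (T : PDO M))) : IsPos (Dl 1 (TwoBKP.comm (B : PDO M) T)) := by
  obtain ⟨v, hv, e⟩ := exists_eq_const_add_mul_D hB
  -- the constant term of `B` vanishes
  have e' : B = v * Op.D _ 1 := by
    rw [hBL.apply_zero] at e
    have h0 : Op.const true (0 : DiffAlg M) = 0 := Op.ext (PDO.ext fun n => by
      rw [Op.coe_const, const_apply, ite_self]; rfl)
    rwa [h0, zero_add] at e
  have h1 : Dl 1 (TwoBKP.comm (B : PDO M) T) =
      ((Op.D _ 1 * v * (Op.D _ 1 * T) - (Op.D _ 1 * T) * B : Op M true) : PDO M) := by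
    rw [← mul_assoc, mul_assoc (Op.D true 1) v, ← e', mul_assoc, mul_assoc, ← mul_sub, coe_D_mul]
    rfl
  have hT' : IsPos ((Op.D _ 1 * T : Op M true) : PDO M) := by rwa [coe_D_mul]
  rw [h1]
  exact (((isPos_D_one true).mul hv).mul hT').sub (hT'.mul hB)

section

variable {L : PDO M × PDO M}

/-- The Lax equations hold for all coefficients. -/
theorem IsLaxPair.evOp_laxField (hL : IsLaxPair L) {B : PDO M} (hf : InT false B)
    (ht : InT true B) (hB : IsLax B) {C : PDO M} (hC : IsNeg C)
    (hBC : TwoBKP.comm B L.1 = TwoBKP.comm C L.1) {E : PDO M} (hE : IsPos E) (hEL : IsLax E)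
    (hBE : TwoBKP.comm B L.2 = TwoBKP.comm E L.2) :
    evOp (laxField L B) L.1 = TwoBKP.comm B L.1 ∧ evOp (laxField L B) L.2 = TwoBKP.comm B L.2 := by
  constructor
  · have hT : IsLax (TwoBKP.comm B L.1) := IsLax.comm (B := ⟨B, hf⟩) (T := hL.P) hB hL.isLax_fst
    refine (hL.isLax_fst.evOp _).ext hT fun n hn => ?_
    rcases le_or_gt 0 n with h0 | h0
    · rw [hL.evOp_fst_isNeg _ n h0]
      rcases h0.lt_or_eq with h0 | rfl
      · have h1 : OrdLE 0 (TwoBKP.comm C L.1) :=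
          (((isNeg_iff.1 hC).mul hL.ordLE).mono (by norm_num)).sub
            ((hL.ordLE.mul (isNeg_iff.1 hC)).mono (by norm_num))
        rw [hBC, h1 n h0]
      · exact hT.apply_zero.symm
    · obtain ⟨j, rfl⟩ : ∃ j : ℕ, n = -(2 * j + 1) := by
        obtain ⟨k, rfl⟩ := hn
        exact ⟨(-k - 1).toNat, by omega⟩
      rw [hL.evOp_fst_odd]
      rfl
  · have hT : IsLax (TwoBKP.comm B L.2) := IsLax.comm (B := ⟨B, ht⟩) (T := hL.Ph) hB hL.isLax_snd
    have hW : IsPos (Dl 1 (hL.Ph : PDO M)) := by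
      rw [← coe_D_mul]
      exact hL.isPos_W
    have hp : IsPos (Dl 1 (TwoBKP.comm B L.2)) := by
      rw [hBE]
      exact isPos_Dl_comm (B := ⟨E, hE.inT_true⟩) (T := hL.Ph) hE hEL hW
    refine (hL.isLax_snd.evOp _).ext hT fun n hn => ?_
    rcases le_or_gt n 0 with h0 | h0
    · rw [hL.evOp_snd_of_nonpos _ h0, hT.eq_Dinv_mul_res hp h0]
      rfl
    · obtain ⟨j, rfl⟩ : ∃ j : ℕ, n = 2 * j - 1 := by
        obtain ⟨k, rfl⟩ := hn
        exact ⟨(k + 1).toNat, by omega⟩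
      rw [hL.evOp_snd_odd]
      rfl

theorem comm_pow_part {t : Bool} (T : Op M t) (k : ℕ) :
    TwoBKP.comm (pos ((T ^ k : Op M t) : PDO M)) T =
      TwoBKP.comm (-neg ((T ^ k : Op M t) : PDO M)) T := by
  let p : Op M t := ⟨_, (T ^ k).2.pos⟩
  let q : Op M t := ⟨_, (T ^ k).2.neg_part⟩
  have e : p + q = T ^ k := Op.ext (pos_add_neg _)
  have h : p * T - T * p = -q * T - T * -q := by
    have : p = T ^ k - q := by rw [← e]; abel
    rw [this, sub_mul, mul_sub, ← pow_succ, ← pow_succ']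
    noncomm_ring
  exact congrArg Subtype.val h

theorem IsLaxPair.isLax_pow_fst (hL : IsLaxPair L) {k : ℕ} (hk : Odd k) :
    IsLax ((hL.P ^ k : Op M false) : PDO M) := IsLax.pow (T := hL.P) hL.isLax_fst hk

theorem IsLaxPair.isLax_pow_snd (hL : IsLaxPair L) {k : ℕ} (hk : Odd k) :
    IsLax ((hL.Ph ^ k : Op M true) : PDO M) := IsLax.pow (T := hL.Ph) hL.isLax_snd hk

theorem IsLaxPair.coe_P_pow (hL : IsLaxPair L) (k : ℕ) :
    ((hL.P ^ k : Op M false) : PDO M) = L.1 ^ k := Op.coe_pow hL.P k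

theorem IsLaxPair.coe_Ph_pow (hL : IsLaxPair L) (k : ℕ) :
    ((hL.Ph ^ k : Op M true) : PDO M) = L.2 ^ k := Op.coe_pow hL.Ph k

theorem IsLaxPair.evOp_flow (hL : IsLaxPair L) {k : ℕ} (hk : Odd k) :
    evOp (flow L k) L.1 = TwoBKP.comm (pos (L.1 ^ k)) L.1 ∧
      evOp (flow L k) L.2 = TwoBKP.comm (pos (L.1 ^ k)) L.2 := by
  have h := hL.isLax_pow_fst hk
  have hc := comm_pow_part hL.P k
  rw [hL.coe_P_pow] at h hc
  have hp := isPos_pos (L.1 ^ k)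
  exact hL.evOp_laxField (hL.coe_P_pow k ▸ (hL.P ^ k).2.pos) hp.inT_true h.pos_part
    (isNeg_neg (L.1 ^ k)).neg hc hp h.pos_part rfl

theorem IsLaxPair.evOp_flowHat (hL : IsLaxPair L) {k : ℕ} (hk : Odd k) :
    evOp (flowHat L k) L.1 = TwoBKP.comm (-neg (L.2 ^ k)) L.1 ∧
      evOp (flowHat L k) L.2 = TwoBKP.comm (-neg (L.2 ^ k)) L.2 := by
  have h := hL.isLax_pow_snd hk
  have hc := comm_pow_part hL.Ph k
  rw [hL.coe_Ph_pow] at h hc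
  have hn := (isNeg_neg (L.2 ^ k)).neg
  exact hL.evOp_laxField hn.inT_false (hL.coe_Ph_pow k ▸ (hL.Ph ^ k).2.neg_part.neg)
    h.neg_part.neg hn rfl (isPos_pos (L.2 ^ k)) h.pos_part hc.symm

/-- The Lax equations in terms of `(A, Â)`. -/
theorem IsLaxPair.evDd_A_of_lax (hL : IsLaxPair L) {Y : Coord → DiffAlg M} {Bf : Op M false}
    {Bt : Op M true} (hB : IsLax (Bf : PDO M)) (hBt : (Bt : PDO M) = Bf)
    (h1 : evOp Y L.1 = TwoBKP.comm (Bf : PDO M) L.1)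
    (h2 : evOp Y L.2 = TwoBKP.comm (Bf : PDO M) L.2) :
    evDd Y hL.A = (splitD M).act hL.A (Op.star _ Bf, -Bt) := by
  have e1 : Op.ev Y false hL.P = Bf * hL.P - hL.P * Bf := Op.ext h1
  have e2 : Op.ev Y true hL.Ph = Bt * hL.Ph - hL.Ph * Bt := by
    rw [← hBt] at h2
    exact Op.ext h2
  have s1 : Op.star false Bf = -(Op.D _ 1 * Bf * Op.D _ (-1)) := IsLax.star_eq hB
  have s2 : Op.star true Bt = -(Op.D _ 1 * Bt * Op.D _ (-1)) := IsLax.star_eq (hBt ▸ hB)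
  refine Prod.ext ?_ ?_
  · have hr : ((splitD M).act hL.A (Op.star _ Bf, -Bt)).1 =
        hL.P ^ 2 * Op.D _ (-1) * Op.star _ Bf +
          Op.star _ (Op.star _ Bf) * (hL.P ^ 2 * Op.D _ (-1)) := rfl
    rw [hL.evDd_A_fst, e1, hr, Op.star_star, s1, pow_two]
    simp only [mul_neg, mul_assoc, Dinv_mul_D_mul, mul_sub, sub_mul, add_mul]
    abel
  · have hl : (evDd Y hL.A).2 = Op.ev Y _ (Op.D _ 1 * hL.Ph ^ 2) := rfl
    have hr : ((splitD M).act hL.A (Op.star _ Bf, -Bt)).2 =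
        Op.D _ 1 * hL.Ph ^ 2 * -Bt + Op.star _ (-Bt) * (Op.D _ 1 * hL.Ph ^ 2) := rfl
    rw [hl, hr, Op.ev_mul, Op.ev_D, zero_mul, add_zero, pow_two, Op.ev_mul, e2, map_neg, s2]
    simp only [mul_neg, neg_neg, mul_assoc, Dinv_mul_D_mul, mul_sub, sub_mul, mul_add]
    abel

end

/-! ### The Hamiltonian vector fields of the hierarchy -/

theorem act_mul_self {b x : Dd M} (hb : stD M b = -b) (hx : stD M x = x) :
    (splitD M).act b (x * b) = 0 := by
  have h : (splitD M).st (x * b) = -b * x := by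
    rw [(splitD M).st_mul]
    change stD M b * stD M x = _
    rw [hb, hx]
  rw [SplitRing.act, h]
  noncomm_ring

theorem tensD_eq_act {b x : Dd M} (hb : stD M b = -b) (hx : stD M x = x) :
    tensD b x = (splitD M).act b (prD M (x * JD M)) + (splitD M).act (JD M) (prD M (x * b)) := by
  have h1 := tensor_add_JD hb hx
  have h2 : (splitD M).act (JD M) (prD M (x * JD M)) = 0 :=
    (tensor_eq_bilD stD_JD hx).trans (bilD_JD hx)
  have h3 : (splitD M).tensor (b + JD M) x =
      (splitD M).act b (prD M (x * b)) + (splitD M).act b (prD M (x * JD M)) +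
        (splitD M).act (JD M) (prD M (x * b)) + (splitD M).act (JD M) (prD M (x * JD M)) := by
    change (splitD M).act (b + JD M) (prD M (x * (b + JD M))) = _
    rw [mul_add, map_add, SplitRing.act_add]
    simp only [SplitRing.act]
    noncomm_ring
  rw [h2, add_zero, h1, add_assoc] at h3
  exact add_left_cancel h3

/-- The pair `(-(Q_-)^*, -Q_+)`. -/
def hamW {t : Bool} (Q : Op M t) : Dd M := (-Op.star _ (nn t Q), -pp t Q)

theorem prD_star {Q : Op M false} : prD M (-Op.star _ Q, 0) = hamW Q := by
  rw [prD_apply, map_zero, map_zero, map_zero, add_zero, zero_add, map_neg, map_neg, ← star_nn,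
    ← star_pp, map_neg, Op.star_star]
  rfl

theorem prD_snd {Q : Op M true} : prD M (0, -Q) = hamW Q := by
  rw [prD_apply, map_zero, map_zero, map_zero, add_zero, zero_add, map_neg, map_neg, map_neg]
  rfl

/-- The term of the first tensor at a Hamiltonian in which `J` stands outside the projection
vanishes, because the positive and the negative part of an operator of Lax type are again of Lax
type. -/
theorem act_JD_hamW {t : Bool} {Q : Op M t} (hQ : IsLax (Q : PDO M)) :
    (splitD M).act (JD M) (hamW Q) = 0 := by
  have s1 : Op.star false (nn t Q) = -(Op.D _ 1 * nn t Q * Op.D _ (-1)) :=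
    IsLax.star_eq hQ.neg_part
  have s2 : Op.star true (pp t Q) = -(Op.D _ 1 * pp t Q * Op.D _ (-1)) :=
    IsLax.star_eq hQ.pos_part
  refine Prod.ext ?_ ?_
  · change Op.D _ (-1) * -Op.star _ (nn t Q) + Op.star _ (-Op.star _ (nn t Q)) * Op.D _ (-1) = 0
    rw [map_neg, Op.star_star, s1]
    simp only [neg_mul, neg_neg, mul_assoc, Dinv_mul_D_mul, add_neg_cancel]
  · change Op.D _ 1 * -pp t Q + Op.star _ (-pp t Q) * Op.D _ 1 = 0
    rw [map_neg, s2]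
    simp only [mul_neg, neg_neg, mul_assoc, Dinv_mul_D, mul_one, neg_add_cancel]

section

variable {L : PDO M × PDO M}

theorem IsLaxPair.act_A_fst (hL : IsLaxPair L) {k : ℕ} (hk : Odd k) :
    (splitD M).act hL.A (Op.star _ (hL.P ^ k), 0) = 0 := by
  have s := IsLax.star_eq (hL.isLax_pow_fst hk)
  refine Prod.ext ?_ ?_
  · change hL.P ^ 2 * Op.D _ (-1) * Op.star _ (hL.P ^ k) +
      Op.star _ (Op.star _ (hL.P ^ k)) * (hL.P ^ 2 * Op.D _ (-1)) = 0
    rw [Op.star_star, s]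
    simp only [mul_neg, mul_assoc, Dinv_mul_D_mul]
    rw [← mul_assoc, ← mul_assoc, ← pow_add, ← pow_add, add_comm 2 k, neg_add_cancel]
  · change Op.D _ 1 * hL.Ph ^ 2 * 0 + Op.star _ 0 * (Op.D _ 1 * hL.Ph ^ 2) = 0
    rw [map_zero, mul_zero, zero_mul, add_zero]

theorem IsLaxPair.act_A_snd (hL : IsLaxPair L) {k : ℕ} (hk : Odd k) :
    (splitD M).act hL.A (0, hL.Ph ^ k) = 0 := by
  have s := IsLax.star_eq (hL.isLax_pow_snd hk)
  refine Prod.ext ?_ ?_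
  · change hL.P ^ 2 * Op.D _ (-1) * 0 + Op.star _ 0 * (hL.P ^ 2 * Op.D _ (-1)) = 0
    rw [map_zero, mul_zero, zero_mul, add_zero]
  · change Op.D _ 1 * hL.Ph ^ 2 * hL.Ph ^ k + Op.star _ (hL.Ph ^ k) * (Op.D _ 1 * hL.Ph ^ 2) = 0
    rw [s]
    simp only [neg_mul, mul_assoc, Dinv_mul_D_mul]
    rw [← pow_add, ← pow_add, add_comm 2 k, add_neg_cancel]

/-- The flow `∂/∂t_k` of `(A, Â)` in the form `A W + W^* A` of the tensors. -/
theorem IsLaxPair.evDd_flow (hL : IsLaxPair L) {k : ℕ} (hk : Odd k) :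
    evDd (flow L k) hL.A = (splitD M).act hL.A (hamW (hL.P ^ k)) := by
  obtain ⟨h1, h2⟩ := hL.evOp_flow hk
  have hc : ((hL.P ^ k - nn _ (hL.P ^ k) : Op M false) : PDO M) = pos (L.1 ^ k) := by
    rw [Op.coe_sub, coe_nn, hL.coe_P_pow, sub_eq_iff_eq_add, pos_add_neg]
  have hB : IsLax ((hL.P ^ k - nn _ (hL.P ^ k) : Op M false) : PDO M) :=
    (hL.isLax_pow_fst hk).sub (hL.isLax_pow_fst hk).neg_part
  have hBt : (pp _ (hL.P ^ k) : PDO M) = ((hL.P ^ k - nn _ (hL.P ^ k) : Op M false) : PDO M) := by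
    rw [hc, coe_pp, hL.coe_P_pow]
  rw [← hc] at h1 h2
  have e : ((Op.star false (hL.P ^ k - nn _ (hL.P ^ k)), -pp _ (hL.P ^ k)) : Dd M) =
      (Op.star _ (hL.P ^ k), 0) + hamW (hL.P ^ k) := by
    rw [hamW, map_sub, Prod.mk_add_mk, zero_add, sub_eq_add_neg]
  rw [hL.evDd_A_of_lax hB hBt h1 h2, e, SplitRing.act_add, hL.act_A_fst hk, zero_add]

theorem IsLaxPair.evDd_flowHat (hL : IsLaxPair L) {k : ℕ} (hk : Odd k) :
    evDd (flowHat L k) hL.A = (splitD M).act hL.A (hamW (hL.Ph ^ k)) := by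
  obtain ⟨h1, h2⟩ := hL.evOp_flowHat hk
  have hc : ((-nn _ (hL.Ph ^ k) : Op M false) : PDO M) = -neg (L.2 ^ k) := by
    rw [Op.coe_neg, coe_nn, hL.coe_Ph_pow]
  have hB : IsLax ((-nn _ (hL.Ph ^ k) : Op M false) : PDO M) :=
    (hL.isLax_pow_snd hk).neg_part.neg
  have hBt : ((-(hL.Ph ^ k - pp _ (hL.Ph ^ k)) : Op M true) : PDO M) =
      ((-nn _ (hL.Ph ^ k) : Op M false) : PDO M) := by
    rw [Op.coe_neg, Op.coe_neg, Op.coe_sub, coe_pp, coe_nn, neg_inj, sub_eq_iff_eq_add, add_comm,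
      pos_add_neg]
  rw [← hc] at h1 h2
  have e : ((Op.star false (-nn _ (hL.Ph ^ k)), -(-(hL.Ph ^ k - pp _ (hL.Ph ^ k)))) : Dd M) =
      (0, hL.Ph ^ k) + hamW (hL.Ph ^ k) := by
    rw [hamW, map_neg, Prod.mk_add_mk, zero_add, neg_neg, sub_eq_add_neg]
  rw [hL.evDd_A_of_lax hB hBt h1 h2, e, SplitRing.act_add, hL.act_A_snd hk, zero_add]

/-! ### The gradients of the Hamiltonians -/

/-- The trace on `𝒟⁻` or `𝒟⁺`. -/
def trO (M : Opens (Coord → ℝ)) (t : Bool) : Op M t →+ LocalFun M :=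
  AddMonoidHom.mk' (fun x => tr (x : PDO M)) fun x y => tr_add x.1 y.1

theorem trO_apply {t : Bool} (x : Op M t) : trO M t x = tr (x : PDO M) := rfl

theorem trO_comm {t : Bool} (x y : Op M t) : trO M t (x * y) = trO M t (y * x) :=
  tr_mul_comm x.2 y.2

theorem trO_ev {t : Bool} (Y : Coord → DiffAlg M) (x : Op M t) :
    trO M t (Op.ev Y t x) = evLoc Y (tr (x : PDO M)) := tr_evOp Y x.1

theorem trO_pow_mul_ev_pow {t : Bool} (Y : Coord → DiffAlg M) (T : Op M t) (m k : ℕ) :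
    trO M t (T ^ m * Op.ev Y t (T ^ (k + 1))) =
      ((k + 1 : ℕ) : ℂ) • trO M t (T ^ (m + k) * Op.ev Y t T) := by
  induction k generalizing m with
  | zero => simp
  | succ k ih =>
    have h : trO M t (T ^ m * (Op.ev Y t (T ^ (k + 1)) * T)) =
        trO M t (T ^ (m + 1) * Op.ev Y t (T ^ (k + 1))) := by
      rw [← mul_assoc, trO_comm, ← mul_assoc, ← pow_succ']
    rw [pow_succ T (k + 1), Op.ev_mul, mul_add, map_add, h, ih, ← mul_assoc, ← pow_add,
      add_right_comm m 1 k, add_assoc m k 1, Nat.cast_succ (k + 1), add_smul, one_smul, add_comm]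

theorem evLoc_tr_pow {t : Bool} (Y : Coord → DiffAlg M) (T : Op M t) (m : ℕ) :
    (2 / ((m + 2 : ℕ) : ℂ)) • evLoc Y (tr ((T : PDO M) ^ (m + 2))) =
      trO M t (T ^ m * Op.ev Y t (T ^ 2)) := by
  have h := trO_pow_mul_ev_pow Y T 0 (m + 1)
  have hm : ((m + 2 : ℕ) : ℂ) ≠ 0 := by exact_mod_cast (by omega : m + 2 ≠ 0)
  rw [pow_zero, one_mul, trO_ev, Op.coe_pow, zero_add] at h
  rw [h, trO_pow_mul_ev_pow Y T m 1, smul_smul, div_mul_cancel₀ _ hm]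
  norm_num

theorem IsLaxPair.isGrad_ham (hL : IsLaxPair L) {m : ℕ} (hm : Odd m) :
    IsGrad hL.A (ham L (m + 2)) (Op.D _ 1 * hL.P ^ m, 0) := by
  constructor
  · have hs : Op.star false (Op.D _ 1 * hL.P ^ m) = Op.D _ 1 * hL.P ^ m := by
      rw [Op.star_mul, IsLax.star_eq (hL.isLax_pow_fst hm), Op.star_D_one]
      simp only [neg_mul_neg, mul_assoc, Dinv_mul_D, mul_one]
    exact Prod.ext hs (map_zero (Op.star true))
  · intro Y
    have hl : evLoc Y (ham L (m + 2)) = _ := ((evLoc Y).map_smul _ _).trans (evLoc_tr_pow Y hL.P m)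
    have hr : trD M ((Op.D _ 1 * hL.P ^ m, 0) * evDd Y hL.A) =
        trO M _ (Op.D _ 1 * hL.P ^ m * (Op.ev Y _ (hL.P ^ 2 * Op.D _ (-1)))) +
          trO M _ (0 * (evDd Y hL.A).2) := rfl
    rw [hl, hr, zero_mul, map_zero, add_zero, Op.ev_mul, Op.ev_D, mul_zero, zero_add, ← mul_assoc,
      trO_comm (_ * _ * _) (Op.D false (-1)), mul_assoc (Op.D false 1), Dinv_mul_D_mul]

theorem IsLaxPair.isGrad_hamHat (hL : IsLaxPair L) {m : ℕ} (hm : Odd m) :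
    IsGrad hL.A (hamHat L (m + 2)) (0, -(hL.Ph ^ m * Op.D _ (-1))) := by
  constructor
  · refine Prod.ext (map_zero (Op.star false)) ?_
    change Op.star _ (-(hL.Ph ^ m * Op.D _ (-1))) = _
    rw [map_neg, Op.star_mul, IsLax.star_eq (hL.isLax_pow_snd hm), Op.star_D_neg_one]
    simp only [neg_mul_neg, mul_assoc, Dinv_mul_D_mul]
  · intro Y
    have hl : evLoc Y (hamHat L (m + 2)) = -trO M _ (hL.Ph ^ m * Op.ev Y _ (hL.Ph ^ 2)) := by
      refine ((evLoc Y).map_smul _ _).trans ((neg_smul _ _).trans (congrArg _ ?_))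
      exact evLoc_tr_pow Y hL.Ph m
    have hr : trD M ((0, -(hL.Ph ^ m * Op.D _ (-1))) * evDd Y hL.A) =
        trO M _ (0 * (evDd Y hL.A).1) +
          trO M _ (-(hL.Ph ^ m * Op.D _ (-1)) * (Op.ev Y _ (Op.D _ 1 * hL.Ph ^ 2))) := rfl
    rw [hl, hr, zero_mul, map_zero, zero_add, Op.ev_mul, Op.ev_D, zero_mul, add_zero, neg_mul,
      mul_assoc, Dinv_mul_D_mul, map_neg]

theorem IsLaxPair.isGrad_ham_one (hL : IsLaxPair L) : IsGrad hL.A (ham L 1) (1, 0) := by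
  constructor
  · refine Prod.ext (Op.ext ?_) (map_zero (Op.star true))
    change adj (1 : PDO M) = 1
    rw [one_eq_Dpow, adj_Dpow]
    simp
  · intro Y
    have hr : trD M ((1, 0) * evDd Y hL.A) =
        trO M _ (1 * (evDd Y hL.A).1) + trO M _ (0 * (evDd Y hL.A).2) := rfl
    have h := hL.evDd_A_fst_leading (Z := Y) (j := 0) fun i hi => absurd hi (Nat.not_lt_zero i)
    have h' := hL.evOp_fst_odd Y 0
    have hl : evLoc Y (ham L 1) = (2 / ((1 : ℕ) : ℂ)) • integral (evOp Y (L.1 ^ 1) (-1)) :=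
      (evLoc Y).map_smul _ _
    have h1 : L.1 ^ 1 = L.1 := by rw [← hL.coe_P_pow, pow_one]; rfl
    simp only [Nat.cast_zero, mul_zero, zero_add] at h h'
    rw [hr, hl, h1, h', one_mul, zero_mul, map_zero, add_zero, trO_apply, tr, h, Nat.cast_one,
      div_one, integral_smul]

theorem IsLaxPair.isGrad_hamHat_one (hL : IsLaxPair L) {r : DiffAlg M}
    (hr : coord rhoLabel * r = 1) : IsGrad hL.A (hamHat L 1) (0, -Op.const _ r) := by
  constructor
  · refine Prod.ext (map_zero (Op.star false)) ?_
    change Op.star _ (-Op.const _ r) = _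
    rw [map_neg, Op.star_const]
  · intro Y
    have he : trD M ((0, -Op.const _ r) * evDd Y hL.A) =
        trO M _ (0 * (evDd Y hL.A).1) + trO M _ (-Op.const _ r * (evDd Y hL.A).2) := rfl
    have h := congrFun (hL.neg_evDd_A Y) (-1)
    simp only [neg_apply, if_pos (show (-1 : ℤ) < 0 by norm_num), Op.coe_add, PDO.add_apply,
      fDg_res] at h
    have h' := hL.evOp_snd_odd Y 0
    have hl : evLoc Y (hamHat L 1) = (-(2 / ((1 : ℕ) : ℂ))) • integral (evOp Y (L.2 ^ 1) (-1)) :=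
      (evLoc Y).map_smul _ _
    have h1 : L.2 ^ 1 = L.2 := by rw [← hL.coe_Ph_pow, pow_one]; rfl
    simp only [Nat.cast_zero, mul_zero, zero_sub] at h'
    rw [he, hl, h1, h', zero_mul, map_zero, zero_add, neg_mul, map_neg, trO_apply, Op.coe_mul,
      Op.coe_const, const_mul, tr, PDO.fsmul_apply, h, mul_comm (Y rhoLabel), ← two_smul ℂ,
      mul_smul_comm, ← mul_assoc, mul_comm r, hr, one_mul, integral_smul, Nat.cast_one, div_one,
      neg_smul]

/-! ### The bihamiltonian recursion -/

theorem IsLaxPair.mul_A_ham (hL : IsLaxPair L) {m : ℕ} (hm : Odd m) :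
    ((Op.D _ 1 * hL.P ^ m, 0) * hL.A : Dd M) = (-Op.star _ (hL.P ^ (m + 2)), 0) := by
  refine Prod.ext ?_ (zero_mul _)
  change Op.D _ 1 * hL.P ^ m * (hL.P ^ 2 * Op.D _ (-1)) = _
  rw [IsLax.star_eq (hL.isLax_pow_fst (hm.add_even even_two)), neg_neg, pow_add]
  simp only [mul_assoc]

theorem IsLaxPair.mul_A_hamHat (hL : IsLaxPair L) (m : ℕ) :
    ((0, -(hL.Ph ^ m * Op.D _ (-1))) * hL.A : Dd M) = (0, -hL.Ph ^ (m + 2)) := by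
  refine Prod.ext (zero_mul _) ?_
  change -(hL.Ph ^ m * Op.D _ (-1)) * (Op.D _ 1 * hL.Ph ^ 2) = _
  rw [neg_mul, mul_assoc, Dinv_mul_D_mul, ← pow_add]

theorem IsLaxPair.tensor_ham (hL : IsLaxPair L) {m : ℕ} (hm : Odd m) :
    (splitD M).tensor hL.A (Op.D _ 1 * hL.P ^ m, 0) = evDd (flow L (m + 2)) hL.A := by
  rw [hL.evDd_flow (hm.add_even even_two)]
  change (splitD M).act hL.A (prD M (_ * hL.A)) = _
  rw [hL.mul_A_ham hm, prD_star]

theorem IsLaxPair.tensor_hamHat (hL : IsLaxPair L) {m : ℕ} (hm : Odd m) :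
    (splitD M).tensor hL.A (0, -(hL.Ph ^ m * Op.D _ (-1))) = evDd (flowHat L (m + 2)) hL.A := by
  rw [hL.evDd_flowHat (hm.add_even even_two)]
  change (splitD M).act hL.A (prD M (_ * hL.A)) = _
  rw [hL.mul_A_hamHat, prD_snd]

theorem IsLaxPair.tensD_ham (hL : IsLaxPair L) {m : ℕ} (hm : Odd m) :
    tensD hL.A (Op.D _ 1 * hL.P ^ m, 0) = evDd (flow L m) hL.A := by
  have h : ((Op.D _ 1 * hL.P ^ m, 0) * JD M : Dd M) = (-Op.star _ (hL.P ^ m), 0) := by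
    refine Prod.ext ?_ (zero_mul _)
    rw [IsLax.star_eq (hL.isLax_pow_fst hm), neg_neg]
    rfl
  rw [hL.evDd_flow hm, tensD_eq_act hL.stD_A (hL.isGrad_ham hm).st, hL.mul_A_ham hm, h, prD_star,
    prD_star, act_JD_hamW (hL.isLax_pow_fst (hm.add_even even_two)), add_zero]

theorem IsLaxPair.tensD_hamHat (hL : IsLaxPair L) {m : ℕ} (hm : Odd m) :
    tensD hL.A (0, -(hL.Ph ^ m * Op.D _ (-1))) = evDd (flowHat L m) hL.A := by
  have h : ((0, -(hL.Ph ^ m * Op.D _ (-1))) * JD M : Dd M) = (0, -hL.Ph ^ m) := by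
    refine Prod.ext (zero_mul _) ?_
    change -(hL.Ph ^ m * Op.D _ (-1)) * Op.D _ 1 = _
    rw [neg_mul, mul_assoc, Dinv_mul_D, mul_one]
  rw [hL.evDd_flowHat hm, tensD_eq_act hL.stD_A (hL.isGrad_hamHat hm).st, hL.mul_A_hamHat, h,
    prD_snd, prD_snd, act_JD_hamW (hL.isLax_pow_snd (hm.add_even even_two)), add_zero]

theorem IsLaxPair.tensor_ham_one (hL : IsLaxPair L) :
    (splitD M).tensor hL.A (1, 0) = evDd (flow L 1) hL.A := by
  have hP : IsNeg ((hL.P - Op.D _ 1 : Op M false) : PDO M) := fun i hi => by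
    change L.1 i - Dpow 1 i = 0
    rw [hL.leading i hi, Dpow_apply, sub_self]
  have hA : IsNeg ((hL.A.1 - Op.D _ 1 : Op M false) : PDO M) := by
    refine OrdLE.isNeg_of_antisymm (fun i hi => ?_) ?_
    · change (hL.A.1 : PDO M) i - Dpow 1 i = 0
      rw [Dpow_apply]
      split_ifs with h
      · subst h
        have h2 := hL.ordLE.mul_top hL.ordLE
        rw [hL.leading 1 (by omega), if_pos rfl, one_mul] at h2
        rw [IsLaxPair.A, coe_mul_D, pow_two, sub_eq_zero]
        exact h2
      · rw [hL.ordLE_A i (by omega), sub_zero]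
    · have : Op.star false (hL.A.1 - Op.D _ 1) = -(hL.A.1 - Op.D _ 1) := by
        rw [map_sub, hL.star_A_fst, Op.star_D_one, neg_sub_neg, neg_sub]
      exact congrArg Subtype.val this
  have parts : ∀ T : Op M false, IsNeg ((T - Op.D _ 1 : Op M false) : PDO M) →
      nn _ T = T - Op.D _ 1 ∧ pp _ T = Op.D _ 1 := fun T hT => by
    have e : T = (T - Op.D _ 1) + Op.D _ 1 := by abel
    have h1 : nn _ (Op.D false 1 : Op M false) = 0 := Op.ext (isPos_D_one _).neg_eq
    have h2 : pp _ (Op.D false 1 : Op M false) = Op.D _ 1 := Op.ext (isPos_D_one _).pos_eq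
    have h3 : nn _ (T - Op.D _ 1) = T - Op.D _ 1 := Op.ext hT.neg_eq
    have h4 : pp _ (T - Op.D _ 1) = 0 := Op.ext hT.pos_eq
    constructor
    · nth_rw 1 [e]
      rw [map_add, h1, h3, add_zero]
    · nth_rw 1 [e]
      rw [map_add, h2, h4, zero_add]
  have e : prD M ((1, 0) * hL.A) =
      ((1, 0) * hL.A + (Op.star _ (hL.P ^ 1), 0)) + hamW (hL.P ^ 1) := by
    have h : ((1, 0) * hL.A : Dd M) = (hL.A.1, 0) := Prod.ext (one_mul _) (zero_mul _)
    rw [h, prD_apply, hamW, pow_one, (parts _ hP).1, (parts _ hP).2, (parts _ hA).1, (parts _ hA).2,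
      map_zero, map_zero, map_zero, map_sub, Op.star_D_one, Op.star_D_one, Prod.mk_add_mk,
      Prod.mk_add_mk]
    have h1 : ∀ {G : Type} [AddCommGroup G] (a s d : G), a - d + 0 = a + s + -(s - -d) := by
      intros; abel
    have h2 : ∀ {G : Type} [AddCommGroup G] (d : G), 0 + -d = 0 + 0 + -d := by
      intros; abel
    exact Prod.ext (h1 _ _ _) (h2 _)
  rw [hL.evDd_flow odd_one]
  change (splitD M).act hL.A (prD M (_ * hL.A)) = _
  rw [e, SplitRing.act_add, SplitRing.act_add, act_mul_self hL.stD_A hL.isGrad_ham_one.st,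
    hL.act_A_fst odd_one, zero_add, zero_add]

theorem IsLaxPair.tensor_hamHat_one (hL : IsLaxPair L) {r : DiffAlg M}
    (hr : coord rhoLabel * r = 1) :
    (splitD M).tensor hL.A (0, -Op.const _ r) = evDd (flowHat L 1) hL.A := by
  have h : ((0, -Op.const _ r) * hL.A : Dd M) = (0, -(Op.const _ r * hL.A.2)) :=
    Prod.ext (zero_mul _) (neg_mul _ _)
  have hn : nn _ (Op.const _ r * hL.A.2) = nn _ hL.Ph := Op.ext <| by
    have h1 := neg_const_mul r hL.neg_A_snd
    have h2 : Op.const true r * fDg (coord rhoLabel) (coord rhoLabel) =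
        Op.D _ (-1) * Op.const _ (coord rhoLabel) := Op.ext <| by
      rw [fDg, mul_assoc, Op.coe_mul, Op.coe_mul, Op.coe_const, Op.coe_const, const_mul, const_mul,
        smul_smul, mul_comm r, hr, one_smul]
    rw [h2] at h1
    refine h1.trans (PDO.ext fun i => ?_)
    rw [coe_nn, neg_apply, neg_apply]
    split_ifs with hi
    · exact (hL.hat_leading i hi.le).symm
    · rfl
  have parts : ∀ T : Op M true, pp _ T = T - (⟨_, T.2.neg_part⟩ : Op M true) := fun T =>
    Op.ext (eq_sub_of_add_eq (pos_add_neg _))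
  have e : prD M ((0, -Op.const _ r) * hL.A) =
      ((0, -Op.const _ r) * hL.A + (0, hL.Ph ^ 1)) + hamW (hL.Ph ^ 1) := by
    have hv : (⟨_, (Op.const _ r * hL.A.2).2.neg_part⟩ : Op M true) = ⟨_, hL.Ph.2.neg_part⟩ :=
      Op.ext (congrArg (fun x : Op M false => (x : PDO M)) hn)
    rw [h, prD_snd, hamW, hamW, pow_one, hn, parts, parts, hv, Prod.mk_add_mk, Prod.mk_add_mk]
    have h1 : ∀ {G : Type} [AddCommGroup G] (s : G), -s = 0 + 0 + -s := by
      intros; abel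
    have h2 : ∀ {G : Type} [AddCommGroup G] (v n p : G), -(v - n) = -v + p + -(p - n) := by
      intros; abel
    exact Prod.ext (h1 _) (h2 _ _ _)
  rw [hL.evDd_flowHat odd_one]
  change (splitD M).act hL.A (prD M (_ * hL.A)) = _
  rw [e, SplitRing.act_add, SplitRing.act_add, act_mul_self hL.stD_A (hL.isGrad_hamHat_one hr).st,
    hL.act_A_snd odd_one, zero_add, zero_add]

/-! ### The two brackets -/

theorem IsLaxPair.bracket₂_eq (hL : IsLaxPair L) (hM : ∀ x ∈ M, x rhoLabel ≠ 0) {F G : LocalFun M}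
    {x y : Dd M} (hx : IsGrad hL.A F x) (hy : IsGrad hL.A G y) :
    bracket₂ L F G = trD M (x * (splitD M).tensor hL.A y) := by
  have h : F ∈ F0 L ∧ G ∈ F0 L := ⟨(mem_F0_iff hL.coe_A_fst hL.coe_A_snd F).2 ⟨x, hx⟩,
    (mem_F0_iff hL.coe_A_fst hL.coe_A_snd G).2 ⟨y, hy⟩⟩
  obtain ⟨x', e1, e2, hx'⟩ := h.1.choose_spec.lift hL.coe_A_fst hL.coe_A_snd
  obtain ⟨y', f1, f2, hy'⟩ := h.2.choose_spec.lift hL.coe_A_fst hL.coe_A_snd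
  rw [bracket₂, bracket, dif_pos h, trD_tensor_unique (hL.isAdmissible_A hM) hx hx' hy hy',
    tensor_eq_bilD hL.stD_A hy'.st]
  refine pair_eq_trD e1 e2 ?_
  rw [coe_bilD_self, hL.coe_A_fst, hL.coe_A_snd, f1, f2]

theorem IsLaxPair.trD_tensD_unique (hL : IsLaxPair L) (hM : ∀ x ∈ M, x rhoLabel ≠ 0)
    {F G : LocalFun M} {x x' y y' : Dd M} (hx : IsGrad hL.A F x) (hx' : IsGrad hL.A F x')
    (hy : IsGrad hL.A G y) (hy' : IsGrad hL.A G y') :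
    trD M (x * tensD hL.A y) = trD M (x' * tensD hL.A y') := by
  have h1 := trD_tensor_unique (hL.isAdmissible_A hM) hx hx' hy hy'
  have h2 := trD_tensor_unique (hL.isAdmissible_add hM) hx hx' hy hy'
  rw [tensor_add_JD hL.stD_A hy.st, tensor_add_JD hL.stD_A hy'.st, mul_add, mul_add, map_add,
    map_add, h1] at h2
  exact add_left_cancel h2

theorem IsLaxPair.bracket₁_eq (hL : IsLaxPair L) (hM : ∀ x ∈ M, x rhoLabel ≠ 0) {F G : LocalFun M}
    {x y : Dd M} (hx : IsGrad hL.A F x) (hy : IsGrad hL.A G y) :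
    bracket₁ L F G = trD M (x * tensD hL.A y) := by
  have h : F ∈ F0 L ∧ G ∈ F0 L := ⟨(mem_F0_iff hL.coe_A_fst hL.coe_A_snd F).2 ⟨x, hx⟩,
    (mem_F0_iff hL.coe_A_fst hL.coe_A_snd G).2 ⟨y, hy⟩⟩
  obtain ⟨x', e1, e2, hx'⟩ := h.1.choose_spec.lift hL.coe_A_fst hL.coe_A_snd
  obtain ⟨y', f1, f2, hy'⟩ := h.2.choose_spec.lift hL.coe_A_fst hL.coe_A_snd
  rw [bracket₁, bracket, dif_pos h, hL.trD_tensD_unique hM hx hx' hy hy']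
  refine pair_eq_trD e1 e2 ?_
  rw [coe_tensD, hL.coe_A_fst, hL.coe_A_snd, f1, f2]

theorem IsLaxPair.bracket_eq_pair (hL : IsLaxPair L) (hM : ∀ x ∈ M, x rhoLabel ≠ 0)
    {F G : LocalFun M} {X Y : PDO M × PDO M} (hX : IsGradient L F X) (hY : IsGradient L G Y) :
    bracket₁ L F G = pair X (tensor₁ (bfA L) Y) ∧
      bracket₂ L F G = pair X (tensor₂ (bfA L) Y) := by
  obtain ⟨x, e1, e2, hx⟩ := hX.lift hL.coe_A_fst hL.coe_A_snd
  obtain ⟨y, f1, f2, hy⟩ := hY.lift hL.coe_A_fst hL.coe_A_snd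
  rw [hL.bracket₁_eq hM hx hy, hL.bracket₂_eq hM hx hy, tensor_eq_bilD hL.stD_A hy.st]
  refine ⟨(pair_eq_trD e1 e2 ?_).symm, (pair_eq_trD e1 e2 ?_).symm⟩
  · rw [coe_tensD, hL.coe_A_fst, hL.coe_A_snd, f1, f2]
  · rw [coe_bilD_self, hL.coe_A_fst, hL.coe_A_snd, f1, f2]

theorem IsLaxPair.isPoissonBracket (hL : IsLaxPair L) (hM : ∀ x ∈ M, x rhoLabel ≠ 0) (a b : ℂ) :
    IsPoissonBracket (F0 L) fun F G => a • bracket₁ L F G + b • bracket₂ L F G := by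
  have hS := mem_F0_iff hL.coe_A_fst hL.coe_A_snd
  refine IsPoissonBracket.pencil (isPoissonBracket_of_val (hL.isAdmissible_A hM) _ hS _
    fun F G x y hx hy => hL.bracket₂_eq hM hx hy)
    (isPoissonBracket_of_val (hL.isAdmissible_add hM) _ hS _ fun F G x y hx hy => ?_)
    (isPoissonBracket_of_val (hL.isAdmissible_sub hM) _ hS _ fun F G x y hx hy => ?_) a b
  · rw [hL.bracket₁_eq hM hx hy, hL.bracket₂_eq hM hx hy, tensor_add_JD hL.stD_A hy.st, mul_add,
      map_add]
  · rw [hL.bracket₁_eq hM hx hy, hL.bracket₂_eq hM hx hy, tensor_sub_JD hL.stD_A hy.st, mul_sub,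
      map_sub]

theorem odd_eq_one_or {k : ℕ} (hk : Odd k) : k = 1 ∨ ∃ m, Odd m ∧ k = m + 2 := by
  obtain ⟨j, rfl⟩ := hk
  rcases j with _ | j
  · exact Or.inl rfl
  · exact Or.inr ⟨2 * j + 1, ⟨j, rfl⟩, by ring⟩

theorem IsLaxPair.exists_isGrad_ham (hL : IsLaxPair L) {k : ℕ} (hk : Odd k) :
    ∃ x, IsGrad hL.A (ham L k) x ∧ (splitD M).tensor hL.A x = evDd (flow L k) hL.A := by
  rcases odd_eq_one_or hk with rfl | ⟨m, hm, rfl⟩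
  · exact ⟨_, hL.isGrad_ham_one, hL.tensor_ham_one⟩
  · exact ⟨_, hL.isGrad_ham hm, hL.tensor_ham hm⟩

theorem IsLaxPair.exists_isGrad_hamHat (hL : IsLaxPair L) (hM : ∀ x ∈ M, x rhoLabel ≠ 0) {k : ℕ}
    (hk : Odd k) :
    ∃ x, IsGrad hL.A (hamHat L k) x ∧ (splitD M).tensor hL.A x = evDd (flowHat L k) hL.A := by
  rcases odd_eq_one_or hk with rfl | ⟨m, hm, rfl⟩
  · obtain ⟨r, hr⟩ := exists_rho_inv hM
    exact ⟨_, hL.isGrad_hamHat_one hr, hL.tensor_hamHat_one hr⟩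
  · exact ⟨_, hL.isGrad_hamHat hm, hL.tensor_hamHat hm⟩

end

end TwoBKP

end

open TwoBKP in
theorem mainTheorem1 (M : TopologicalSpace.Opens (Coord → ℝ))
    (hM : ∀ x ∈ M, x rhoLabel ≠ 0) :
    (∃! L : PDO M × PDO M, IsLaxPair L) ∧
    ∀ L : PDO M × PDO M, IsLaxPair L →
      -- the flows are well defined: the Lax equations hold for all coefficients
      (∀ k : ℕ, Odd k →
        (evOp (flow L k) L.1 = comm (pos (L.1 ^ k)) L.1 ∧
          evOp (flow L k) L.2 = comm (pos (L.1 ^ k)) L.2) ∧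
        (evOp (flowHat L k) L.1 = comm (-neg (L.2 ^ k)) L.1 ∧
          evOp (flowHat L k) L.2 = comm (-neg (L.2 ^ k)) L.2)) ∧
      -- the brackets do not depend on the choice of the variational gradients
      (∀ F G : LocalFun M, ∀ X Y : PDO M × PDO M, IsGradient L F X → IsGradient L G Y →
        bracket₁ L F G = pair X (tensor₁ (bfA L) Y) ∧
          bracket₂ L F G = pair X (tensor₂ (bfA L) Y)) ∧
      -- they are compatible Poisson brackets
      (∀ a b : ℂ, IsPoissonBracket (F0 L) fun F G => a • bracket₁ L F G + b • bracket₂ L F G) ∧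
      -- the Hamiltonians are admissible functionals
      (∀ k : ℕ, Odd k → ham L k ∈ F0 L ∧ hamHat L k ∈ F0 L) ∧
      -- the bihamiltonian recursion
      (∀ k : ℕ, Odd k → ∀ f : DiffAlg M, integral f ∈ F0 L →
        (integral (ev (flow L k) f) = bracket₁ L (integral f) (ham L (k + 2)) ∧
          integral (ev (flow L k) f) = bracket₂ L (integral f) (ham L k)) ∧
        (integral (ev (flowHat L k) f) = bracket₁ L (integral f) (hamHat L (k + 2)) ∧
          integral (ev (flowHat L k) f) = bracket₂ L (integral f) (hamHat L k))) := by
  refine ⟨?_, fun L hL => ⟨fun k hk => ⟨hL.evOp_flow hk, hL.evOp_flowHat hk⟩,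
    fun F G X Y hX hY => hL.bracket_eq_pair hM hX hY, hL.isPoissonBracket hM,
    fun k hk => ⟨?_, ?_⟩, fun k hk f hf => ?_⟩⟩
  · obtain ⟨L, hL⟩ := exists_isLaxPair M
    exact ⟨L, hL, fun L' hL' => hL'.unique hL⟩
  · obtain ⟨x, hx, -⟩ := hL.exists_isGrad_ham hk
    exact (mem_F0_iff hL.coe_A_fst hL.coe_A_snd _).2 ⟨x, hx⟩
  · obtain ⟨x, hx, -⟩ := hL.exists_isGrad_hamHat hM hk
    exact (mem_F0_iff hL.coe_A_fst hL.coe_A_snd _).2 ⟨x, hx⟩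
  · obtain ⟨x, hx⟩ := (mem_F0_iff hL.coe_A_fst hL.coe_A_snd _).1 hf
    obtain ⟨y, hy, ey⟩ := hL.exists_isGrad_ham hk
    obtain ⟨z, hz, ez⟩ := hL.exists_isGrad_hamHat hM hk
    rw [hL.bracket₁_eq hM hx (hL.isGrad_ham hk), hL.bracket₁_eq hM hx (hL.isGrad_hamHat hk),
      hL.bracket₂_eq hM hx hy, hL.bracket₂_eq hM hx hz, hL.tensD_ham hk, hL.tensD_hamHat hk, ey, ez,
      ← hx.var, ← hx.var]
    exact ⟨⟨rfl, rfl⟩, rfl, rfl⟩
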